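/- Let $(X,Y)$ be a pair of real random variables ($d_x=d_y=1$) with joint probability density $f$ on $\mathbb R^2$ and marginal densities $f_X,f_Y$, and let $I(X;Y)=H(X)+H(Y)-H(X,Y)$, where $H$ denotes differential entropy $-\int g\log g$. Let $k\ge 1$ be an integer, $\delta>0$, and let $C_a,C_b,C_c,C_d,C_e,C_f,C_g,C_h$ and $C_0>0$ be finite constants. Suppose that - (a) $f\le C_a$ almost everywhere; - (b) for some $\gamma>0$, $\int f\,|\log f|^{1+\gamma}\le C_b$; - (c) $\int f e^{-bf}\le C_c e^{-C_0 b}$ for all $b>1$; - (d) for almost every $z\in\mathbb R^2$, $f$ is twice continuously differentiable at (i.e. in a neighbourhood of) $z$ and its Hessian at $z$ has spectral norm $<C_d$; - (e) the conditional densities satisfy $f_{Y|X}(y|x)<C_e$ and $f_{X|Y}(x|y)<C_e$ almost everywhere (where they are defined); - (f) $f_X<C_f$ and $f_Y<C_f$ almost everywhere; - (g) the set of points of $\mathbb R^2$ at which the condition in (d) fails has 1-dimensional Hausdorff measure at most $C_g$; - (h) the set of $x\in\mathbb R$ at which $f_X$ is not twice continuously differentiable or $|f_X''(x)|\ge C_d$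 has 0-dimensional Hausdorff measure (cardinality) at most $C_h$, and likewise for $f_Y$. Given $N>k$ i.i.d. samples $(X_i,Y_i)$ of $(X,Y)$ and $p\in\{2,\infty\}$, let $\rho_{k,i,p}$ be the $\ell_p$ distance from $(X_i,Y_i)$ to its $k$-th nearest neighbour among the other samples, $n_{x,i,p}=\#\{j\ne i:|X_j-X_i|\le\rho_{k,i,p}\}$, $n_{y,i,p}=\#\{j\ne i:|Y_j-Y_i|\le\rho_{k,i,p}\}$, and $a_N=\big((\log N)^{1+\delta}/N\big)^{1/2}$. With $\psi=\Gamma'/\Gamma$ and $c_d=\pi^{d/2}/\Gamma(d/2+1)$, let $$\iota_{k,i,\infty}=\psi(k)+\log N-\psi(n_{x,i,\infty}+1)-\psi(n_{y,i,\infty}+1)\ \text{ if }\rho_{k,i,\infty}\le a_N,\qquad \iota_{k,i,\infty}=0\ \text{ otherwise},$$ $$\iota_{k,i,2}=\psi(k)+\log N+\log\frac{c_1c_1}{c_2}-\log n_{x,i,2}-\log n_{y,i,2}\ \text{ if }\rho_{k,i,2}\le a_N,\qquad \iota_{k,i,2}=0\ \text{ otherwise},$$ and let $\widehat I_{\rm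 tKSG}=\frac1N\sum_{i=1}^N\iota_{k,i,\infty}$ and $\widehat I_{\rm tBI-KSG}=\frac1N\sum_{i=1}^N\iota_{k,i,2}$ be the truncated KSG and BI-KSG estimators. Then, as $N\to\infty$, $$\mathbb E\big[(\widehat I_{\rm tKSG}-I(X;Y))^2\big]=O\!\left(\frac{(\log N)^{(2k+2)(1+\delta)}}{N}\right),\qquad \mathbb E\big[(\widehat I_{\rm tBI-KSG}-I(X;Y))^2\big]=O\!\left(\frac{(\log N)^{(2k+2)(1+\delta)}}{N}\right),$$ where the implied constant, and the $N$ from which the bounds hold, depend only on $k$, $\delta$ and the constants $C_a,\dots,C_h,C_0$. -/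

import Mathlib

open MeasureTheory ProbabilityTheory
open scoped ENNReal

noncomputable section

namespace KSG

/-- The real digamma function `ψ = Γ' / Γ`. -/
def digamma (x : ℝ) : ℝ := logDeriv Real.Gamma x

/-- Volume of the `d`-dimensional Euclidean unit ball, `π ^ (d/2) / Γ (d/2 + 1)`. -/
def ballVol (d : ℕ) : ℝ := Real.pi ^ ((d : ℝ) / 2) / Real.Gamma ((d : ℝ) / 2 + 1)

/-! ### Densities, entropy and mutual information -/

/-- `f` is a probability density on the plane (with respect to Lebesgue measure). -/
structure IsPdf (f : ℝ × ℝ → ℝ) : Prop where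
  measurable : Measurable f
  nonneg : ∀ z, 0 ≤ f z
  lintegral_eq_one : ∫⁻ z, ENNReal.ofReal (f z) = 1

/-- The law with density `f`. -/
def law (f : ℝ × ℝ → ℝ) : Measure (ℝ × ℝ) :=
  volume.withDensity fun z => ENNReal.ofReal (f z)

/-- The marginal density of the first coordinate. -/
def margX (f : ℝ × ℝ → ℝ) (x : ℝ) : ℝ := ∫ y, f (x, y)

/-- The marginal density of the second coordinate. -/
def margY (f : ℝ × ℝ → ℝ) (y : ℝ) : ℝ := ∫ x, f (x, y)

/-- Differential entropy `-∫ g log g` of a density `g` (with `0 log 0 = 0`). -/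
def entropy {E : Type*} [MeasureSpace E] (g : E → ℝ) : ℝ := -∫ z, g z * Real.log (g z)

/-- Mutual information `I(X;Y) = H(X) + H(Y) - H(X,Y)` of a pair with joint density `f`. -/
def mutualInfo (f : ℝ × ℝ → ℝ) : ℝ := entropy (margX f) + entropy (margY f) - entropy f

/-! ### The regularity class -/

/-- `g` is twice continuously differentiable at (that is, in a neighbourhood of) `z`, with Hessian
of operator norm less than `C` at `z`. For a Euclidean space `E` this is the spectral norm. -/
def RegularAt {E : Type*} [NormedAddCommGroup E] [NormedSpace ℝ E] (C : ℝ) (g : E → ℝ) (z : E) :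
    Prop :=
  ContDiffAt ℝ 2 g z ∧ ‖fderiv ℝ (fderiv ℝ g) z‖ < C

/-- `f`, regarded as a function on the plane with its Euclidean norm. -/
def onPlane (f : ℝ × ℝ → ℝ) : WithLp 2 (ℝ × ℝ) → ℝ := fun z => f (WithLp.ofLp z)

/-- The regularity assumptions on a joint density `f` of two real random variables, with
constants `Ca, …, Ch, C0`. Mathlib's Hausdorff measure `μH[s]` is the unnormalized one,
`lim_{ε → 0} inf ∑ (diam U_i) ^ s`; in particular `μH[0]` is the counting measure. -/
structure RateAssumption (Ca Cb Cc Cd Ce Cf Cg Ch C0 : ℝ) (f : ℝ × ℝ → ℝ) : Prop where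
  bounded : ∀ᵐ z, f z ≤ Ca
  log_moment : ∃ γ : ℝ, 0 < γ ∧
    Integrable (fun z => f z * |Real.log (f z)| ^ (1 + γ)) ∧
    ∫ z, f z * |Real.log (f z)| ^ (1 + γ) ≤ Cb
  tail : ∀ b : ℝ, 1 < b → ∫ z, f z * Real.exp (-b * f z) ≤ Cc * Real.exp (-C0 * b)
  regular : ∀ᵐ z : ℝ × ℝ, RegularAt Cd (onPlane f) (WithLp.toLp 2 z)
  cond_YX : ∀ᵐ z : ℝ × ℝ, margX f z.1 ≠ 0 → f z / margX f z.1 < Ce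
  cond_XY : ∀ᵐ z : ℝ × ℝ, margY f z.2 ≠ 0 → f z / margY f z.2 < Ce
  marg_X : ∀ᵐ x, margX f x < Cf
  marg_Y : ∀ᵐ y, margY f y < Cf
  hausdorff_joint :
    Measure.hausdorffMeasure 1 {z : WithLp 2 (ℝ × ℝ) | ¬ RegularAt Cd (onPlane f) z}
      ≤ ENNReal.ofReal Cg
  hausdorff_X :
    Measure.hausdorffMeasure 0 {x : ℝ | ¬ RegularAt Cd (margX f) x} ≤ ENNReal.ofReal Ch
  hausdorff_Y :
    Measure.hausdorffMeasure 0 {y : ℝ | ¬ RegularAt Cd (margY f) y} ≤ ENNReal.ofReal Ch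

/-! ### The estimators

A sample is `s : Fin N → ℝ × ℝ`, with `s i = (X_i, Y_i)`; the `ℓ_p` distance is used for
`p = ∞` and `p = 2`. -/

/-- The `ℓ_p` distance on the plane. -/
def lpDist (p : ℝ≥0∞) (z w : ℝ × ℝ) : ℝ := dist (WithLp.toLp p z) (WithLp.toLp p w)

/-- `ρ_{k,i,p}`: the `ℓ_p` distance from the `i`-th sample point to its `k`-th nearest neighbour
among the others, i.e. the least `r` such that at least `k` other sample points are within
distance `r` (meaningful for `1 ≤ k < N`). -/
def knnDist (p : ℝ≥0∞) (k : ℕ) {N : ℕ} (s : Fin N → ℝ × ℝ) (i : Fin N) : ℝ :=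
  sInf {r : ℝ | k ≤ Set.ncard {j : Fin N | j ≠ i ∧ lpDist p (s j) (s i) ≤ r}}

/-- `n_{x,i,p}`: the number of `j ≠ i` with `|X_j - X_i| ≤ ρ_{k,i,p}`. -/
def countX (p : ℝ≥0∞) (k : ℕ) {N : ℕ} (s : Fin N → ℝ × ℝ) (i : Fin N) : ℕ :=
  Set.ncard {j : Fin N | j ≠ i ∧ |(s j).1 - (s i).1| ≤ knnDist p k s i}

/-- `n_{y,i,p}`: the number of `j ≠ i` with `|Y_j - Y_i| ≤ ρ_{k,i,p}`. -/
def countY (p : ℝ≥0∞) (k : ℕ) {N : ℕ} (s : Fin N → ℝ × ℝ) (i : Fin N) : ℕ :=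
  Set.ncard {j : Fin N | j ≠ i ∧ |(s j).2 - (s i).2| ≤ knnDist p k s i}

/-- The truncation threshold `a_N = ((log N)^(1+δ) / N)^(1/(d_x+d_y))` for `d_x = d_y = 1`. -/
def threshold (δ : ℝ) (N : ℕ) : ℝ := (Real.log N ^ (1 + δ) / N) ^ ((1 : ℝ) / (1 + 1))

open Classical in
/-- The truncated local information estimate of the KSG estimator (`ℓ_∞` distance). -/
def iotaKSG (k : ℕ) (δ : ℝ) {N : ℕ} (s : Fin N → ℝ × ℝ) (i : Fin N) : ℝ :=
  if knnDist ∞ k s i ≤ threshold δ N then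
    digamma k + Real.log N - digamma (countX ∞ k s i + 1) - digamma (countY ∞ k s i + 1)
  else 0

open Classical in
/-- The truncated local information estimate of the BI-KSG estimator (`ℓ_2` distance), for
`d_x = d_y = 1`. -/
def iotaBIKSG (k : ℕ) (δ : ℝ) {N : ℕ} (s : Fin N → ℝ × ℝ) (i : Fin N) : ℝ :=
  if knnDist 2 k s i ≤ threshold δ N then
    digamma k + Real.log N + Real.log (ballVol 1 * ballVol 1 / ballVol (1 + 1))
      - Real.log (countX 2 k s i) - Real.log (countY 2 k s i)
  else 0

/-- The truncated KSG estimator. -/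
def tKSG (k : ℕ) (δ : ℝ) {N : ℕ} (s : Fin N → ℝ × ℝ) : ℝ :=
  (1 / (N : ℝ)) * ∑ i, iotaKSG k δ s i

/-- The truncated bias-improved KSG estimator. -/
def tBIKSG (k : ℕ) (δ : ℝ) {N : ℕ} (s : Fin N → ℝ × ℝ) : ℝ :=
  (1 / (N : ℝ)) * ∑ i, iotaBIKSG k δ s i

end KSG

end

noncomputable section

namespace KSG

/-! ### Norms on the plane -/

/-! The mean squared error is the variance plus the squared bias, and the two are bounded by
unrelated arguments. Both estimators are averages of one statistic `loc`, built from a planar norm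
with unit ball of area c (`PlaneNorm`) and a function G squeezed between log n and log n + 1/n
(`LogLike`), so everything is proved once for such pairs.

Variance. Delete one sample point j. It belongs to the k nearest neighbours of at most 8k other
points, by a pigeonhole over octants (`card_affected_le`). For every other point the radius is
unchanged and only the marginal counts drop by at most one, which costs 1/n; summed over the points
whose strip contains point j these costs form a harmonic sum (`sum_inv_le`). Hence moving a point
changes the sum of local estimates by O(log N) (`abs_sum_loc_sub_le`), and
`variance_le_of_bounded_differences` gives variance O((log N)²/N).

Regularity. The exponential tail bound forces f to be bounded below where it is nonzero
(`IsPdf.ae_lower_of_tail`). The singular set has finite length, so almost every axis-parallel line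
meets it in finitely many points, with integrable number (`exists_fibre_count_le`). Between two such
points f is identically zero or bounded below, hence lives on an interval of bounded length, and the
second derivative bound controls its increments. The outcome is the L¹ modulus ∫ |f(z + h) - f(z)|
dz = O(|h|), valid even though f jumps (`PiecewiseSmooth.lintegral_translate_le`,
`lintegral_translate_fst_le`).

Bias. Fix z and condition on the position w of the k-th neighbour (`integral_loc`); let r be its
distance and p the mass of the ball of radius r. Given k - 1 points in the ball, the mean of G(n_x)
is log(N · 2r · f_X) up to O(r + 1/(Nr)) (`abs_integral_hits_log_le`). The mean of -log p is exact:
p is uniform on (0, 1] when w is drawn from the law (`map_cdf_eq_uniform`), and a beta integral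
(`integral_bin_log`) makes ψ(k) cancel. What remains is the deviation of p/(c r²) from f(z), of
order r on average over z by the L¹ modulus; an exceptional set of mass O(a_N)
(`Regular.exists_bad`); and the event that the radius exceeds a_N, negligible because N a_N² = (log
N)^(1+δ). Writing t for this last quantity, the bias is O(t^(k+1)/√N). Throughout the bias argument
q = k - 1 and m = N - 3. -/

/-- The octant of the plane in which a vector lies. -/
def octant (u : ℝ × ℝ) : Bool × Bool × Bool :=
  (decide (0 ≤ u.1), decide (0 ≤ u.2), decide (|u.2| ≤ |u.1|))

/-- The properties of the `ℓ_2` and `ℓ_∞` norms `ν` on the plane that matter for nearest neighbour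
statistics; `c` is the area of the unit ball. -/
structure PlaneNorm (ν : ℝ × ℝ → ℝ) (c : ℝ) : Prop where
  continuous : Continuous ν
  neg : ∀ h, ν (-h) = ν h
  fst_le : ∀ h, |h.1| ≤ ν h
  snd_le : ∀ h, |h.2| ≤ ν h
  volume_le : ∀ r, 0 ≤ r → volume {h | ν h ≤ r} = ENNReal.ofReal (c * r ^ 2)
  pos : 0 < c
  octant : ∀ u v, octant u = octant v → ν v ≤ ν u → ν (v - u) ≤ ν u

def supNorm (h : ℝ × ℝ) : ℝ := max |h.1| |h.2|

def eucNorm (h : ℝ × ℝ) : ℝ := √(h.1 ^ 2 + h.2 ^ 2)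

theorem lpDist_top (z w : ℝ × ℝ) : lpDist ∞ z w = supNorm (z - w) := by
  simp [lpDist, supNorm, WithLp.prod_dist_eq_sup, Real.dist_eq]

theorem lpDist_two (z w : ℝ × ℝ) : lpDist 2 z w = eucNorm (z - w) := by
  simp [lpDist, eucNorm, WithLp.prod_dist_eq_of_L2, Real.dist_eq]

theorem abs_sub_le_of_same_sign {a b s : ℝ} (h : 0 ≤ a ↔ 0 ≤ b) (ha : |a| ≤ s) (hb : |b| ≤ s) :
    |b - a| ≤ s := by
  rw [abs_le] at *
  by_cases h0 : 0 ≤ a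
  · have := h.1 h0
    constructor <;> linarith
  · have : ¬ 0 ≤ b := fun hb => h0 (h.2 hb)
    push Not at *
    constructor <;> linarith

theorem planeNorm_supNorm : PlaneNorm supNorm 4 where
  continuous := by unfold supNorm; fun_prop
  neg h := by simp [supNorm]
  fst_le h := le_max_left _ _
  snd_le h := le_max_right _ _
  volume_le r hr := by
    have : {h : ℝ × ℝ | supNorm h ≤ r} = Set.Icc (-r) r ×ˢ Set.Icc (-r) r := by
      ext h
      simp only [supNorm, abs_le, Set.mem_prod, Set.mem_ofPred_eq, max_le_iff, Set.mem_Icc]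
    rw [this, Measure.volume_eq_prod, Measure.prod_prod, Real.volume_Icc,
      ← ENNReal.ofReal_mul (by linarith)]
    congr 1; ring
  pos := by norm_num
  octant u v h hv := by
    simp only [KSG.octant, Prod.mk.injEq, decide_eq_decide] at h
    unfold supNorm at *
    exact max_le (abs_sub_le_of_same_sign h.1 (le_max_left _ _) ((le_max_left _ _).trans hv))
      (abs_sub_le_of_same_sign h.2.1 (le_max_right _ _) ((le_max_right _ _).trans hv))

theorem mul_nonneg_of_same_sign {a b : ℝ} (h : 0 ≤ a ↔ 0 ≤ b) : 0 ≤ a * b := by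
  by_cases h0 : 0 ≤ a
  · exact mul_nonneg h0 (h.1 h0)
  · have : ¬ 0 ≤ b := fun hb => h0 (h.2 hb)
    push Not at *
    nlinarith

theorem planeNorm_eucNorm : PlaneNorm eucNorm Real.pi where
  continuous := by unfold eucNorm; fun_prop
  neg h := by simp [eucNorm]
  fst_le h := Real.abs_le_sqrt (by nlinarith [sq_nonneg h.2])
  snd_le h := Real.abs_le_sqrt (by nlinarith [sq_nonneg h.1])
  volume_le r hr := by
    have h1 := (Complex.volume_preserving_equiv_real_prod).measure_preimage
      (s := {h : ℝ × ℝ | eucNorm h ≤ r}) (by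
        apply MeasurableSet.nullMeasurableSet
        exact measurableSet_le (by unfold eucNorm; fun_prop) measurable_const)
    have h2 : Complex.measurableEquivRealProd ⁻¹' {h : ℝ × ℝ | eucNorm h ≤ r}
        = Metric.closedBall 0 r := by
      ext z
      simp [eucNorm, Complex.norm_eq_sqrt_sq_add_sq]
    rw [← h1, h2, Complex.volume_closedBall, ← ENNReal.ofReal_pow hr, mul_comm Real.pi,
      ENNReal.ofReal_mul (by positivity)]
    congr 1
    rw [ENNReal.ofReal, ← NNReal.coe_real_pi, Real.toNNReal_coe]
  pos := Real.pi_pos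
  octant u v h hv := by
    simp only [KSG.octant, Prod.mk.injEq, decide_eq_decide] at h
    obtain ⟨h1, h2, h3⟩ := h
    unfold eucNorm at *
    apply Real.sqrt_le_sqrt
    have hv' := (Real.sqrt_le_sqrt_iff (by positivity)).1 hv
    have p1 := mul_nonneg_of_same_sign h1
    have p2 := mul_nonneg_of_same_sign h2
    have p3 : 0 ≤ (u.1 ^ 2 - u.2 ^ 2) * (v.1 ^ 2 - v.2 ^ 2) := by
      apply mul_nonneg_of_same_sign
      rw [sub_nonneg, sub_nonneg, sq_le_sq, sq_le_sq, h3]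
    -- The angle between the vectors is at most 45°, algebraically: 2⟨u,v⟩² - |u|²|v|² = (u₁² -
    -- u₂²)(v₁² - v₂²) + 4u₁u₂v₁v₂, and both terms are nonnegative in a common octant. Together with
    -- |v| ≤ |u| this yields |v|² ≤ 2⟨u,v⟩, which is |v - u| ≤ |u|.
    have p4 : (v.1 ^ 2 + v.2 ^ 2) ^ 2 ≤ (2 * (u.1 * v.1 + u.2 * v.2)) ^ 2 := by
      nlinarith [mul_nonneg p1 p2, sq_nonneg (u.1 * v.1 + u.2 * v.2),
        mul_le_mul_of_nonneg_right hv' (by positivity : 0 ≤ v.1 ^ 2 + v.2 ^ 2)]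
    have p5 := abs_le_of_sq_le_sq p4 (by positivity)
    simp only [Prod.fst_sub, Prod.snd_sub]
    nlinarith [(abs_le.1 p5).2]

namespace PlaneNorm

variable {ν : ℝ × ℝ → ℝ} {c : ℝ}

theorem nonneg (hν : PlaneNorm ν c) (h : ℝ × ℝ) : 0 ≤ ν h := (abs_nonneg _).trans (hν.fst_le h)

theorem measurable (hν : PlaneNorm ν c) : Measurable ν := hν.continuous.measurable

theorem sub_comm (hν : PlaneNorm ν c) (z w : ℝ × ℝ) : ν (z - w) = ν (w - z) := by
  rw [← hν.neg, neg_sub]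

/-- A sphere lies between two concentric balls whose areas c s² and c r² can be made arbitrarily
close. This is what excludes ties among neighbour distances and atoms in the law of the distance. -/
theorem volume_sphere (hν : PlaneNorm ν c) (r : ℝ) : volume {h | ν h = r} = 0 := by
  rcases lt_or_ge r 0 with hr | hr
  · have : {h | ν h = r} = ∅ := by
      ext h
      simp only [Set.mem_ofPred_eq, Set.mem_empty_iff_false, iff_false]
      exact (hr.trans_le (hν.nonneg h)).ne'
    simp [this]
  have key : ∀ ε ∈ Set.Ioo (0 : ℝ) 1, volume {h | ν h = r} ≤
      ENNReal.ofReal (c * (r + ε) ^ 2 - c * r ^ 2 + ε) := by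
    intro ε hε
    rcases hr.eq_or_lt with rfl | hr
    · refine (measure_mono (t := {h | ν h ≤ ε}) fun h hh => ?_).trans ?_
      · simp only [Set.mem_ofPred_eq] at *; linarith [hε.1]
      · rw [hν.volume_le _ hε.1.le]
        apply ENNReal.ofReal_le_ofReal
        nlinarith [hε.1]
    · obtain ⟨s, hs0, hsr, hs⟩ : ∃ s, 0 ≤ s ∧ s < r ∧ c * r ^ 2 - c * s ^ 2 ≤ ε := by
        have : Filter.Tendsto (fun s => c * r ^ 2 - c * s ^ 2) (nhdsWithin r (Set.Iio r))
            (nhds (c * r ^ 2 - c * r ^ 2)) := by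
          apply Filter.Tendsto.mono_left _ nhdsWithin_le_nhds
          apply Continuous.tendsto
          fun_prop
        have e1 := this.eventually (gt_mem_nhds (by simpa using hε.1 : _ < ε))
        have e2 : ∀ᶠ s in nhdsWithin r (Set.Iio r), s ∈ Set.Ioo 0 r := Ioo_mem_nhdsLT hr
        obtain ⟨s, h1, h2⟩ := (e1.and e2).exists
        exact ⟨s, h2.1.le, h2.2, h1.le⟩
      have h1 : volume {h | ν h = r} + volume {h | ν h ≤ s} ≤ volume {h | ν h ≤ r} := by
        rw [← measure_union]
        · apply measure_mono
          rintro h (hh | hh) <;> simp only [Set.mem_ofPred_eq] at * <;> linarith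
        · rw [Set.disjoint_left]
          intro h h1 h2
          simp only [Set.mem_ofPred_eq] at *
          linarith
        · exact measurableSet_le hν.measurable measurable_const
      rw [hν.volume_le _ hs0, hν.volume_le _ hr.le] at h1
      have h2 := ENNReal.le_sub_of_add_le_right ENNReal.ofReal_ne_top h1
      rw [← ENNReal.ofReal_sub _ (by have := hν.pos; positivity)] at h2
      refine h2.trans (ENNReal.ofReal_le_ofReal ?_)
      have := hν.pos
      have : c * r ^ 2 ≤ c * (r + ε) ^ 2 := by
        gcongr
        linarith [hε.1]
      linarith
  have lim : Filter.Tendsto (fun ε => ENNReal.ofReal (c * (r + ε) ^ 2 - c * r ^ 2 + ε))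
      (nhdsWithin 0 (Set.Ioi 0)) (nhds 0) := by
    have : Filter.Tendsto (fun ε => c * (r + ε) ^ 2 - c * r ^ 2 + ε) (nhdsWithin 0 (Set.Ioi 0))
        (nhds (c * (r + 0) ^ 2 - c * r ^ 2 + 0)) := by
      apply Filter.Tendsto.mono_left _ nhdsWithin_le_nhds
      apply Continuous.tendsto
      fun_prop
    have := ENNReal.tendsto_ofReal this
    simpa using this
  refine le_antisymm (ge_of_tendsto lim ?_) bot_le
  filter_upwards [Ioo_mem_nhdsGT (zero_lt_one' ℝ)] with ε hε using key ε hε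

end PlaneNorm

/-! ### Functions between the logarithm and the shifted digamma function -/

/-- A function on the positive integers that agrees with `log` up to `1 / n`. -/
structure LogLike (G : ℕ → ℝ) : Prop where
  log_le : ∀ n : ℕ, 1 ≤ n → Real.log n ≤ G n
  le_log : ∀ n : ℕ, 1 ≤ n → G n ≤ Real.log n + 1 / n
  step : ∀ n : ℕ, 1 ≤ n → |G (n + 1) - G n| ≤ 1 / n

theorem logLike_log : LogLike fun n => Real.log n where
  log_le n _ := le_rfl
  le_log n hn := by simp
  step n hn := by
    have hn' : (0 : ℝ) < n := by exact_mod_cast hn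
    push_cast
    have h1 : Real.log (n + 1) - Real.log n = Real.log ((n + 1) / n) := by
      rw [Real.log_div (by positivity) (by positivity)]
    rw [h1, abs_of_nonneg (Real.log_nonneg (by rw [le_div_iff₀ hn']; linarith))]
    refine (Real.log_le_sub_one_of_pos (by positivity)).trans (le_of_eq ?_)
    field_simp
    ring

theorem digamma_nat (n : ℕ) :
    digamma (n + 1) = -Real.eulerMascheroniConstant + harmonic n := by
  rw [digamma, logDeriv_apply, Real.deriv_Gamma_nat, Real.Gamma_nat_eq_factorial]
  field_simp

/-- ψ(n + 1) is H_n - γ, and γ is bracketed by the decreasing sequence H_n - log n and the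
increasing sequence H_(n-1) - log n. The second is the source of the 1/n. -/
theorem logLike_digamma : LogLike fun n => digamma (n + 1) where
  log_le n hn := by
    rw [digamma_nat]
    have h2 := Real.eulerMascheroniConstant_lt_eulerMascheroniSeq' n
    simp only [Real.eulerMascheroniSeq', if_neg (show n ≠ 0 by omega)] at h2
    linarith
  le_log n hn := by
    have hn' : (0 : ℝ) < n := by exact_mod_cast hn
    obtain ⟨m, rfl⟩ : ∃ m, n = m + 1 := ⟨n - 1, by omega⟩
    rw [digamma_nat]
    have h2 := Real.eulerMascheroniSeq_lt_eulerMascheroniConstant m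
    simp only [Real.eulerMascheroniSeq] at h2
    rw [harmonic_succ]
    push_cast
    rw [one_div]
    linarith
  step n hn := by
    have hn' : (0 : ℝ) < n := by exact_mod_cast hn
    rw [digamma_nat, digamma_nat, harmonic_succ]
    push_cast
    have : -Real.eulerMascheroniConstant + ((harmonic n : ℝ) + (n + 1 : ℝ)⁻¹) -
        (-Real.eulerMascheroniConstant + harmonic n) = 1 / (n + 1) := by
      rw [one_div]; ring
    rw [this, abs_of_pos (by positivity)]
    apply one_div_le_one_div_of_le hn' (by linarith)

theorem LogLike.bounds {G : ℕ → ℝ} (hG : LogLike G) {n N : ℕ} (hn : 1 ≤ n) (hN : n ≤ N) :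
    0 ≤ G n ∧ G n ≤ Real.log N + 1 := by
  have hn' : (1 : ℝ) ≤ n := by exact_mod_cast hn
  have hN' : (n : ℝ) ≤ N := by exact_mod_cast hN
  constructor
  · exact (Real.log_nonneg hn').trans (hG.log_le n hn)
  · refine (hG.le_log n hn).trans (add_le_add (Real.log_le_log (by linarith) hN') ?_)
    rw [div_le_one (by linarith)]
    exact hn'

/-! ### Nearest neighbour statistics relative to a finite set of sample points -/

section Local

variable {ι : Type*}

/-- Distance from `z` to its `k`-th nearest neighbour among the points `s l`, `l ∈ T`. -/
def kRad (ν : ℝ × ℝ → ℝ) (k : ℕ) (T : Finset ι) (s : ι → ℝ × ℝ) (z : ℝ × ℝ) : ℝ :=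
  sInf {r : ℝ | k ≤ (T.filter fun l => ν (s l - z) ≤ r).card}

def cntX (T : Finset ι) (s : ι → ℝ × ℝ) (z : ℝ × ℝ) (r : ℝ) : ℕ :=
  (T.filter fun l => |(s l).1 - z.1| ≤ r).card

def cntY (T : Finset ι) (s : ι → ℝ × ℝ) (z : ℝ × ℝ) (r : ℝ) : ℕ :=
  (T.filter fun l => |(s l).2 - z.2| ≤ r).card

/-- The common form of the truncated local information estimates. -/
def loc (ν : ℝ × ℝ → ℝ) (k : ℕ) (G : ℕ → ℝ) (κ a : ℝ) (T : Finset ι) (s : ι → ℝ × ℝ)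
    (z : ℝ × ℝ) : ℝ :=
  if kRad ν k T s z ≤ a then
    κ - G (cntX T s z (kRad ν k T s z)) - G (cntY T s z (kRad ν k T s z))
  else 0

variable {ν : ℝ × ℝ → ℝ} {c : ℝ} {k : ℕ} {T T' : Finset ι} {s s' : ι → ℝ × ℝ} {z : ℝ × ℝ}

/-- The count only changes at the finitely many distances ν (s l - z), so the infimum is one of them
and is attained. -/
theorem kRad_isLeast (hk : 1 ≤ k) (hT : k ≤ T.card) :
    IsLeast {r : ℝ | k ≤ (T.filter fun l => ν (s l - z) ≤ r).card} (kRad ν k T s z) := by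
  classical
  set W := (T.image fun l => ν (s l - z)).filter
    fun r => k ≤ (T.filter fun l => ν (s l - z) ≤ r).card with hW
  have key : ∀ r, k ≤ (T.filter fun l => ν (s l - z) ≤ r).card → ∃ v ∈ W, v ≤ r := by
    intro r hr
    have hne : (T.filter fun l => ν (s l - z) ≤ r).Nonempty := by
      rw [← Finset.card_pos]; omega
    obtain ⟨m, hm, hmax⟩ := Finset.exists_max_image _ (fun l => ν (s l - z)) hne
    rw [Finset.mem_filter] at hm
    refine ⟨ν (s m - z), ?_, hm.2⟩
    rw [hW, Finset.mem_filter]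
    refine ⟨Finset.mem_image_of_mem _ hm.1, hr.trans (Finset.card_le_card ?_)⟩
    intro l hl
    rw [Finset.mem_filter]
    exact ⟨(Finset.mem_filter.1 hl).1, hmax l hl⟩
  have hWne : W.Nonempty := by
    have hne : T.Nonempty := by rw [← Finset.card_pos]; omega
    obtain ⟨m, hm, hmax⟩ := Finset.exists_max_image _ (fun l => ν (s l - z)) hne
    obtain ⟨v, hv, -⟩ := key (ν (s m - z)) (by
      rwa [Finset.filter_true_of_mem hmax])
    exact ⟨v, hv⟩
  have : IsLeast {r : ℝ | k ≤ (T.filter fun l => ν (s l - z) ≤ r).card} (W.min' hWne) := by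
    refine ⟨(Finset.mem_filter.1 (W.min'_mem hWne)).2, fun r hr => ?_⟩
    obtain ⟨v, hv, hvr⟩ := key r hr
    exact (W.min'_le v hv).trans hvr
  rw [kRad, this.csInf_eq]
  exact this

theorem kRad_spec (hk : 1 ≤ k) (hT : k ≤ T.card) :
    k ≤ (T.filter fun l => ν (s l - z) ≤ kRad ν k T s z).card := (kRad_isLeast hk hT).1

theorem kRad_le (hk : 1 ≤ k) (hT : k ≤ T.card) {r : ℝ}
    (hr : k ≤ (T.filter fun l => ν (s l - z) ≤ r).card) : kRad ν k T s z ≤ r :=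
  (kRad_isLeast hk hT).2 hr

theorem kRad_le_iff (hk : 1 ≤ k) (hT : k ≤ T.card) {r : ℝ} :
    kRad ν k T s z ≤ r ↔ k ≤ (T.filter fun l => ν (s l - z) ≤ r).card := by
  refine ⟨fun h => (kRad_spec (ν := ν) (s := s) (z := z) hk hT).trans
    (Finset.card_le_card ?_), kRad_le hk hT⟩
  exact Finset.monotone_filter_right _ fun l _ hl => hl.trans h

theorem le_cntX (hν : PlaneNorm ν c) (hk : 1 ≤ k) (hT : k ≤ T.card) :
    k ≤ cntX T s z (kRad ν k T s z) :=
  (kRad_spec hk hT).trans (Finset.card_le_card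
    (Finset.monotone_filter_right _ fun l _ hl => (hν.fst_le (s l - z)).trans hl))

theorem le_cntY (hν : PlaneNorm ν c) (hk : 1 ≤ k) (hT : k ≤ T.card) :
    k ≤ cntY T s z (kRad ν k T s z) :=
  (kRad_spec hk hT).trans (Finset.card_le_card
    (Finset.monotone_filter_right _ fun l _ hl => (hν.snd_le (s l - z)).trans hl))

theorem loc_congr {G : ℕ → ℝ} {κ a : ℝ} (h : ∀ l ∈ T, s l = s' l) :
    loc ν k G κ a T s z = loc ν k G κ a T s' z := by
  have h1 : kRad ν k T s z = kRad ν k T s' z := by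
    unfold kRad
    congr 1
    ext r
    rw [Set.mem_ofPred_eq, Set.mem_ofPred_eq, Finset.filter_congr fun l hl => by rw [h l hl]]
  have h2 : ∀ r, cntX T s z r = cntX T s' z r := fun r => by
    unfold cntX
    rw [Finset.filter_congr fun l hl => by rw [h l hl]]
  have h3 : ∀ r, cntY T s z r = cntY T s' z r := fun r => by
    unfold cntY
    rw [Finset.filter_congr fun l hl => by rw [h l hl]]
  unfold loc
  rw [h1, h2, h3]

theorem loc_map {ι' : Type*} (e : ι' ↪ ι) (U : Finset ι') {G : ℕ → ℝ} {κ a : ℝ} :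
    loc ν k G κ a (U.map e) s z = loc ν k G κ a U (s ∘ e) z := by
  unfold loc kRad cntX cntY
  simp only [Finset.filter_map, Finset.card_map]
  rfl

theorem abs_loc_le (hν : PlaneNorm ν c) {G : ℕ → ℝ} (hG : LogLike G) {κ a : ℝ} {N : ℕ}
    (hk : 1 ≤ k) (hT : k ≤ T.card) (hN : T.card ≤ N) :
    |loc ν k G κ a T s z| ≤ |κ| + 2 * (Real.log N + 1) := by
  have hl : 0 ≤ Real.log N := Real.log_natCast_nonneg N
  unfold loc
  split_ifs with h
  · have h1 := hG.bounds (hk.trans (le_cntX (s := s) (z := z) hν hk hT))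
      ((Finset.card_filter_le _ _).trans hN)
    have h2 := hG.bounds (hk.trans (le_cntY (s := s) (z := z) hν hk hT))
      ((Finset.card_filter_le _ _).trans hN)
    unfold cntX cntY at *
    rw [abs_le]
    constructor <;> cases abs_cases κ <;> linarith
  · rw [abs_zero]; positivity

/-! ### Effect of a single sample point -/

/-- Order the points by x: the i-th smallest has n ≥ max(1, i - 1), so 1/n ≤ 2/i. The induction
removes the point with the largest x. -/
theorem sum_inv_le_harmonic (T : Finset ι) (x : ι → ℝ) (n : ι → ℕ) (h1 : ∀ i ∈ T, 1 ≤ n i)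
    (h2 : ∀ i ∈ T, (T.filter fun l => x l ≤ x i).card ≤ n i + 1) :
    ∑ i ∈ T, (1 : ℝ) / n i ≤ 2 * (harmonic T.card : ℝ) := by
  classical
  induction T using Finset.induction_on_max_value x with
  | empty => simp
  | insert a t hat hmax ih =>
    rw [Finset.sum_insert hat, Finset.card_insert_of_notMem hat, harmonic_succ]
    have h3 := ih (fun i hi => h1 i (Finset.mem_insert_of_mem hi)) fun i hi =>
      (Finset.card_le_card (Finset.filter_subset_filter _ (Finset.subset_insert _ _))).trans
        (h2 i (Finset.mem_insert_of_mem hi))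
    have h4 := h2 a (Finset.mem_insert_self _ _)
    rw [Finset.filter_true_of_mem, Finset.card_insert_of_notMem hat] at h4
    · have h5 : (1 : ℝ) ≤ n a := by exact_mod_cast h1 a (Finset.mem_insert_self _ _)
      have h6 : (t.card : ℝ) ≤ n a := by exact_mod_cast (by omega : t.card ≤ n a)
      have h7 : (1 : ℝ) / n a ≤ 2 * (t.card + 1 : ℝ)⁻¹ := by
        rw [← div_eq_mul_inv, div_le_div_iff₀ (by linarith) (by positivity)]
        linarith
      push_cast
      linarith
    · intro l hl
      rcases Finset.mem_insert.1 hl with rfl | hl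
      · exact le_rfl
      · exact hmax l hl

/-- Each window reaches back to x₀, which lies to the left of all the points, so the window of a
point covers every point of T to its left. That is the hypothesis of `sum_inv_le_harmonic`. -/
theorem sum_inv_le_of_forward [DecidableEq ι] (T : Finset ι) (x ρ : ι → ℝ) (n : ι → ℕ) (x₀ : ℝ) {N : ℕ}
    (hN : T.card ≤ N) (h1 : ∀ i ∈ T, 1 ≤ n i) (hx : ∀ i ∈ T, |x₀ - x i| ≤ ρ i)
    (hx0 : ∀ i ∈ T, x₀ ≤ x i)
    (h2 : ∀ i ∈ T, (T.filter fun l => l ≠ i ∧ |x l - x i| ≤ ρ i).card ≤ n i) :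
    ∑ i ∈ T, (1 : ℝ) / n i ≤ 2 * (1 + Real.log N) := by
  refine (sum_inv_le_harmonic T x n h1 fun i hi => ?_).trans ?_
  · refine le_trans ?_ (Nat.add_le_add_right (h2 i hi) 1)
    rw [← Finset.card_insert_of_notMem (a := i) (by simp)]
    apply Finset.card_le_card
    intro l hl
    rw [Finset.mem_filter] at hl
    by_cases hli : l = i
    · simp [hli]
    · refine Finset.mem_insert_of_mem (Finset.mem_filter.2 ⟨hl.1, hli, ?_⟩)
      have := hx i hi
      rw [abs_le] at *
      have := hx0 l hl.1
      constructor <;> linarith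
  · have h := harmonic_le_one_add_log T.card
    rcases Nat.eq_zero_or_pos T.card with h0 | h0
    · rw [h0]
      simp only [harmonic_zero, Rat.cast_zero, mul_zero]
      have := Real.log_natCast_nonneg N
      positivity
    · have : Real.log T.card ≤ Real.log N :=
        Real.log_le_log (by exact_mod_cast h0) (by exact_mod_cast hN)
      linarith

/-- The points on each side of x₀ are treated separately; reflection x ↦ -x reduces the left side to
the right one. -/
theorem sum_inv_le [DecidableEq ι] (T : Finset ι) (x ρ : ι → ℝ) (n : ι → ℕ) (x₀ : ℝ) {N : ℕ}
    (hN : T.card ≤ N) (h1 : ∀ i ∈ T, 1 ≤ n i) (hx : ∀ i ∈ T, |x₀ - x i| ≤ ρ i)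
    (h2 : ∀ i ∈ T, (T.filter fun l => l ≠ i ∧ |x l - x i| ≤ ρ i).card ≤ n i) :
    ∑ i ∈ T, (1 : ℝ) / n i ≤ 4 * (1 + Real.log N) := by
  rw [← Finset.sum_filter_add_sum_filter_not T (fun i => x₀ ≤ x i)]
  have hsub : ∀ (p : ι → Prop) [DecidablePred p], ∀ i ∈ T.filter p,
      ((T.filter p).filter fun l => l ≠ i ∧ |x l - x i| ≤ ρ i).card ≤ n i := fun p _ i hi =>
    (Finset.card_le_card (Finset.filter_subset_filter _ (Finset.filter_subset _ _))).trans
      (h2 i (Finset.mem_filter.1 hi).1)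
  have hc : ∀ (p : ι → Prop) [DecidablePred p], (T.filter p).card ≤ N := fun p _ =>
    (Finset.card_filter_le _ _).trans hN
  have e1 := sum_inv_le_of_forward (T.filter fun i => x₀ ≤ x i) x ρ n x₀ (hc _)
    (fun i hi => h1 i (Finset.mem_filter.1 hi).1) (fun i hi => hx i (Finset.mem_filter.1 hi).1)
    (fun i hi => (Finset.mem_filter.1 hi).2) (hsub _)
  have e2 := sum_inv_le_of_forward (T.filter fun i => ¬ x₀ ≤ x i) (fun i => - x i) ρ n (-x₀) (hc _)
    (fun i hi => h1 i (Finset.mem_filter.1 hi).1)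
    (fun i hi => by
      have := hx i (Finset.mem_filter.1 hi).1
      rwa [neg_sub_neg, abs_sub_comm])
    (fun i hi => by have := (Finset.mem_filter.1 hi).2; linarith)
    (by
      have := hsub fun i => ¬ x₀ ≤ x i
      simpa only [neg_sub_neg, abs_sub_comm] using this)
  linarith

theorem kRad_erase [DecidableEq ι] (hk : 1 ≤ k) (j : ι) (hT : k ≤ (T.erase j).card)
    (h : k ≤ ((T.erase j).filter fun l => ν (s l - z) ≤ kRad ν k T s z).card) :
    kRad ν k (T.erase j) s z = kRad ν k T s z := by
  apply le_antisymm
  · exact kRad_le hk hT h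
  · apply kRad_le hk (hT.trans (Finset.card_le_card (Finset.erase_subset _ _)))
    exact (kRad_spec hk hT).trans
      (Finset.card_le_card (Finset.filter_subset_filter _ (Finset.erase_subset _ _)))

theorem card_filter_erase_step [DecidableEq ι] (j : ι) (hj : j ∈ T) (p : ι → Prop)
    [DecidablePred p] {G : ℕ → ℝ} (hG : LogLike G) (h1 : 1 ≤ ((T.erase j).filter p).card) :
    |G (T.filter p).card - G ((T.erase j).filter p).card|
      ≤ if p j then 1 / (((T.erase j).filter p).card : ℝ) else 0 := by
  split_ifs with hp
  · have : (T.filter p).card = ((T.erase j).filter p).card + 1 := by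
      rw [← Finset.card_insert_of_notMem (a := j) (s := (T.erase j).filter p) (by simp)]
      congr 1
      ext l
      simp only [Finset.mem_filter, Finset.mem_insert, Finset.mem_erase]
      grind
    rw [this]
    exact hG.step _ h1
  · have : (T.filter p) = ((T.erase j).filter p) := by
      ext l
      simp only [Finset.mem_filter, Finset.mem_erase]
      grind
    rw [this, sub_self, abs_zero]

/-- If the ball still holds k points after j is removed, the radius, and with it the truncation, is
the same for both point sets. Only the two strip counts can differ, each by at most one, and only
when the strip contains j. -/
theorem abs_loc_sub_loc_erase_le [DecidableEq ι] (hν : PlaneNorm ν c) {G : ℕ → ℝ}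
    (hG : LogLike G) {κ a : ℝ} (hk : 1 ≤ k) (j : ι) (hj : j ∈ T) (hT : k ≤ (T.erase j).card)
    (h : k ≤ ((T.erase j).filter fun l => ν (s l - z) ≤ kRad ν k T s z).card) :
    |loc ν k G κ a T s z - loc ν k G κ a (T.erase j) s z| ≤
      (if |(s j).1 - z.1| ≤ kRad ν k T s z then
        1 / (cntX (T.erase j) s z (kRad ν k T s z) : ℝ) else 0) +
      (if |(s j).2 - z.2| ≤ kRad ν k T s z then
        1 / (cntY (T.erase j) s z (kRad ν k T s z) : ℝ) else 0) := by
  have e := kRad_erase hk j hT h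
  have hX := le_cntX (s := s) (z := z) hν hk hT
  have hY := le_cntY (s := s) (z := z) hν hk hT
  rw [e] at hX hY
  have h1 := card_filter_erase_step j hj (fun l => |(s l).1 - z.1| ≤ kRad ν k T s z) hG
    (hk.trans hX)
  have h2 := card_filter_erase_step j hj (fun l => |(s l).2 - z.2| ≤ kRad ν k T s z) hG
    (hk.trans hY)
  unfold loc
  rw [e]
  unfold cntX cntY at *
  split_ifs at * with h0 <;> first
    | (rw [sub_self, abs_zero]; positivity)
    | (rw [abs_le] at *; constructor <;> linarith)

/-- Among more than 8k affected points, more than k lie in one octant around `s j`. Take the one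
farthest from `s j`: the others in its octant are no farther from it than `s j` is, so its ball
keeps at least k points without j, a contradiction. -/
theorem card_affected_le [Fintype ι] [DecidableEq ι] (hν : PlaneNorm ν c) (hk : 1 ≤ k)
    (hι : k + 2 ≤ Fintype.card ι) (s : ι → ℝ × ℝ) (j : ι) :
    (Finset.univ.filter fun i => i ≠ j ∧ (((Finset.univ.erase i).erase j).filter fun l =>
      ν (s l - s i) ≤ kRad ν k (Finset.univ.erase i) s (s i)).card < k).card ≤ 8 * k := by
  by_contra! hlt
  obtain ⟨o, -, ho⟩ := Finset.exists_lt_card_fiber_of_mul_lt_card_of_maps_to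
    (t := (Finset.univ : Finset (Bool × Bool × Bool))) (f := fun i => octant (s i - s j)) (n := k)
    (fun _ _ => Finset.mem_univ _) (by simpa using hlt)
  set Q := (Finset.univ.filter fun i => i ≠ j ∧ (((Finset.univ.erase i).erase j).filter fun l =>
      ν (s l - s i) ≤ kRad ν k (Finset.univ.erase i) s (s i)).card < k).filter
      fun i => octant (s i - s j) = o with hQ
  obtain ⟨i, hi, hmax⟩ := Finset.exists_max_image Q (fun i => ν (s i - s j))
    (by rw [← Finset.card_pos]; omega)
  have hi' := hi
  rw [hQ, Finset.mem_filter, Finset.mem_filter] at hi'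
  obtain ⟨⟨-, hij, haff⟩, hoct⟩ := hi'
  have hcard : k ≤ (Finset.univ.erase i).card := by
    rw [Finset.card_erase_of_mem (Finset.mem_univ _), Finset.card_univ]; omega
  -- An affected point must have j in its ball: otherwise removing j would not lower the count.
  have hle : ν (s i - s j) ≤ kRad ν k (Finset.univ.erase i) s (s i) := by
    by_contra! hgt
    have h1 := kRad_spec (ν := ν) (s := s) (z := s i) hk hcard
    refine absurd (h1.trans (Finset.card_le_card ?_)) (not_le.2 haff)
    intro l hl
    rw [Finset.mem_filter] at *
    refine ⟨Finset.mem_erase.2 ⟨?_, hl.1⟩, hl.2⟩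
    rintro rfl
    rw [hν.sub_comm] at hgt
    exact absurd hl.2 (not_le.2 hgt)
  refine absurd (Finset.card_le_card (s := Q.erase i) ?_) (not_le.2 (haff.trans_le
    (by rw [Finset.card_erase_of_mem hi]; omega)))
  intro l hl
  have hlQ := Finset.mem_of_mem_erase hl
  have hl2 := hlQ
  rw [hQ, Finset.mem_filter, Finset.mem_filter] at hl2
  rw [Finset.mem_filter]
  refine ⟨Finset.mem_erase.2 ⟨hl2.1.2.1, Finset.mem_erase.2
    ⟨Finset.ne_of_mem_erase hl, Finset.mem_univ _⟩⟩, ?_⟩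
  have := hν.octant (s i - s j) (s l - s j) (hoct.trans hl2.2.symm) (hmax l hlQ)
  rw [sub_sub_sub_cancel_right] at this
  exact this.trans hle

/-- Affected points, at most 8k of them, are charged the trivial bound of order log N each. The
others are charged 1/n_x and 1/n_y, and only if their strip contains j, so `sum_inv_le` applies once
per coordinate. -/
theorem sum_abs_loc_sub_le [Fintype ι] [DecidableEq ι] (hν : PlaneNorm ν c) {G : ℕ → ℝ}
    (hG : LogLike G) {κ a : ℝ} (hk : 1 ≤ k) {N : ℕ} (hN : Fintype.card ι = N) (hkN : k + 2 ≤ N)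
    (s : ι → ℝ × ℝ) (j : ι) :
    ∑ i ∈ Finset.univ.erase j, |loc ν k G κ a (Finset.univ.erase i) s (s i) -
        loc ν k G κ a ((Finset.univ.erase i).erase j) s (s i)|
      ≤ 8 * k * (2 * (|κ| + 2 * (Real.log N + 1))) + 8 * (1 + Real.log N) := by
  set ρ : ι → ℝ := fun i => kRad ν k (Finset.univ.erase i) s (s i) with hρ
  set p : ι → Prop := fun i => (((Finset.univ.erase i).erase j).filter fun l =>
      ν (s l - s i) ≤ ρ i).card < k with hp
  have hl : 0 ≤ Real.log N := Real.log_natCast_nonneg N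
  have c1 : ∀ i : ι, (Finset.univ.erase i).card = N - 1 := fun i => by
    rw [Finset.card_erase_of_mem (Finset.mem_univ _), Finset.card_univ, hN]
  have c2 : ∀ i : ι, i ≠ j → ((Finset.univ.erase i).erase j).card = N - 2 := fun i hi => by
    rw [Finset.card_erase_of_mem (Finset.mem_erase.2 ⟨hi.symm, Finset.mem_univ _⟩), c1]
    omega
  rw [← Finset.sum_filter_add_sum_filter_not (Finset.univ.erase j) p]
  refine add_le_add ?_ ?_
  · refine (Finset.sum_le_card_nsmul _ _ (2 * (|κ| + 2 * (Real.log N + 1)))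
      fun i hi => ?_).trans ?_
    · have hij : i ≠ j := Finset.ne_of_mem_erase (Finset.mem_filter.1 hi).1
      have b1 := abs_loc_le (T := Finset.univ.erase i) (s := s) (z := s i) (κ := κ) (a := a)
        hν hG hk (by rw [c1]; omega) (N := N) (by rw [c1]; omega)
      have b2 := abs_loc_le (T := (Finset.univ.erase i).erase j) (s := s) (z := s i) (κ := κ)
        (a := a) hν hG hk (by rw [c2 i hij]; omega) (N := N) (by rw [c2 i hij]; omega)
      rw [abs_le] at *
      constructor <;> linarith
    · rw [nsmul_eq_mul]
      apply mul_le_mul_of_nonneg_right _ (by positivity)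
      have h := card_affected_le hν hk (by omega) s j
      have e : (Finset.univ.erase j).filter p = Finset.univ.filter fun i => i ≠ j ∧ p i := by
        ext i; simp [Finset.mem_filter]
      rw [e]
      exact_mod_cast h
  · set U := (Finset.univ.erase j).filter fun i => ¬ p i with hU
    have hU' : ∀ i ∈ U, i ≠ j ∧ k ≤ (((Finset.univ.erase i).erase j).filter fun l =>
        ν (s l - s i) ≤ ρ i).card := fun i hi => by
      rw [hU, Finset.mem_filter] at hi
      exact ⟨Finset.ne_of_mem_erase hi.1, not_lt.1 hi.2⟩
    have hcU : ∀ (q : ι → Prop) [DecidablePred q], (U.filter q).card ≤ N := fun q _ =>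
      (Finset.card_le_univ _).trans hN.le
    have main : ∀ i ∈ U, |loc ν k G κ a (Finset.univ.erase i) s (s i) -
        loc ν k G κ a ((Finset.univ.erase i).erase j) s (s i)| ≤
        (if |(s j).1 - (s i).1| ≤ ρ i then
          1 / (cntX ((Finset.univ.erase i).erase j) s (s i) (ρ i) : ℝ) else 0) +
        (if |(s j).2 - (s i).2| ≤ ρ i then
          1 / (cntY ((Finset.univ.erase i).erase j) s (s i) (ρ i) : ℝ) else 0) := fun i hi =>
      abs_loc_sub_loc_erase_le hν hG hk j
        (Finset.mem_erase.2 ⟨(hU' i hi).1.symm, Finset.mem_univ _⟩)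
        (by rw [c2 i (hU' i hi).1]; omega) (hU' i hi).2
    refine (Finset.sum_le_sum main).trans ?_
    rw [Finset.sum_add_distrib, ← Finset.sum_filter, ← Finset.sum_filter]
    have k1 : ∀ i ∈ U, 1 ≤ cntX ((Finset.univ.erase i).erase j) s (s i) (ρ i) := fun i hi =>
      hk.trans ((hU' i hi).2.trans (Finset.card_le_card
        (Finset.monotone_filter_right _ fun l _ hl => (hν.fst_le (s l - s i)).trans hl)))
    have k2 : ∀ i ∈ U, 1 ≤ cntY ((Finset.univ.erase i).erase j) s (s i) (ρ i) := fun i hi =>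
      hk.trans ((hU' i hi).2.trans (Finset.card_le_card
        (Finset.monotone_filter_right _ fun l _ hl => (hν.snd_le (s l - s i)).trans hl)))
    have e1 := sum_inv_le (U.filter fun i => |(s j).1 - (s i).1| ≤ ρ i) (fun i => (s i).1) ρ
      (fun i => cntX ((Finset.univ.erase i).erase j) s (s i) (ρ i)) (s j).1 (hcU _)
      (fun i hi => k1 i (Finset.mem_filter.1 hi).1) (fun i hi => (Finset.mem_filter.1 hi).2)
      (fun i hi => Finset.card_le_card fun l hl => by
        rw [Finset.mem_filter, Finset.mem_filter] at hl
        exact Finset.mem_filter.2 ⟨Finset.mem_erase.2 ⟨(hU' l hl.1.1).1,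
          Finset.mem_erase.2 ⟨hl.2.1, Finset.mem_univ _⟩⟩, hl.2.2⟩)
    have e2 := sum_inv_le (U.filter fun i => |(s j).2 - (s i).2| ≤ ρ i) (fun i => (s i).2) ρ
      (fun i => cntY ((Finset.univ.erase i).erase j) s (s i) (ρ i)) (s j).2 (hcU _)
      (fun i hi => k2 i (Finset.mem_filter.1 hi).1) (fun i hi => (Finset.mem_filter.1 hi).2)
      (fun i hi => Finset.card_le_card fun l hl => by
        rw [Finset.mem_filter, Finset.mem_filter] at hl
        exact Finset.mem_filter.2 ⟨Finset.mem_erase.2 ⟨(hU' l hl.1.1).1,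
          Finset.mem_erase.2 ⟨hl.2.1, Finset.mem_univ _⟩⟩, hl.2.2⟩)
    linarith

/-- Bounded differences: moving one sample point changes the sum of the local estimates by
`O(log N)`. -/
theorem abs_sum_loc_sub_le [Fintype ι] [DecidableEq ι] (hν : PlaneNorm ν c) {G : ℕ → ℝ}
    (hG : LogLike G) {κ a : ℝ} (hk : 1 ≤ k) {N : ℕ} (hN : Fintype.card ι = N) (hkN : k + 2 ≤ N)
    (s s' : ι → ℝ × ℝ) (j : ι) (hs : ∀ i, i ≠ j → s i = s' i) :
    |∑ i, loc ν k G κ a (Finset.univ.erase i) s (s i) -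
        ∑ i, loc ν k G κ a (Finset.univ.erase i) s' (s' i)|
      ≤ (32 * k + 2) * (|κ| + 2 * (Real.log N + 1)) + 16 * (1 + Real.log N) := by
  have a1 := sum_abs_loc_sub_le (κ := κ) (a := a) hν hG hk hN hkN s j
  have a2 := sum_abs_loc_sub_le (κ := κ) (a := a) hν hG hk hN hkN s' j
  have c1 : ∀ i : ι, (Finset.univ.erase i).card = N - 1 := fun i => by
    rw [Finset.card_erase_of_mem (Finset.mem_univ _), Finset.card_univ, hN]
  have b : ∀ s : ι → ℝ × ℝ, |loc ν k G κ a (Finset.univ.erase j) s (s j)| ≤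
      |κ| + 2 * (Real.log N + 1) := fun s =>
    abs_loc_le hν hG hk (by rw [c1]; omega) (by rw [c1]; omega)
  rw [← Finset.sum_sub_distrib, ← Finset.sum_erase_add _ _ (Finset.mem_univ j)]
  refine (abs_add_le _ _).trans ?_
  have h1 : |∑ i ∈ Finset.univ.erase j, (loc ν k G κ a (Finset.univ.erase i) s (s i) -
      loc ν k G κ a (Finset.univ.erase i) s' (s' i))| ≤
      ∑ i ∈ Finset.univ.erase j, |loc ν k G κ a (Finset.univ.erase i) s (s i) -
        loc ν k G κ a ((Finset.univ.erase i).erase j) s (s i)| +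
      ∑ i ∈ Finset.univ.erase j, |loc ν k G κ a (Finset.univ.erase i) s' (s' i) -
        loc ν k G κ a ((Finset.univ.erase i).erase j) s' (s' i)| := by
    rw [← Finset.sum_add_distrib]
    refine (Finset.abs_sum_le_sum_abs _ _).trans (Finset.sum_le_sum fun i hi => ?_)
    have hij := Finset.ne_of_mem_erase hi
    -- The two samples agree once j is deleted, so both sums are compared with the same leave-j-out
    -- values.
    have e : loc ν k G κ a ((Finset.univ.erase i).erase j) s (s i) =
        loc ν k G κ a ((Finset.univ.erase i).erase j) s' (s' i) := by
      rw [hs i hij]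
      exact loc_congr fun l hl => hs l (Finset.ne_of_mem_erase hl)
    rw [e, abs_sub_comm (loc ν k G κ a (Finset.univ.erase i) s' (s' i))]
    exact abs_sub_le _ _ _
  have h2 : |loc ν k G κ a (Finset.univ.erase j) s (s j) -
      loc ν k G κ a (Finset.univ.erase j) s' (s' j)| ≤ 2 * (|κ| + 2 * (Real.log N + 1)) := by
    refine (abs_sub _ _).trans ?_
    linarith [b s, b s']
  linarith

end Local

/-! ### Variance of functions with bounded differences -/

section BoundedDifferences

variable {E : Type*} [MeasurableSpace E]

theorem integrable_of_abs_le {α : Type*} [MeasurableSpace α] {μ : Measure α} [IsFiniteMeasure μ]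
    {F : α → ℝ} (hF : Measurable F) {B : ℝ} (hB : ∀ x, |F x| ≤ B) : Integrable F μ :=
  Integrable.of_bound hF.aestronglyMeasurable B (Filter.Eventually.of_forall hB)

/-- The bias–variance decomposition. It serves twice: to peel off one coordinate in the variance
bound, and for the mean squared error itself. -/
theorem integral_sq_sub {α : Type*} [MeasurableSpace α] {μ : Measure α} [IsProbabilityMeasure μ]
    {F : α → ℝ} (hF : Measurable F) {B : ℝ} (hB : ∀ x, |F x| ≤ B) (m : ℝ) :
    ∫ x, (F x - m) ^ 2 ∂μ = ∫ x, (F x - ∫ y, F y ∂μ) ^ 2 ∂μ + (∫ y, F y ∂μ - m) ^ 2 := by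
  set M := ∫ y, F y ∂μ with hM
  have h1 : Integrable F μ := integrable_of_abs_le hF hB
  have h2 : Integrable (fun x => (F x - M) ^ 2) μ := by
    refine integrable_of_abs_le (by fun_prop) (B := (B + |M|) ^ 2) fun x => ?_
    rw [abs_pow]
    gcongr
    exact (abs_sub _ _).trans (by gcongr; exact hB x)
  have h3 : Integrable (fun x => 2 * (M - m) * (F x - M)) μ :=
    (h1.sub (integrable_const _)).const_mul _
  have e : ∀ x, (F x - m) ^ 2 = (F x - M) ^ 2 + (2 * (M - m) * (F x - M) + (M - m) ^ 2) :=
    fun x => by ring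
  simp_rw [e]
  have h4 : Integrable (fun x => 2 * (M - m) * (F x - M) + (M - m) ^ 2) μ :=
    h3.add (integrable_const _)
  rw [integral_add h2 h4, integral_add h3 (integrable_const _),
    integral_const_mul, integral_sub h1 (integrable_const _)]
  simp [hM]

theorem measurable_insertNth {n : ℕ} (i : Fin (n + 1)) :
    Measurable fun p : E × (Fin n → E) => (Fin.insertNth i p.1 p.2 : Fin (n + 1) → E) :=
  (MeasurableEquiv.piFinSuccAbove (fun _ : Fin (n + 1) => E) i).symm.measurable

theorem integral_pi_insertNth (μ : Measure E) [IsProbabilityMeasure μ] {n : ℕ} (i : Fin (n + 1))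
    {F : (Fin (n + 1) → E) → ℝ} (hF : Integrable F (Measure.pi fun _ => μ)) :
    ∫ s, F s ∂(Measure.pi fun _ => μ) =
      ∫ x, ∫ v, F (Fin.insertNth i x v) ∂(Measure.pi fun _ => μ) ∂μ := by
  have h := (measurePreserving_piFinSuccAbove (fun _ : Fin (n + 1) => μ) i).symm
  rw [← h.integral_comp', integral_prod]
  · rfl
  · exact (h.integrable_comp_emb (MeasurableEquiv.measurableEmbedding _)).2 hF

/-- Let H be the average of F over the first coordinate. Given the other coordinates, F stays within
d of H, which costs d² of variance; H inherits the bounded differences and is handled by induction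
on the number of coordinates. -/
theorem variance_le_of_bounded_differences (μ : Measure E) [IsProbabilityMeasure μ] (n : ℕ)
    (F : (Fin n → E) → ℝ) (hF : Measurable F) {B d : ℝ} (hB : ∀ s, |F s| ≤ B)
    (hd : ∀ s s' j, (∀ i, i ≠ j → s i = s' i) → |F s - F s'| ≤ d) :
    ∫ s, (F s - ∫ t, F t ∂(Measure.pi fun _ => μ)) ^ 2 ∂(Measure.pi fun _ => μ) ≤ n * d ^ 2 := by
  induction n with
  | zero =>
    have : ∀ s : Fin 0 → E, F s = F Fin.elim0 := fun s => by congr; ext i; exact i.elim0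
    simp [this]
  | succ n ih =>
    set P : Measure (Fin n → E) := Measure.pi fun _ => μ with hP
    have hm : Measurable fun p : E × (Fin n → E) => F (Fin.insertNth 0 p.1 p.2) :=
      hF.comp (measurable_insertNth 0)
    set H : (Fin n → E) → ℝ := fun v => ∫ x, F (Fin.insertNth 0 x v) ∂μ with hH
    have hHm : Measurable H :=
      ((hm.comp measurable_swap).stronglyMeasurable.integral_prod_right').measurable
    have hi : ∀ v, Integrable (fun x => F (Fin.insertNth 0 x v)) μ := fun v =>
      integrable_of_abs_le (hm.comp (measurable_id.prodMk measurable_const)) fun x => hB _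
    have hHB : ∀ v, |H v| ≤ B := fun v => by
      refine (abs_integral_le_integral_abs).trans ?_
      refine (integral_mono (hi v).abs (integrable_const B) fun x => hB _).trans (by simp)
    have hB0 : ∀ v, 0 ≤ B := fun v => (abs_nonneg _).trans (hHB v)
    have hmean : ∫ t, F t ∂(Measure.pi fun _ => μ) = ∫ v, H v ∂P := by
      rw [integral_pi_insertNth μ 0 (integrable_of_abs_le hF hB), integral_integral_swap]
      exact integrable_of_abs_le hm fun _ => hB _
    set m := ∫ v, H v ∂P with hmdef
    have hdH : ∀ v v' j, (∀ i, i ≠ j → v i = v' i) → |H v - H v'| ≤ d := by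
      intro v v' j hv
      rw [hH]
      simp only
      rw [← integral_sub (hi v) (hi v')]
      refine (abs_integral_le_integral_abs).trans ?_
      refine (integral_mono ((hi v).sub (hi v')).abs (integrable_const d) fun x => ?_).trans
        (by simp)
      refine hd _ _ j.succ fun i hij => ?_
      rcases Fin.eq_zero_or_eq_succ i with rfl | ⟨i, rfl⟩
      · simp
      · simpa using hv i fun h => hij (by rw [h])
    have ih' := ih H hHm hHB hdH
    rw [← hmdef] at ih'
    have hdev : ∀ v x, |F (Fin.insertNth 0 x v) - H v| ≤ d := by
      intro v x
      have e : F (Fin.insertNth 0 x v) - H v =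
          ∫ y, (F (Fin.insertNth 0 x v) - F (Fin.insertNth 0 y v)) ∂μ := by
        rw [integral_sub (integrable_const _) (hi v)]
        simp [hH]
      rw [e]
      refine (abs_integral_le_integral_abs).trans ?_
      refine (integral_mono ((integrable_const _).sub (hi v)).abs (integrable_const d)
        fun y => ?_).trans (by simp)
      refine hd _ _ 0 fun i hij => ?_
      rcases Fin.eq_zero_or_eq_succ i with rfl | ⟨i, rfl⟩
      · exact absurd rfl hij
      · simp
    have hsqB : ∀ x, |F x - m| ≤ B + |m| := fun x => (abs_sub _ _).trans (by gcongr; exact hB x)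
    have hsq : ∀ x, |(F x - m) ^ 2| ≤ (B + |m|) ^ 2 := fun x => by
      rw [abs_pow]; gcongr; exact hsqB x
    have hHsq : Integrable (fun v => (H v - m) ^ 2) P := by
      refine integrable_of_abs_le (by fun_prop) (B := (B + |m|) ^ 2) fun x => ?_
      rw [abs_pow]
      gcongr
      exact (abs_sub _ _).trans (by gcongr; exact hHB x)
    have hm2 : Measurable fun p : E × (Fin n → E) => (F (Fin.insertNth 0 p.1 p.2) - m) ^ 2 :=
      (hm.sub_const m).pow_const 2
    have hint : Integrable (fun p : E × (Fin n → E) => (F (Fin.insertNth 0 p.1 p.2) - m) ^ 2)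
        (μ.prod P) := integrable_of_abs_le hm2 fun p => hsq _
    rw [hmean, integral_pi_insertNth μ 0 (integrable_of_abs_le (by fun_prop) hsq),
      integral_integral_swap hint]
    have step : ∀ v, ∫ x, (F (Fin.insertNth 0 x v) - m) ^ 2 ∂μ ≤ d ^ 2 + (H v - m) ^ 2 := by
      intro v
      rw [integral_sq_sub (F := fun x => F (Fin.insertNth 0 x v))
        (hm.comp (measurable_id.prodMk measurable_const)) fun x => hB _]
      apply add_le_add_left
      have : ∀ x, (F (Fin.insertNth 0 x v) - H v) ^ 2 ≤ d ^ 2 := fun x => by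
        rw [← sq_abs]
        gcongr
        exact hdev v x
      refine (integral_mono_of_nonneg (Filter.Eventually.of_forall fun x => sq_nonneg _)
        (integrable_const (d ^ 2)) (Filter.Eventually.of_forall this)).trans (by simp)
    refine (integral_mono hint.integral_prod_right ((integrable_const (d ^ 2)).add hHsq)
      step).trans ?_
    rw [integral_add' (integrable_const _) hHsq]
    simp only [integral_const, probReal_univ, one_smul]
    push_cast
    linarith

end BoundedDifferences

/-! ### Counting points of an i.i.d. sample in a set -/

section Hits

variable {E : Type*}

open Classical in
/-- Number of sample points in `A`. -/
def hits {m : ℕ} (A : Set E) (u : Fin m → E) : ℕ := (Finset.univ.filter fun l => u l ∈ A).card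

/-- Binomial probabilities. -/
def bin (m q : ℕ) (p : ℝ) : ℝ := m.choose q * p ^ q * (1 - p) ^ (m - q)

variable {m : ℕ} {A D : Set E}

open Classical in
theorem hits_eq_sum (A : Set E) (u : Fin m → E) : hits A u = ∑ l, if u l ∈ A then 1 else 0 := by
  rw [hits, Finset.card_filter]

open Classical in
theorem hits_insertNth (A : Set E) (i : Fin (m + 1)) (x : E) (v : Fin m → E) :
    hits A (Fin.insertNth i x v : Fin (m + 1) → E) = (if x ∈ A then 1 else 0) + hits A v := by
  rw [hits_eq_sum, hits_eq_sum, Fin.sum_univ_succAbove _ i]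
  simp

theorem hits_le (A : Set E) (u : Fin m → E) : hits A u ≤ m :=
  (Finset.card_le_univ _).trans (by simp)

variable [MeasurableSpace E]

theorem measurable_hits (hA : MeasurableSet A) : Measurable fun u : Fin m → E => hits A u := by
  classical
  simp_rw [hits_eq_sum]
  exact Finset.measurable_sum _ fun l _ =>
    Measurable.ite (measurable_pi_apply l hA) measurable_const measurable_const

theorem integrable_hits (μ : Measure E) [IsProbabilityMeasure μ] (hA : MeasurableSet A)
    (hD : MeasurableSet D) (Ψ : ℕ → ℕ → ℝ) :
    Integrable (fun u : Fin m → E => Ψ (hits A u) (hits D u)) (Measure.pi fun _ => μ) := by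
  refine integrable_of_abs_le
    (B := ∑ a ∈ Finset.range (m + 1), ∑ b ∈ Finset.range (m + 1), |Ψ a b|) ?_ fun u => ?_
  · have : Measurable fun p : ℕ × ℕ => Ψ p.1 p.2 := measurable_of_countable _
    exact this.comp ((measurable_hits hA).prodMk (measurable_hits hD))
  · have h1 := Finset.single_le_sum (f := fun b => |Ψ (hits A u) b|) (fun _ _ => abs_nonneg _)
      (Finset.mem_range.2 (Nat.lt_succ_of_le (hits_le D u)))
    have h2 := Finset.single_le_sum (f := fun a => ∑ b ∈ Finset.range (m + 1), |Ψ a b|)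
      (fun _ _ => Finset.sum_nonneg fun _ _ => abs_nonneg _)
      (Finset.mem_range.2 (Nat.lt_succ_of_le (hits_le A u)))
    exact h1.trans h2

-- Size biasing: write the count of D as a sum of indicators and fix the point that lies in D. That
-- point is outside A because the sets are disjoint, and the remaining points are an i.i.d. sample
-- of one point fewer.
open Classical in
theorem integral_hits_mul (μ : Measure E) [IsProbabilityMeasure μ] (hA : MeasurableSet A)
    (hD : MeasurableSet D) (hAD : Disjoint A D) (Ψ : ℕ → ℕ → ℝ) :
    ∫ u : Fin (m + 1) → E, hits D u * Ψ (hits A u) (hits D u) ∂(Measure.pi fun _ => μ) =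
      (m + 1) * μ.real D *
        ∫ v : Fin m → E, Ψ (hits A v) (hits D v + 1) ∂(Measure.pi fun _ => μ) := by
  have e : ∀ u : Fin (m + 1) → E, (hits D u : ℝ) * Ψ (hits A u) (hits D u) =
      ∑ l, (if u l ∈ D then 1 else 0) * Ψ (hits A u) (hits D u) := fun u => by
    rw [← Finset.sum_mul, hits_eq_sum]; push_cast; rfl
  have hint : ∀ l, Integrable (fun u : Fin (m + 1) → E =>
      (if u l ∈ D then (1 : ℝ) else 0) * Ψ (hits A u) (hits D u)) (Measure.pi fun _ => μ) := by
    intro l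
    refine (integrable_hits μ hA hD Ψ).bdd_mul (c := 1) ?_ (Filter.Eventually.of_forall fun u => ?_)
    · exact (Measurable.ite (measurable_pi_apply l hD) measurable_const
        measurable_const).aestronglyMeasurable
    · split_ifs <;> simp
  simp_rw [e]
  rw [integral_finsetSum _ fun l _ => hint l]
  have each : ∀ l : Fin (m + 1), ∫ u : Fin (m + 1) → E,
      (if u l ∈ D then (1 : ℝ) else 0) * Ψ (hits A u) (hits D u) ∂(Measure.pi fun _ => μ) =
      μ.real D * ∫ v : Fin m → E, Ψ (hits A v) (hits D v + 1) ∂(Measure.pi fun _ => μ) := by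
    intro l
    rw [integral_pi_insertNth μ l (hint l)]
    have : ∀ x, ∫ v : Fin m → E, (if (Fin.insertNth l x v : Fin (m + 1) → E) l ∈ D
        then (1 : ℝ) else 0) * Ψ (hits A (Fin.insertNth l x v : Fin (m + 1) → E))
          (hits D (Fin.insertNth l x v : Fin (m + 1) → E)) ∂(Measure.pi fun _ => μ) =
        D.indicator (fun _ => ∫ v : Fin m → E, Ψ (hits A v) (hits D v + 1)
          ∂(Measure.pi fun _ => μ)) x := by
      intro x
      by_cases hx : x ∈ D
      · have hxA : x ∉ A := fun h => Set.disjoint_left.1 hAD h hx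
        simp [hits_insertNth, hx, hxA, add_comm]
      · simp [hx]
    simp_rw [this]
    rw [integral_indicator_const _ hD, smul_eq_mul]
  simp_rw [each]
  simp [mul_assoc]

-- Splitting off the first point gives Pascal's rule.
open Classical in
theorem integral_hits_eq (μ : Measure E) [IsProbabilityMeasure μ] (hA : MeasurableSet A)
    (m q : ℕ) :
    ∫ u : Fin m → E, (if hits A u = q then (1 : ℝ) else 0) ∂(Measure.pi fun _ => μ) =
      bin m q (μ.real A) := by
  induction m generalizing q with
  | zero =>
    have : ∀ u : Fin 0 → E, hits A u = 0 := fun u => Nat.le_zero.1 (hits_le A u)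
    rcases q with _ | q <;> simp [this, bin]
  | succ m ih =>
    have hint := fun m q => integrable_hits (m := m) μ hA hA
      fun a _ => if a = q then (1 : ℝ) else 0
    rw [integral_pi_insertNth μ 0 (hint _ q)]
    have hc : μ.real Aᶜ = 1 - μ.real A := probReal_compl_eq_one_sub hA
    rcases q with _ | q
    · have : ∀ x, ∫ v : Fin m → E, (if hits A (Fin.insertNth 0 x v : Fin (m + 1) → E) = 0
          then (1 : ℝ) else 0) ∂(Measure.pi fun _ => μ) =
          Aᶜ.indicator (fun _ => bin m 0 (μ.real A)) x := by
        intro x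
        by_cases hx : x ∈ A
        · simp only [hits_insertNth, hx]; simp [hx]
        · simp only [hits_insertNth, hx]; simp [ih, hx]
      simp_rw [this]
      rw [integral_indicator_const _ hA.compl, hc]
      simp [bin, pow_succ']
    · have : ∀ x, ∫ v : Fin m → E, (if hits A (Fin.insertNth 0 x v : Fin (m + 1) → E) = q + 1
          then (1 : ℝ) else 0) ∂(Measure.pi fun _ => μ) =
          A.indicator (fun _ => bin m q (μ.real A)) x +
          Aᶜ.indicator (fun _ => bin m (q + 1) (μ.real A)) x := by
        intro x
        by_cases hx : x ∈ A
        · simp only [hits_insertNth, hx]; simp [ih, hx, add_comm 1]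
        · simp only [hits_insertNth, hx]; simp [ih, hx]
      simp_rw [this]
      rw [integral_add ((integrable_const _).indicator hA)
        ((integrable_const _).indicator hA.compl), integral_indicator_const _ hA,
        integral_indicator_const _ hA.compl, hc]
      simp only [bin, smul_eq_mul, Nat.choose_succ_succ, Nat.reduceSubDiff]
      -- The truncated exponent m - (q + 1) is a true difference only for q < m; otherwise the
      -- binomial coefficient in front of it vanishes.
      rcases Nat.lt_or_ge q m with h | h
      · obtain ⟨d, rfl⟩ : ∃ d, m = q + 1 + d := ⟨m - (q + 1), by omega⟩
        rw [show q + 1 + d - q = d + 1 by omega, show q + 1 + d - (q + 1) = d by omega]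
        push_cast
        ring
      · rw [Nat.choose_eq_zero_of_lt (show m < q + 1 by omega)]
        push_cast
        ring

theorem bin_nonneg {m q : ℕ} {p : ℝ} (h0 : 0 ≤ p) (h1 : p ≤ 1) : 0 ≤ bin m q p := by
  unfold bin
  have : 0 ≤ 1 - p := by linarith
  positivity

theorem bin_le {m q : ℕ} {p : ℝ} (h0 : 0 ≤ p) (h1 : p ≤ 1) :
    bin m q p ≤ (m : ℝ) ^ q * p ^ q * (1 - p) ^ (m - q) := by
  unfold bin
  have : 0 ≤ 1 - p := by linarith
  have h : (m.choose q : ℝ) ≤ (m : ℝ) ^ q := by exact_mod_cast Nat.choose_le_pow m q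
  gcongr

/-- Used to express the binomial probabilities for neighbouring sample sizes as multiples of a
single one, so that errors become relative. -/
theorem bin_succ {m q : ℕ} (hq : q ≤ m) (p : ℝ) :
    ((m : ℝ) + 1 - q) * bin (m + 1) q p = (m + 1) * (1 - p) * bin m q p := by
  unfold bin
  rw [show m + 1 - q = (m - q) + 1 by omega, pow_succ]
  have h : ((m + 1).choose q : ℝ) * ((m : ℝ) + 1 - q) = m.choose q * (m + 1) := by
    have := Nat.choose_mul_succ_eq m q
    have e : ((m + 1 - q : ℕ) : ℝ) = (m : ℝ) + 1 - q := by
      rw [Nat.cast_sub (by omega)]; push_cast; ring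
    rw [← e]
    exact_mod_cast this.symm
  linear_combination p ^ q * (1 - p) ^ (m - q) * (1 - p) * h

/-- Two-sided control of `E[1{K = q} Λ(k + B)]` when `Λ t - log t ∈ [0, 1/t]`, where `K` and `B`
count the points in disjoint sets. -/
theorem integral_hits_log_le (μ : Measure E) [IsProbabilityMeasure μ] (hA : MeasurableSet A)
    (hD : MeasurableSet D) (hAD : Disjoint A D) {G : ℕ → ℝ} (hG : LogLike G) {M : ℝ} (hM : 0 < M)
    (hDpos : 0 < μ.real D) (m q : ℕ) :
    ∫ u : Fin (m + 1) → E, (if hits A u = q then G (hits D u + q + 1) - Real.log M else 0)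
        ∂(Measure.pi fun _ => μ) ≤
      (q + 1) / M * bin (m + 1) q (μ.real A) + (m + 1) * μ.real D / M * bin m q (μ.real A)
        - bin (m + 1) q (μ.real A) + bin (m + 2) q (μ.real A) / ((m + 2) * μ.real D) := by
  classical
  -- Two uses of size biasing. With the indicator alone it evaluates E[B; K = q]; with the indicator
  -- divided by b, on a sample larger by one point, it bounds E[1/(B + 1); K = q].
  have e1 := integral_hits_mul (m := m) μ hA hD hAD fun a _ => if a = q then (1 : ℝ) else 0
  have e2 := integral_hits_mul (m := m + 1) μ hA hD hAD
    fun a b => if a = q then 1 / (b : ℝ) else 0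
  rw [integral_hits_eq μ hA] at e1
  have i0 := integrable_hits (m := m + 1) μ hA hD fun a _ => if a = q then (1 : ℝ) else 0
  have i1 := integrable_hits (m := m + 1) μ hA hD fun a b => b * if a = q then (1 : ℝ) else 0
  have i2 := integrable_hits (m := m + 1) μ hA hD
    fun a b => if a = q then 1 / ((b + 1 : ℕ) : ℝ) else 0
  have e3 : ∫ u : Fin (m + 2) → E, (hits D u : ℝ) *
      (if hits A u = q then 1 / (hits D u : ℝ) else 0) ∂(Measure.pi fun _ => μ) ≤
      bin (m + 2) q (μ.real A) := by
    rw [← integral_hits_eq μ hA]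
    refine integral_mono (integrable_hits (m := m + 2) μ hA hD
      fun a b => b * if a = q then 1 / (b : ℝ) else 0)
      (integrable_hits (m := m + 2) μ hA hD fun a _ => if a = q then (1 : ℝ) else 0) fun u => ?_
    simp only
    split_ifs
    · rw [mul_one_div]; exact div_self_le_one _
    · simp
  rw [e2] at e3
  have e4 : ∫ v : Fin (m + 1) → E, (if hits A v = q then 1 / ((hits D v + 1 : ℕ) : ℝ) else 0)
      ∂(Measure.pi fun _ => μ) ≤ bin (m + 2) q (μ.real A) / ((m + 2) * μ.real D) := by
    rw [le_div_iff₀ (by positivity), mul_comm]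
    have e : ((m + 1 : ℕ) : ℝ) + 1 = m + 2 := by push_cast; ring
    rw [e] at e3
    exact e3
  have main : ∫ u : Fin (m + 1) → E, (if hits A u = q then G (hits D u + q + 1) - Real.log M else 0)
        ∂(Measure.pi fun _ => μ) ≤ ∫ u : Fin (m + 1) → E,
        (((q + 1) / M - 1) * (if hits A u = q then (1 : ℝ) else 0) +
        (1 / M * (hits D u * (if hits A u = q then (1 : ℝ) else 0)) +
        (if hits A u = q then 1 / ((hits D u + 1 : ℕ) : ℝ) else 0)))
        ∂(Measure.pi fun _ => μ) := by
    refine integral_mono (integrable_hits (m := m + 1) μ hA hD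
      fun a b => if a = q then G (b + q + 1) - Real.log M else 0)
      ((i0.const_mul _).add ((i1.const_mul _).add i2)) fun u => ?_
    simp only
    split_ifs with h
    · set b := hits D u
      have h1 := hG.le_log (b + q + 1) (by omega)
      have hp : (0 : ℝ) < ((b + q + 1 : ℕ) : ℝ) := by positivity
      -- The logarithm is linearised around the reference value M, so only the first moment of B is
      -- needed; the excess of G over log costs the inverse moment.
      have h2 := Real.log_le_sub_one_of_pos (div_pos hp hM)
      rw [Real.log_div hp.ne' hM.ne'] at h2
      have h3 : (1 : ℝ) / ((b + q + 1 : ℕ) : ℝ) ≤ 1 / ((b + 1 : ℕ) : ℝ) := by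
        apply one_div_le_one_div_of_le (by positivity)
        exact_mod_cast (by omega)
      have h4 : ((b + q + 1 : ℕ) : ℝ) / M = (q + 1) / M + 1 / M * b := by
        push_cast; ring
      linarith
    · simp
  refine main.trans ?_
  have i3 : Integrable (fun u : Fin (m + 1) → E =>
      1 / M * (hits D u * (if hits A u = q then (1 : ℝ) else 0)) +
        (if hits A u = q then 1 / ((hits D u + 1 : ℕ) : ℝ) else 0)) (Measure.pi fun _ => μ) :=
    (i1.const_mul _).add i2
  rw [integral_add (i0.const_mul _) i3, integral_const_mul, integral_hits_eq μ hA,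
    integral_add (i1.const_mul _) i2, integral_const_mul, e1]
  have : (1 : ℝ) / M * ((m + 1) * μ.real D * bin m q (μ.real A)) =
    (m + 1) * μ.real D / M * bin m q (μ.real A) := by ring
  linarith

/-- Here log x ≥ 1 - 1/x is used with x = n/M, so the inverse moment of B + 1 suffices. -/
theorem le_integral_hits_log (μ : Measure E) [IsProbabilityMeasure μ] (hA : MeasurableSet A)
    (hD : MeasurableSet D) (hAD : Disjoint A D) {G : ℕ → ℝ} (hG : LogLike G) {M : ℝ} (hM : 0 < M)
    (hDpos : 0 < μ.real D) (m q : ℕ) :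
    bin m q (μ.real A) - M * (bin (m + 1) q (μ.real A) / ((m + 1) * μ.real D)) ≤
    ∫ u : Fin m → E, (if hits A u = q then G (hits D u + q + 1) - Real.log M else 0)
        ∂(Measure.pi fun _ => μ) := by
  classical
  have e2 := integral_hits_mul (m := m) μ hA hD hAD
    fun a b => if a = q then 1 / (b : ℝ) else 0
  have i0 := integrable_hits (m := m) μ hA hD fun a _ => if a = q then (1 : ℝ) else 0
  have i2 := integrable_hits (m := m) μ hA hD
    fun a b => if a = q then 1 / ((b + 1 : ℕ) : ℝ) else 0
  have e3 : ∫ u : Fin (m + 1) → E, (hits D u : ℝ) *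
      (if hits A u = q then 1 / (hits D u : ℝ) else 0) ∂(Measure.pi fun _ => μ) ≤
      bin (m + 1) q (μ.real A) := by
    rw [← integral_hits_eq μ hA]
    refine integral_mono (integrable_hits (m := m + 1) μ hA hD
      fun a b => b * if a = q then 1 / (b : ℝ) else 0)
      (integrable_hits (m := m + 1) μ hA hD fun a _ => if a = q then (1 : ℝ) else 0) fun u => ?_
    simp only
    split_ifs
    · rw [mul_one_div]; exact div_self_le_one _
    · simp
  rw [e2] at e3
  have e4 : ∫ v : Fin m → E, (if hits A v = q then 1 / ((hits D v + 1 : ℕ) : ℝ) else 0)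
      ∂(Measure.pi fun _ => μ) ≤ bin (m + 1) q (μ.real A) / ((m + 1) * μ.real D) := by
    rw [le_div_iff₀ (by positivity), mul_comm]
    exact e3
  have main : ∫ u : Fin m → E,
        ((if hits A u = q then (1 : ℝ) else 0) -
        M * (if hits A u = q then 1 / ((hits D u + 1 : ℕ) : ℝ) else 0))
        ∂(Measure.pi fun _ => μ) ≤
        ∫ u : Fin m → E, (if hits A u = q then G (hits D u + q + 1) - Real.log M else 0)
        ∂(Measure.pi fun _ => μ) := by
    refine integral_mono (i0.sub (i2.const_mul _)) (integrable_hits (m := m) μ hA hD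
      fun a b => if a = q then G (b + q + 1) - Real.log M else 0) fun u => ?_
    simp only
    split_ifs with h
    · set b := hits D u
      have h1 := hG.log_le (b + q + 1) (by omega)
      have hp : (0 : ℝ) < ((b + q + 1 : ℕ) : ℝ) := by positivity
      have h2 := Real.log_le_sub_one_of_pos (div_pos hM hp)
      rw [Real.log_div hM.ne' hp.ne'] at h2
      have h3 : M / ((b + q + 1 : ℕ) : ℝ) ≤ M * (1 / ((b + 1 : ℕ) : ℝ)) := by
        rw [mul_one_div]
        apply div_le_div_of_nonneg_left hM.le (by positivity)
        exact_mod_cast (by omega)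
      linarith
    · simp
  refine le_trans ?_ main
  rw [integral_sub i0 (i2.const_mul _), integral_const_mul, integral_hits_eq μ hA]
  have := mul_le_mul_of_nonneg_left e4 hM.le
  linarith

end Hits

/-! ### Beta integrals and the probability integral transform -/

theorem bin_mul_succ (m q : ℕ) :
    (m.choose q : ℝ) * (m - q : ℕ) = m.choose (q + 1) * (q + 1) := by
  exact_mod_cast (Nat.choose_succ_right_eq m q).symm

theorem continuous_bin (m q : ℕ) : Continuous (bin m q) := by unfold bin; fun_prop

theorem intervalIntegrable_mul_log {g : ℝ → ℝ} (hg : Continuous g) :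
    IntervalIntegrable (fun u => g u * Real.log u) volume 0 1 :=
  intervalIntegral.intervalIntegrable_log'.continuousOn_mul hg.continuousOn

theorem hasDerivAt_beta (a b : ℕ) (u : ℝ) :
    HasDerivAt (fun u : ℝ => u ^ (a + 1) * (1 - u) ^ b)
      ((a + 1) * (u ^ a * (1 - u) ^ b) - b * (u ^ (a + 1) * (1 - u) ^ (b - 1))) u := by
  have h1 : HasDerivAt (fun u : ℝ => u ^ (a + 1)) (((a + 1 : ℕ) : ℝ) * u ^ a) u := by
    simpa using hasDerivAt_pow (a + 1) u
  have h2 : HasDerivAt (fun u : ℝ => (1 - u) ^ b) ((b : ℝ) * (1 - u) ^ (b - 1) * (-1)) u :=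
    ((hasDerivAt_id u).const_sub 1).pow b
  exact (h1.mul h2).congr_deriv (by push_cast; ring)

theorem integral_beta_step (a b : ℕ) (hb : 1 ≤ b) :
    (b : ℝ) * ∫ u in (0 : ℝ)..1, u ^ (a + 1) * (1 - u) ^ (b - 1) =
      (a + 1) * ∫ u in (0 : ℝ)..1, u ^ a * (1 - u) ^ b := by
  have h := intervalIntegral.integral_eq_sub_of_hasDerivAt (a := 0) (b := 1)
    (fun u _ => hasDerivAt_beta a b u) (Continuous.intervalIntegrable (by fun_prop) _ _)
  rw [intervalIntegral.integral_sub (Continuous.intervalIntegrable (by fun_prop) _ _)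
    (Continuous.intervalIntegrable (by fun_prop) _ _), intervalIntegral.integral_const_mul,
    intervalIntegral.integral_const_mul] at h
  rw [sub_self, zero_pow (by omega : b ≠ 0), zero_pow (by omega : a + 1 ≠ 0)] at h
  linarith

/-- Integration by parts trades a factor 1 - u for a factor u, raising q with m fixed. The induction
on m - q therefore leaves q free and ends at q = m, where the integrand is a power. -/
theorem integral_bin {m q : ℕ} (hq : q ≤ m) :
    (m + 1) * ∫ u in (0 : ℝ)..1, bin m q u = 1 := by
  obtain ⟨d, rfl⟩ : ∃ d, m = q + d := ⟨m - q, by omega⟩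
  clear hq
  induction d generalizing q with
  | zero =>
    have : ∀ u : ℝ, bin (q + 0) q u = u ^ q := fun u => by simp [bin]
    simp_rw [this, integral_pow]
    simp
    field_simp
  | succ d ih =>
    have ih := ih (q := q + 1)
    rw [show q + 1 + d = q + (d + 1) by ring] at ih
    refine Eq.trans (congrArg _ ?_) ih
    simp only [bin, mul_assoc]
    rw [intervalIntegral.integral_const_mul, intervalIntegral.integral_const_mul]
    have h1 := integral_beta_step q (q + (d + 1) - q) (by omega)
    have h2 := bin_mul_succ (q + (d + 1)) q
    rw [show q + (d + 1) - (q + 1) = q + (d + 1) - q - 1 by omega]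
    have h3 : (0 : ℝ) < q + 1 := by positivity
    apply mul_left_cancel₀ h3.ne'
    linear_combination (((q + (d + 1)).choose q : ℝ)) * h1.symm +
      (∫ u in (0 : ℝ)..1, u ^ (q + 1) * (1 - u) ^ (q + (d + 1) - q - 1)) * h2

theorem integral_beta_log_step (a b : ℕ) :
    ((a : ℝ) + 1) * (∫ u in (0 : ℝ)..1, u ^ a * (1 - u) ^ b * Real.log u)
      - b * (∫ u in (0 : ℝ)..1, u ^ (a + 1) * (1 - u) ^ (b - 1) * Real.log u)
      = - ∫ u in (0 : ℝ)..1, u ^ a * (1 - u) ^ b := by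
  -- The singularity of the logarithm at 0 is absorbed by one factor u, so both boundary terms of
  -- the integration by parts vanish.
  have hc : Continuous fun u : ℝ => u ^ (a + 1) * (1 - u) ^ b * Real.log u := by
    have : (fun u : ℝ => u ^ (a + 1) * (1 - u) ^ b * Real.log u) =
        fun u => u ^ a * (1 - u) ^ b * (u * Real.log u) := by
      ext u; ring
    rw [this]
    have := Real.continuous_mul_log
    fun_prop
  have i1 := (intervalIntegrable_mul_log (g := fun u => u ^ a * (1 - u) ^ b)
    (by fun_prop)).const_mul ((a : ℝ) + 1)
  have i2 := (intervalIntegrable_mul_log (g := fun u => u ^ (a + 1) * (1 - u) ^ (b - 1))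
    (by fun_prop)).const_mul (b : ℝ)
  have i3 : IntervalIntegrable (fun u : ℝ => u ^ a * (1 - u) ^ b) volume 0 1 :=
    Continuous.intervalIntegrable (by fun_prop) _ _
  have h := intervalIntegral.integral_eq_sub_of_hasDerivAt_of_le (a := 0) (b := 1) zero_le_one
    (f := fun u : ℝ => u ^ (a + 1) * (1 - u) ^ b * Real.log u)
    (f' := fun u => (a + 1) * (u ^ a * (1 - u) ^ b * Real.log u) -
      b * (u ^ (a + 1) * (1 - u) ^ (b - 1) * Real.log u) + u ^ a * (1 - u) ^ b)
    hc.continuousOn (fun u hu => by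
      have := hu.1.ne'
      exact ((hasDerivAt_beta a b u).mul (Real.hasDerivAt_log hu.1.ne')).congr_deriv (by
        field_simp
        ring)) ((i1.sub i2).add i3)
  rw [intervalIntegral.integral_add (i1.sub i2) i3, intervalIntegral.integral_sub i1 i2,
    intervalIntegral.integral_const_mul, intervalIntegral.integral_const_mul] at h
  simp only [Real.log_one, Real.log_zero, mul_zero, sub_zero] at h
  linarith

/-- This is the expected logarithm of the (q + 1)-th smallest of m + 1 uniform variables, ψ(q + 1) -
ψ(m + 2) in digamma terms. It explains the ψ(k) in the estimator. The induction is that of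
`integral_bin`, with `integral_beta_log_step` for the step. -/
theorem integral_bin_log {m q : ℕ} (hq : q ≤ m) :
    (m + 1) * ∫ u in (0 : ℝ)..1, bin m q u * Real.log u = harmonic q - harmonic (m + 1) := by
  obtain ⟨d, rfl⟩ : ∃ d, m = q + d := ⟨m - q, by omega⟩
  clear hq
  induction d generalizing q with
  | zero =>
    have h := integral_beta_log_step q 0
    simp only [pow_zero, mul_one, Nat.cast_zero, zero_mul, sub_zero, integral_pow] at h
    have : ∀ u : ℝ, bin (q + 0) q u = u ^ q := fun u => by simp [bin]
    simp_rw [this]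
    rw [add_zero, h, harmonic_succ]
    push_cast
    simp
  | succ d ih =>
    have ih := ih (q := q + 1)
    rw [show q + 1 + d = q + (d + 1) by ring] at ih
    have h0 := integral_bin (m := q + (d + 1)) (q := q) (by omega)
    rw [harmonic_succ q] at ih
    simp only [bin, mul_assoc] at ih h0 ⊢
    rw [intervalIntegral.integral_const_mul] at ih h0 ⊢
    have h1 := integral_beta_log_step q (q + (d + 1) - q)
    have h2 := bin_mul_succ (q + (d + 1)) q
    rw [show q + (d + 1) - (q + 1) = q + (d + 1) - q - 1 by omega] at ih
    simp only [mul_assoc] at h1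
    have h3 : (0 : ℝ) < q + 1 := by positivity
    set c := ((q + (d + 1)).choose q : ℝ)
    set c' := ((q + (d + 1)).choose (q + 1) : ℝ)
    set I := ∫ u in (0 : ℝ)..1, u ^ q * (1 - u) ^ (q + (d + 1) - q)
    set J := ∫ u in (0 : ℝ)..1, u ^ q * ((1 - u) ^ (q + (d + 1) - q) * Real.log u)
    set J' := ∫ u in (0 : ℝ)..1, u ^ (q + 1) * ((1 - u) ^ (q + (d + 1) - q - 1) * Real.log u)
    push_cast at ih h0 ⊢
    apply mul_left_cancel₀ h3.ne'
    have h4 : ((q : ℝ) + 1) * ((q : ℝ) + 1)⁻¹ = 1 := mul_inv_cancel₀ h3.ne'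
    linear_combination ((q : ℝ) + (d + 1) + 1) * c * h1 + ((q : ℝ) + (d + 1) + 1) * J' * h2
      + (q + 1) * ih - h0 + h4

/-- Probability integral transform. -/
theorem map_cdf_eq_uniform {α : Type*} [MeasurableSpace α] (μ : Measure α)
    [IsProbabilityMeasure μ] {X : α → ℝ} (hX : Measurable X) (h0 : ∀ r, μ {w | X w = r} = 0) :
    μ.map (fun w => μ.real {w' | X w' ≤ X w}) = volume.restrict (Set.Ioc 0 1) := by
  set l := μ.map X with hl
  have : IsProbabilityMeasure l := Measure.isProbabilityMeasure_map hX.aemeasurable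
  set F : ℝ → ℝ := fun r => cdf l r with hF
  have hFr : ∀ r, μ.real {w' | X w' ≤ r} = F r := fun r => by
    simp only [hF]
    rw [cdf_eq_real, hl, map_measureReal_apply hX measurableSet_Iic]
    rfl
  have hmono : Monotone F := monotone_cdf l
  -- The absence of atoms makes the right-continuous distribution function continuous.
  have hcont : Continuous F := by
    rw [continuous_iff_continuousAt]
    intro r
    have hs : l {r} = 0 := by
      rw [hl, Measure.map_apply hX (measurableSet_singleton r)]
      exact h0 r
    rw [← measure_cdf l, StieltjesFunction.measure_singleton, ENNReal.ofReal_eq_zero] at hs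
    have h1 := (cdf l).mono.leftLim_le (le_refl r)
    have h2 : Function.leftLim (cdf l) r = cdf l r := le_antisymm h1 (by linarith)
    rw [hmono.continuousAt_iff_leftLim_eq_rightLim]
    have h3 : Function.rightLim F r = F r := (cdf l).rightLim_eq r
    rw [h3]
    exact h2
  have hFX : Measurable fun w => μ.real {w' | X w' ≤ X w} := by
    simp_rw [hFr]
    exact hcont.measurable.comp hX
  have : IsFiniteMeasure (volume.restrict (Set.Ioc (0 : ℝ) 1)) := ⟨by simp⟩
  have := Measure.isProbabilityMeasure_map (μ := μ) hFX.aemeasurable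
  refine Measure.ext_of_Iic _ _ fun t => ?_
  rw [Measure.map_apply hFX measurableSet_Iic, Measure.restrict_apply measurableSet_Iic]
  have e : (fun w => μ.real {w' | X w' ≤ X w}) ⁻¹' Set.Iic t = X ⁻¹' {r | F r ≤ t} := by
    ext w
    simp [hFr]
  rw [e]
  have hF0 : ∀ r, 0 ≤ F r := cdf_nonneg l
  have hF1 : ∀ r, F r ≤ 1 := cdf_le_one l
  rcases lt_or_ge t 0 with ht | ht
  · have h1 : {r | F r ≤ t} = ∅ := by
      ext r; simp only [Set.mem_ofPred_eq, Set.mem_empty_iff_false, iff_false, not_le]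
      exact ht.trans_le (hF0 r)
    have h2 : Set.Iic t ∩ Set.Ioc (0 : ℝ) 1 = ∅ := by
      ext r; simp only [Set.mem_inter_iff, Set.mem_Iic, Set.mem_Ioc, Set.mem_empty_iff_false,
        iff_false]
      intro h; linarith [h.1, h.2.1]
    rw [h1, h2]; simp
  rcases le_or_gt 1 t with ht1 | ht1
  · have h1 : {r | F r ≤ t} = Set.univ := by
      ext r; simp only [Set.mem_ofPred_eq, Set.mem_univ, iff_true]
      exact (hF1 r).trans ht1
    have h2 : Set.Iic t ∩ Set.Ioc (0 : ℝ) 1 = Set.Ioc 0 1 := by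
      ext r; simp only [Set.mem_inter_iff, Set.mem_Iic, Set.mem_Ioc]
      constructor
      · exact fun h => h.2
      · exact fun h => ⟨h.2.trans ht1, h⟩
    rw [h1, h2]; simp
  have h2 : Set.Iic t ∩ Set.Ioc (0 : ℝ) 1 = Set.Ioc 0 t := by
    ext r; simp only [Set.mem_inter_iff, Set.mem_Iic, Set.mem_Ioc]
    constructor
    · exact fun h => ⟨h.2.1, h.1⟩
    · exact fun h => ⟨h.2, h.1, h.2.trans ht1.le⟩
  rw [h2, Real.volume_Ioc, sub_zero]
  have hbdd : BddAbove {r | F r ≤ t} := by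
    obtain ⟨b, hb⟩ := ((tendsto_cdf_atTop l).eventually (lt_mem_nhds ht1)).exists
    exact ⟨b, fun r hr => by
      by_contra! hlt
      exact absurd (hmono hlt.le) (not_le.2 (lt_of_le_of_lt hr hb))⟩
  rcases Set.eq_empty_or_nonempty {r | F r ≤ t} with hemp | hne
  · rw [hemp]
    have : t ≤ 0 := by
      refine ge_of_tendsto (tendsto_cdf_atBot l) (Filter.Eventually.of_forall fun r => ?_)
      by_contra! hlt
      exact Set.eq_empty_iff_forall_notMem.1 hemp r hlt.le
    rw [ENNReal.ofReal_of_nonpos this]; simp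
  -- F may be flat, so it has no inverse; the rightmost point of the sublevel set replaces it. There
  -- F equals t by continuity, and the sublevel set is the half-line up to x.
  · set x := sSup {r | F r ≤ t} with hx
    have hxm : F x ≤ t := (isClosed_le hcont continuous_const).csSup_mem hne hbdd
    have hxt : F x = t := by
      refine le_antisymm hxm ?_
      have : Filter.Tendsto F (nhdsWithin x (Set.Ioi x)) (nhds (F x)) :=
        hcont.continuousAt.tendsto.mono_left nhdsWithin_le_nhds
      refine ge_of_tendsto this ?_
      filter_upwards [self_mem_nhdsWithin] with r hr
      by_contra! hlt
      exact absurd (le_csSup hbdd hlt.le) (not_le.2 hr)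
    have e2 : {r | F r ≤ t} = Set.Iic x := by
      ext r
      exact ⟨fun h => le_csSup hbdd h, fun h => (hmono h).trans hxm⟩
    rw [e2, ← hxt, ← hFr, ofReal_measureReal]
    rfl

theorem integral_cdf_comp {α : Type*} [MeasurableSpace α] (μ : Measure α)
    [IsProbabilityMeasure μ] {X : α → ℝ} (hX : Measurable X) (h0 : ∀ r, μ {w | X w = r} = 0)
    (hm : Measurable fun w => μ.real {w' | X w' ≤ X w}) {g : ℝ → ℝ} (hg : Measurable g) :
    ∫ w, g (μ.real {w' | X w' ≤ X w}) ∂μ = ∫ u in (0 : ℝ)..1, g u := by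
  rw [intervalIntegral.integral_of_le zero_le_one, ← map_cdf_eq_uniform μ hX h0,
    integral_map hm.aemeasurable hg.aestronglyMeasurable]

theorem integrable_cdf_comp {α : Type*} [MeasurableSpace α] (μ : Measure α)
    [IsProbabilityMeasure μ] {X : α → ℝ} (hX : Measurable X) (h0 : ∀ r, μ {w | X w = r} = 0)
    (hm : Measurable fun w => μ.real {w' | X w' ≤ X w}) {g : ℝ → ℝ} (hg : Measurable g)
    (hi : IntervalIntegrable g volume 0 1) :
    Integrable (fun w => g (μ.real {w' | X w' ≤ X w})) μ := by
  rw [intervalIntegrable_iff_integrableOn_Ioc_of_le zero_le_one, IntegrableOn,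
    ← map_cdf_eq_uniform μ hX h0] at hi
  exact (integrable_map_measure hg.aestronglyMeasurable hm.aemeasurable).1 hi

/-! ### Measurability of the local estimates -/

section Measurability

variable {α ι : Type*} [MeasurableSpace α] {ν : ℝ × ℝ → ℝ} {c : ℝ} {k : ℕ} {T : Finset ι}
  {X : α → ι → ℝ × ℝ} {Z : α → ℝ × ℝ}

theorem measurable_card_filter (T : Finset ι) (p : ι → α → Prop)
    [∀ x, DecidablePred fun l => p l x] (hp : ∀ l, MeasurableSet {x | p l x}) :
    Measurable fun x => (T.filter fun l => p l x).card := by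
  classical
  simp_rw [Finset.card_filter]
  exact Finset.measurable_sum _ fun l _ => Measurable.ite (hp l) measurable_const measurable_const

theorem measurable_kRad (hν : PlaneNorm ν c) (hk : 1 ≤ k) (hT : k ≤ T.card)
    (hX : ∀ l, Measurable fun x => X x l) (hZ : Measurable Z) :
    Measurable fun x => kRad ν k T (X x) (Z x) := by
  refine measurable_of_Iic fun r => ?_
  have : (fun x => kRad ν k T (X x) (Z x)) ⁻¹' Set.Iic r =
      {x | k ≤ (T.filter fun l => ν (X x l - Z x) ≤ r).card} := by
    ext x
    exact kRad_le_iff hk hT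
  rw [this]
  exact measurableSet_le measurable_const (measurable_card_filter T _ fun l =>
    measurableSet_le (hν.measurable.comp ((hX l).sub hZ)) measurable_const)

theorem measurable_loc (hν : PlaneNorm ν c) {G : ℕ → ℝ} {κ a : ℝ} (hk : 1 ≤ k) (hT : k ≤ T.card)
    (hX : ∀ l, Measurable fun x => X x l) (hZ : Measurable Z) :
    Measurable fun x => loc ν k G κ a T (X x) (Z x) := by
  have hR := measurable_kRad hν hk hT hX hZ
  have h1 : Measurable fun x => cntX T (X x) (Z x) (kRad ν k T (X x) (Z x)) :=
    measurable_card_filter T _ fun l => by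
      have := hX l
      exact measurableSet_le (by fun_prop) hR
  have h2 : Measurable fun x => cntY T (X x) (Z x) (kRad ν k T (X x) (Z x)) :=
    measurable_card_filter T _ fun l => by
      have := hX l
      exact measurableSet_le (by fun_prop) hR
  have hG : Measurable G := measurable_of_countable _
  exact Measurable.ite (measurableSet_le hR measurable_const)
    ((measurable_const.sub (hG.comp h1)).sub (hG.comp h2)) measurable_const

end Measurability

/-! ### Conditioning on the `k`-th nearest neighbour -/

section Decomposition

/-- The closed ball for the norm `ν`. -/
def nball (ν : ℝ × ℝ → ℝ) (z : ℝ × ℝ) (r : ℝ) : Set (ℝ × ℝ) := {w | ν (w - z) ≤ r}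

def stripX (z : ℝ × ℝ) (r : ℝ) : Set (ℝ × ℝ) := {w | |w.1 - z.1| ≤ r}

def stripY (z : ℝ × ℝ) (r : ℝ) : Set (ℝ × ℝ) := {w | |w.2 - z.2| ≤ r}

variable {ν : ℝ × ℝ → ℝ} {c : ℝ} {k m : ℕ} {z : ℝ × ℝ}

theorem PlaneNorm.measurableSet_nball (hν : PlaneNorm ν c) (z : ℝ × ℝ) (r : ℝ) :
    MeasurableSet (nball ν z r) :=
  measurableSet_le (hν.measurable.comp (measurable_id.sub_const z)) measurable_const

theorem measurableSet_stripX (z : ℝ × ℝ) (r : ℝ) : MeasurableSet (stripX z r) :=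
  measurableSet_le (by fun_prop) measurable_const

theorem measurableSet_stripY (z : ℝ × ℝ) (r : ℝ) : MeasurableSet (stripY z r) :=
  measurableSet_le (by fun_prop) measurable_const

theorem card_filter_eq_hits {n : ℕ} (v : Fin n → ℝ × ℝ) (z : ℝ × ℝ) (r : ℝ) :
    (Finset.univ.filter fun l => ν (v l - z) ≤ r).card = hits (nball ν z r) v := by
  unfold hits
  congr

theorem cntX_eq_hits {n : ℕ} (v : Fin n → ℝ × ℝ) (z : ℝ × ℝ) (r : ℝ) :
    cntX Finset.univ v z r = hits (stripX z r) v := by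
  unfold hits cntX
  congr

theorem cntY_eq_hits {n : ℕ} (v : Fin n → ℝ × ℝ) (z : ℝ × ℝ) (r : ℝ) :
    cntY Finset.univ v z r = hits (stripY z r) v := by
  unfold hits cntY
  congr

/-- The closed ball through `v j` holds exactly k points, and any smaller ball loses `v j` itself.
-/
theorem kRad_eq_of_hits {n : ℕ} (hk : 1 ≤ k) (hkn : k ≤ n) (v : Fin n → ℝ × ℝ) (j : Fin n)
    (h : hits (nball ν z (ν (v j - z))) v = k) : kRad ν k Finset.univ v z = ν (v j - z) := by
  have hc : k ≤ (Finset.univ : Finset (Fin n)).card := by simpa using hkn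
  apply le_antisymm
  · exact kRad_le hk hc (by rw [card_filter_eq_hits, h])
  · by_contra! hlt
    have h1 := kRad_spec (ν := ν) (s := v) (z := z) hk hc
    rw [← card_filter_eq_hits] at h
    have h2 : (Finset.univ.filter fun l => ν (v l - z) ≤ kRad ν k Finset.univ v z) ⊂
        (Finset.univ.filter fun l => ν (v l - z) ≤ ν (v j - z)) := by
      rw [Finset.ssubset_iff_of_subset
        (Finset.monotone_filter_right _ fun l _ hl => hl.trans hlt.le)]
      exact ⟨j, by simp, by simpa using hlt⟩
    have h3 := Finset.card_lt_card h2
    omega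

/-- With distinct distances the rank is an injection of the n points into {1, …, n}, hence a
bijection, and rank k is taken exactly once. -/
theorem existsUnique_hits {n : ℕ} (hk : 1 ≤ k) (hkn : k ≤ n) (v : Fin n → ℝ × ℝ)
    (hinj : ∀ i j, i ≠ j → ν (v i - z) ≠ ν (v j - z)) :
    ∃ j, hits (nball ν z (ν (v j - z))) v = k ∧
      ∀ j', hits (nball ν z (ν (v j' - z))) v = k → j' = j := by
  have hmono : ∀ i j, ν (v i - z) < ν (v j - z) →
      hits (nball ν z (ν (v i - z))) v < hits (nball ν z (ν (v j - z))) v := by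
    intro i j hij
    rw [← card_filter_eq_hits, ← card_filter_eq_hits]
    apply Finset.card_lt_card
    rw [Finset.ssubset_iff_of_subset (Finset.monotone_filter_right _ fun l _ hl => hl.trans hij.le)]
    exact ⟨j, by simp, by simpa using hij⟩
  have hi : ∀ i j, hits (nball ν z (ν (v i - z))) v = hits (nball ν z (ν (v j - z))) v →
      i = j := by
    intro i j h
    by_contra hne
    rcases lt_or_gt_of_ne (hinj i j hne) with h1 | h1
    · exact (hmono i j h1).ne h
    · exact (hmono j i h1).ne' h
  have hpos : ∀ i, 1 ≤ hits (nball ν z (ν (v i - z))) v := by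
    intro i
    rw [← card_filter_eq_hits, Nat.one_le_iff_ne_zero, ← Nat.pos_iff_ne_zero, Finset.card_pos]
    exact ⟨i, by simp⟩
  have hs := Finset.surjOn_of_injOn_of_card_le (s := Finset.univ) (t := Finset.Icc 1 n)
    (fun i : Fin n => hits (nball ν z (ν (v i - z))) v)
    (fun i _ => by simpa using ⟨hpos i, hits_le _ v⟩) (fun i _ j _ h => hi i j h) (by simp)
  obtain ⟨j, -, hj⟩ := hs (show k ∈ (Finset.Icc 1 n : Set ℕ) by simp [hk, hkn])
  exact ⟨j, hj, fun j' hj' => hi j' j (hj'.trans hj.symm)⟩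

/-- Fubini: with one of the two points fixed, the other hits a given level of X with probability
zero. -/
theorem ae_pairwise_ne {E : Type*} [MeasurableSpace E] (μ : Measure E) [IsProbabilityMeasure μ]
    {X : E → ℝ} (hX : Measurable X) (h0 : ∀ r, μ {w | X w = r} = 0) (n : ℕ) :
    ∀ᵐ v ∂(Measure.pi fun _ : Fin n => μ), ∀ i j, i ≠ j → X (v i) ≠ X (v j) := by
  rw [ae_all_iff]
  intro i
  rw [ae_all_iff]
  intro j
  by_cases hij : i = j
  · simp [hij]
  obtain ⟨m, rfl⟩ : ∃ m, n = m + 1 := ⟨n - 1, by have := i.pos; omega⟩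
  obtain ⟨j', rfl⟩ := Fin.exists_succAbove_eq (x := j) (y := i) (Ne.symm hij)
  have hp := (measurePreserving_piFinSuccAbove (fun _ : Fin (m + 1) => μ) i)
  have hae : ∀ᵐ p ∂(μ.prod (Measure.pi fun _ : Fin m => μ)), X p.1 ≠ X (p.2 j') := by
    rw [Measure.ae_prod_iff_ae_ae]
    swap
    · exact (measurableSet_eq_fun (by fun_prop) (by fun_prop)).compl
    have hs := Measure.ae_ae_comm (μ := Measure.pi fun _ : Fin m => μ) (ν := μ)
      (p := fun v x => X x ≠ X (v j'))
      ((measurableSet_eq_fun (by fun_prop) (by fun_prop)).compl)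
    rw [← hs]
    refine Filter.Eventually.of_forall fun v => ?_
    rw [ae_iff]
    simpa using h0 (X (v j'))
  filter_upwards [hp.quasiMeasurePreserving.ae hae] with v hv _
  exact hv

open Classical in
/-- The expected local estimate at `z`, as an integral over the position of the `k`-th nearest
neighbour. -/
theorem integral_loc (hν : PlaneNorm ν c) (μ : Measure (ℝ × ℝ)) [IsProbabilityMeasure μ]
    {G : ℕ → ℝ} (hG : LogLike G) {κ a : ℝ} (hk : 1 ≤ k) (hkm : k ≤ m + 1)
    (h0 : ∀ r, μ {w | ν (w - z) = r} = 0) :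
    Integrable (fun w => ∫ u : Fin m → ℝ × ℝ,
        (if ν (w - z) ≤ a ∧ hits (nball ν z (ν (w - z))) u + 1 = k then
          κ - G (hits (stripX z (ν (w - z))) u + 1) - G (hits (stripY z (ν (w - z))) u + 1)
        else 0) ∂(Measure.pi fun _ => μ)) μ ∧
    ∫ v : Fin (m + 1) → ℝ × ℝ, loc ν k G κ a Finset.univ v z ∂(Measure.pi fun _ => μ) =
      (m + 1) * ∫ w, ∫ u : Fin m → ℝ × ℝ,
        (if ν (w - z) ≤ a ∧ hits (nball ν z (ν (w - z))) u + 1 = k then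
          κ - G (hits (stripX z (ν (w - z))) u + 1) - G (hits (stripY z (ν (w - z))) u + 1)
        else 0) ∂(Measure.pi fun _ => μ) ∂μ := by
  have hX : Measurable fun w : ℝ × ℝ => ν (w - z) := hν.measurable.comp (measurable_id.sub_const z)
  have hc : k ≤ (Finset.univ : Finset (Fin (m + 1))).card := by simpa using hkm
  have hlm : Measurable fun v : Fin (m + 1) → ℝ × ℝ => loc ν k G κ a Finset.univ v z :=
    measurable_loc (X := fun v => v) hν hk hc (fun l => measurable_pi_apply l) measurable_const
  have hsm : ∀ j, Measurable fun v : Fin (m + 1) → ℝ × ℝ =>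
      hits (nball ν z (ν (v j - z))) v := by
    intro j
    have e : ∀ v : Fin (m + 1) → ℝ × ℝ, hits (nball ν z (ν (v j - z))) v =
        (Finset.univ.filter fun l => ν (v l - z) ≤ ν (v j - z)).card :=
      fun v => (card_filter_eq_hits v z _).symm
    simp_rw [e]
    exact measurable_card_filter _ _ fun l => measurableSet_le
      (hX.comp (measurable_pi_apply l)) (hX.comp (measurable_pi_apply j))
  have hjm : ∀ j, Integrable (fun v : Fin (m + 1) → ℝ × ℝ =>
      if hits (nball ν z (ν (v j - z))) v = k then loc ν k G κ a Finset.univ v z else 0)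
      (Measure.pi fun _ => μ) := by
    intro j
    refine integrable_of_abs_le (Measurable.ite (hsm j (measurableSet_singleton k)) hlm
      measurable_const) (B := |κ| + 2 * (Real.log (m + 1 : ℕ) + 1)) fun v => ?_
    have hl : 0 ≤ Real.log (m + 1 : ℕ) := Real.log_natCast_nonneg _
    split_ifs
    · exact abs_loc_le hν hG hk hc (by simp)
    · rw [abs_zero]; positivity
  -- Almost surely exactly one point is the k-th neighbour, so the local estimate is the sum over
  -- candidates. By symmetry all m + 1 summands have the same mean.
  have hsum : ∀ᵐ v ∂(Measure.pi fun _ : Fin (m + 1) => μ), loc ν k G κ a Finset.univ v z =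
      ∑ j, if hits (nball ν z (ν (v j - z))) v = k then loc ν k G κ a Finset.univ v z else 0 := by
    filter_upwards [ae_pairwise_ne μ hX h0 (m + 1)] with v hv
    obtain ⟨j, hj, huniq⟩ := existsUnique_hits hk hkm v hv
    rw [Finset.sum_eq_single j]
    · simp [hj]
    · intro j' _ hne
      rw [if_neg fun h => hne (huniq j' h)]
    · simp
  have point : ∀ (j : Fin (m + 1)) (w : ℝ × ℝ), ∫ u : Fin m → ℝ × ℝ,
      (if hits (nball ν z (ν ((Fin.insertNth j w u : Fin (m + 1) → ℝ × ℝ) j - z)))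
          (Fin.insertNth j w u : Fin (m + 1) → ℝ × ℝ) = k then
        loc ν k G κ a Finset.univ (Fin.insertNth j w u : Fin (m + 1) → ℝ × ℝ) z else 0)
        ∂(Measure.pi fun _ => μ) = ∫ u : Fin m → ℝ × ℝ,
        (if ν (w - z) ≤ a ∧ hits (nball ν z (ν (w - z))) u + 1 = k then
          κ - G (hits (stripX z (ν (w - z))) u + 1) - G (hits (stripY z (ν (w - z))) u + 1)
        else 0) ∂(Measure.pi fun _ => μ) := by
    intro j w
    congr 1
    ext u
    have h1 : hits (nball ν z (ν (w - z))) (Fin.insertNth j w u : Fin (m + 1) → ℝ × ℝ) =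
        hits (nball ν z (ν (w - z))) u + 1 := by
      rw [hits_insertNth, if_pos (show w ∈ nball ν z (ν (w - z)) by simp [nball]), add_comm]
    rw [Fin.insertNth_apply_same, h1]
    by_cases hsel : hits (nball ν z (ν (w - z))) u + 1 = k
    · have hR := kRad_eq_of_hits (ν := ν) (z := z) hk hkm
        (Fin.insertNth j w u : Fin (m + 1) → ℝ × ℝ) j
        (by rw [Fin.insertNth_apply_same, h1, hsel])
      rw [Fin.insertNth_apply_same] at hR
      -- The k-th neighbour lies in its own ball and in both strips; this is the + 1 in each of the
      -- three counts.
      rw [if_pos hsel, loc, hR, cntX_eq_hits, cntY_eq_hits, hits_insertNth, hits_insertNth,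
        if_pos (show w ∈ stripX z (ν (w - z)) from hν.fst_le (w - z)),
        if_pos (show w ∈ stripY z (ν (w - z)) from hν.snd_le (w - z))]
      simp only [hsel, and_true, add_comm 1]
    · simp [hsel]
  have each : ∀ j : Fin (m + 1), ∫ v : Fin (m + 1) → ℝ × ℝ,
      (if hits (nball ν z (ν (v j - z))) v = k then loc ν k G κ a Finset.univ v z else 0)
        ∂(Measure.pi fun _ => μ) = ∫ w, ∫ u : Fin m → ℝ × ℝ,
        (if ν (w - z) ≤ a ∧ hits (nball ν z (ν (w - z))) u + 1 = k then
          κ - G (hits (stripX z (ν (w - z))) u + 1) - G (hits (stripY z (ν (w - z))) u + 1)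
        else 0) ∂(Measure.pi fun _ => μ) ∂μ := by
    intro j
    rw [integral_pi_insertNth μ j (hjm j)]
    simp_rw [point]
  refine ⟨?_, ?_⟩
  · have hp := (measurePreserving_piFinSuccAbove (fun _ : Fin (m + 1) => μ) 0).symm
    have := ((hp.integrable_comp_emb (MeasurableEquiv.measurableEmbedding _)).2
      (hjm 0)).integral_prod_left
    simp_rw [← point 0]
    exact this
  rw [integral_congr_ae hsum, integral_finsetSum _ fun j _ => hjm j]
  simp_rw [each]
  simp

end Decomposition

/-! ### Translation modulus of a piecewise smooth function on the line -/

/-- A nonnegative function on the line that is twice differentiable off a finite set, with bounded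
second derivative, bounded, bounded below where it does not vanish, and of bounded integral. -/
structure PiecewiseSmooth (A D c B : ℝ) (F : Finset ℝ) (g : ℝ → ℝ) : Prop where
  measurable : Measurable g
  c_pos : 0 < c
  A_nonneg : 0 ≤ A
  D_nonneg : 0 ≤ D
  B_nonneg : 0 ≤ B
  diff : ∀ x ∉ F, DifferentiableAt ℝ g x
  diff2 : ∀ x ∉ F, DifferentiableAt ℝ (deriv g) x
  deriv2_le : ∀ x ∉ F, |deriv (deriv g) x| ≤ D
  nonneg : ∀ x ∉ F, 0 ≤ g x
  le : ∀ x ∉ F, g x ≤ A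
  dichotomy : ∀ x ∉ F, g x = 0 ∨ c ≤ g x
  lintegral_le : ∫⁻ x, ENNReal.ofReal (g x) ≤ ENNReal.ofReal B

namespace PiecewiseSmooth

variable {A D c B : ℝ} {F : Finset ℝ} {g : ℝ → ℝ}

/-- On an interval free of singular points g is continuous with values in {0} ∪ [c, ∞), so by
connectedness it is identically zero or at least c. In the second case the bound B on the integral
limits the length. -/
theorem zero_or_length_le (hg : PiecewiseSmooth A D c B F g) {p q : ℝ}
    (hF : ∀ x ∈ Set.Ioo p q, x ∉ F) :
    (∀ x ∈ Set.Ioo p q, g x = 0) ∨ q - p ≤ B / c := by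
  rcases em (∀ x ∈ Set.Ioo p q, g x = 0) with h | h
  · exact Or.inl h
  right
  push Not at h
  obtain ⟨x₀, hx₀, hne⟩ := h
  have hall : ∀ x ∈ Set.Ioo p q, c ≤ g x := by
    by_contra! hcon
    obtain ⟨x₁, hx₁, hlt⟩ := hcon
    have hcont : ContinuousOn g (Set.Ioo p q) := fun x hx =>
      (hg.diff x (hF x hx)).continuousAt.continuousWithinAt
    have h0 : g x₁ = 0 := (hg.dichotomy x₁ (hF x₁ hx₁)).resolve_right (not_le.2 hlt)
    have h1 : c ≤ g x₀ := (hg.dichotomy x₀ (hF x₀ hx₀)).resolve_left hne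
    have := isPreconnected_Ioo.intermediate_value hx₁ hx₀ hcont
    obtain ⟨y, hy, hyv⟩ := this (show c / 2 ∈ Set.Icc (g x₁) (g x₀) by
      constructor <;> linarith [hg.c_pos])
    rcases hg.dichotomy y (hF y hy) with h | h <;> linarith [hg.c_pos]
  have hpq : p < q := hx₀.1.trans hx₀.2
  have h1 : ENNReal.ofReal (c * (q - p)) ≤ ENNReal.ofReal B := by
    calc ENNReal.ofReal (c * (q - p)) = ∫⁻ _ in Set.Ioo p q, ENNReal.ofReal c := by
          rw [setLIntegral_const, Real.volume_Ioo, ENNReal.ofReal_mul hg.c_pos.le]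
      _ ≤ ∫⁻ x in Set.Ioo p q, ENNReal.ofReal (g x) :=
          setLIntegral_mono (by have := hg.measurable; fun_prop)
            fun x hx => ENNReal.ofReal_le_ofReal (hall x hx)
      _ ≤ ∫⁻ x, ENNReal.ofReal (g x) := setLIntegral_le_lintegral _ _
      _ ≤ _ := hg.lintegral_le
  rw [ENNReal.ofReal_le_ofReal_iff hg.B_nonneg] at h1
  rw [le_div_iff₀ hg.c_pos]
  linarith

/-- The mean value theorem gives a point where the derivative is at most 2A/(q - p); the second
derivative bound carries this to the whole interval. -/
theorem abs_deriv_le (hg : PiecewiseSmooth A D c B F g) {p q : ℝ} (hpq : p < q)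
    (hF : ∀ x ∈ Set.Ioo p q, x ∉ F) {t : ℝ} (ht : t ∈ Set.Ioo p q) :
    |deriv g t| ≤ 2 * A / (q - p) + D * (q - p) := by
  -- The middle half is used so that the endpoints are themselves regular points.
  set p' := p + (q - p) / 4 with hp'
  set q' := q - (q - p) / 4 with hq'
  have hpq' : p' < q' := by rw [hp', hq']; linarith
  have hsub : Set.Icc p' q' ⊆ Set.Ioo p q := fun x hx =>
    ⟨by have := hx.1; rw [hp'] at this; linarith, by have := hx.2; rw [hq'] at this; linarith⟩
  obtain ⟨ξ, hξ, hd⟩ := exists_deriv_eq_slope g hpq'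
    (fun x hx => (hg.diff x (hF x (hsub hx))).continuousAt.continuousWithinAt)
    (fun x hx => (hg.diff x (hF x (hsub (Set.Ioo_subset_Icc_self hx)))).differentiableWithinAt)
  have hξ' : ξ ∈ Set.Ioo p q := hsub (Set.Ioo_subset_Icc_self hξ)
  have h1 : |deriv g ξ| ≤ 2 * A / (q - p) := by
    rw [hd, abs_div, abs_of_pos (by linarith : 0 < q' - p')]
    have e : q' - p' = (q - p) / 2 := by rw [hp', hq']; ring
    rw [e, div_div_eq_mul_div, mul_comm]
    apply div_le_div_of_nonneg_right _ (by linarith)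
    have a1 := hg.nonneg p' (hF _ (hsub (Set.left_mem_Icc.2 hpq'.le)))
    have a2 := hg.nonneg q' (hF _ (hsub (Set.right_mem_Icc.2 hpq'.le)))
    have a3 := hg.le p' (hF _ (hsub (Set.left_mem_Icc.2 hpq'.le)))
    have a4 := hg.le q' (hF _ (hsub (Set.right_mem_Icc.2 hpq'.le)))
    have : |g q' - g p'| ≤ A := by rw [abs_le]; constructor <;> linarith
    linarith
  have h2 : |deriv g t - deriv g ξ| ≤ D * |t - ξ| := by
    have := (convex_Ioo p q).norm_image_sub_le_of_norm_deriv_le (f := deriv g) (C := D)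
      (fun x hx => hg.diff2 x (hF x hx)) (fun x hx => hg.deriv2_le x (hF x hx)) hξ' ht
    simpa using this
  have h3 : |t - ξ| ≤ q - p := by
    rw [abs_le]
    constructor <;> linarith [ht.1, ht.2, hξ'.1, hξ'.2]
  have h4 := mul_le_mul_of_nonneg_left h3 hg.D_nonneg
  have h5 := abs_sub_abs_le_abs_sub (deriv g t) (deriv g ξ)
  linarith

/-- The derivative bound blows up like 1/(q - p) on short intervals, but it is integrated over a
length at most q - p, so the product stays bounded; long intervals are excluded by
`zero_or_length_le`. -/
theorem setLIntegral_le_of_disjoint (hg : PiecewiseSmooth A D c B F g) {p q h : ℝ} (hh : 0 < h)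
    (hF : ∀ x ∈ Set.Ioo p q, x ∉ F) :
    ∫⁻ x in Set.Ioo p (q - h), ENNReal.ofReal |g (x + h) - g x| ≤
      ENNReal.ofReal (h * (2 * A + D * (B / c) ^ 2)) := by
  rcases le_or_gt (q - h) p with hqp | hqp
  · rw [Set.Ioo_eq_empty (not_lt.2 hqp)]; simp
  have hpq : p < q := by linarith
  have hmem : ∀ x ∈ Set.Ioo p (q - h), x ∈ Set.Ioo p q ∧ x + h ∈ Set.Ioo p q := fun x hx =>
    ⟨⟨hx.1, by linarith [hx.2]⟩, ⟨by linarith [hx.1], by linarith [hx.2]⟩⟩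
  rcases hg.zero_or_length_le hF with h0 | hL
  · rw [setLIntegral_congr_fun (g := fun _ => 0) measurableSet_Ioo fun x hx => by
      simp [h0 _ (hmem x hx).1, h0 _ (hmem x hx).2]]
    simp
  · set K := 2 * A / (q - p) + D * (q - p) with hK
    have hbound : ∀ x ∈ Set.Ioo p (q - h), |g (x + h) - g x| ≤ K * h := by
      intro x hx
      have := (convex_Ioo p q).norm_image_sub_le_of_norm_deriv_le (f := g) (C := K)
        (fun x hx => hg.diff x (hF x hx)) (fun x hx => hg.abs_deriv_le hpq hF hx)
        (hmem x hx).1 (hmem x hx).2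
      simpa [abs_of_pos hh] using this
    have hKn : 0 ≤ K * h := by
      have := hg.A_nonneg
      have := hg.D_nonneg
      have : 0 < q - p := by linarith
      positivity
    calc ∫⁻ x in Set.Ioo p (q - h), ENNReal.ofReal |g (x + h) - g x|
        ≤ ∫⁻ _ in Set.Ioo p (q - h), ENNReal.ofReal (K * h) :=
          setLIntegral_mono measurable_const fun x hx => ENNReal.ofReal_le_ofReal (hbound x hx)
      _ = ENNReal.ofReal (K * h * (q - h - p)) := by
          rw [setLIntegral_const, Real.volume_Ioo, ENNReal.ofReal_mul hKn]
      _ ≤ _ := by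
          apply ENNReal.ofReal_le_ofReal
          have h1 : K * (q - p) = 2 * A + D * (q - p) ^ 2 := by
            rw [hK]
            have : q - p ≠ 0 := by linarith
            field_simp
          have h2 : (q - p) ^ 2 ≤ (B / c) ^ 2 := by
            have : 0 ≤ q - p := by linarith
            gcongr
          have h3 := mul_le_mul_of_nonneg_left h2 hg.D_nonneg
          calc K * h * (q - h - p) ≤ K * h * (q - p) := by gcongr; linarith
            _ = h * (K * (q - p)) := by ring
            _ ≤ _ := by rw [h1]; gcongr

theorem ae_abs_sub_le (hg : PiecewiseSmooth A D c B F g) (h : ℝ) :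
    ∀ᵐ x, |g (x + h) - g x| ≤ A := by
  have h1 : ∀ᵐ x : ℝ, x ∉ F := by
    rw [ae_iff]
    simpa using F.finite_toSet.measure_zero volume
  have h2 : ∀ᵐ x : ℝ, x + h ∉ F :=
    (measurePreserving_add_right volume h).quasiMeasurePreserving.ae h1
  filter_upwards [h1, h2] with x hx hx'
  rw [abs_le]
  constructor <;> linarith [hg.nonneg x hx, hg.nonneg _ hx', hg.le x hx, hg.le _ hx']

/-- Cut the interval at a singular point m. The two sides contain fewer singular points; the points
x whose segment to x + h straddles m form a set of length h, on which the increment is at most A. -/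
theorem setLIntegral_le (hg : PiecewiseSmooth A D c B F g) {h : ℝ} (hh : 0 < h) (n : ℕ)
    (p q : ℝ) (hn : (F.filter fun x => x ∈ Set.Ioo p q).card ≤ n) :
    ∫⁻ x in Set.Ioo p (q - h), ENNReal.ofReal |g (x + h) - g x| ≤
      ENNReal.ofReal (h * ((n + 1) * (2 * A + D * (B / c) ^ 2) + n * A)) := by
  have hA := hg.A_nonneg
  have hD := hg.D_nonneg
  induction n using Nat.strong_induction_on generalizing p q with
  | _ n ih =>
    rcases (F.filter fun x => x ∈ Set.Ioo p q).eq_empty_or_nonempty with hemp | ⟨m, hm⟩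
    · refine (hg.setLIntegral_le_of_disjoint hh (p := p) (q := q) fun x hx hxF => ?_).trans ?_
      · have : x ∈ F.filter fun x => x ∈ Set.Ioo p q := Finset.mem_filter.2 ⟨hxF, hx⟩
        rw [hemp] at this
        simp at this
      · apply ENNReal.ofReal_le_ofReal
        have : 0 ≤ (n : ℝ) * A := by positivity
        have : 0 ≤ (n : ℝ) * (2 * A + D * (B / c) ^ 2) := by positivity
        refine mul_le_mul_of_nonneg_left ?_ hh.le
        linarith
    · have hm' := hm
      rw [Finset.mem_filter] at hm'
      set F1 := F.filter fun x => x ∈ Set.Ioo p m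
      set F2 := F.filter fun x => x ∈ Set.Ioo m q
      have hcard : F1.card + F2.card + 1 ≤ n := by
        refine le_trans ?_ hn
        have hd : Disjoint F1 F2 := by
          rw [Finset.disjoint_left]
          intro x h1 h2
          exact absurd ((Finset.mem_filter.1 h1).2.2.trans (Finset.mem_filter.1 h2).2.1)
            (lt_irrefl _)
        rw [← Finset.card_union_of_disjoint hd,
          ← Finset.card_insert_of_notMem (a := m) (by simp [F1, F2])]
        apply Finset.card_le_card
        intro x hx
        rw [Finset.mem_insert, Finset.mem_union, Finset.mem_filter, Finset.mem_filter] at hx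
        rw [Finset.mem_filter]
        rcases hx with rfl | ⟨h1, h2⟩ | ⟨h1, h2⟩
        · exact hm'
        · exact ⟨h1, h2.1, h2.2.trans hm'.2.2⟩
        · exact ⟨h1, hm'.2.1.trans h2.1, h2.2⟩
      have i1 := ih F1.card (by omega) p m le_rfl
      have i2 := ih F2.card (by omega) m q le_rfl
      have i3 : ∫⁻ x in Set.Icc (m - h) m, ENNReal.ofReal |g (x + h) - g x| ≤
          ENNReal.ofReal (h * A) := by
        calc _ ≤ ∫⁻ _ in Set.Icc (m - h) m, ENNReal.ofReal A := by
              apply lintegral_mono_ae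
              filter_upwards [ae_restrict_of_ae (hg.ae_abs_sub_le h)] with x hx
              exact ENNReal.ofReal_le_ofReal hx
          _ = _ := by
              rw [setLIntegral_const, Real.volume_Icc, ← ENNReal.ofReal_mul hA]
              congr 1; ring
      have hsub : Set.Ioo p (q - h) ⊆ Set.Ioo p (m - h) ∪ (Set.Icc (m - h) m ∪ Set.Ioo m (q - h)) := by
        intro x hx
        rcases lt_or_ge x (m - h) with h1 | h1
        · exact Or.inl ⟨hx.1, h1⟩
        · rcases le_or_gt x m with h2 | h2
          · exact Or.inr (Or.inl ⟨h1, h2⟩)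
          · exact Or.inr (Or.inr ⟨h2, hx.2⟩)
      refine (lintegral_mono_set hsub).trans ((lintegral_union_le _ _ _).trans
        ((add_le_add i1 ((lintegral_union_le _ _ _).trans (add_le_add i3 i2))).trans ?_))
      rw [← ENNReal.ofReal_add (by positivity) (by positivity),
        ← ENNReal.ofReal_add (by positivity) (by positivity)]
      apply ENNReal.ofReal_le_ofReal
      have hc' : (F1.card : ℝ) + F2.card + 1 ≤ n := by exact_mod_cast hcard
      set K := 2 * A + D * (B / c) ^ 2 with hK
      have hK0 : 0 ≤ K := by positivity
      calc _ = h * ((F1.card + F2.card + 1 + 1) * K + (F1.card + F2.card + 1) * A) := by ring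
        _ ≤ _ := by gcongr

theorem lintegral_translate_le (hg : PiecewiseSmooth A D c B F g) {h : ℝ} (hh : 0 < h) :
    ∫⁻ x, ENNReal.ofReal |g (x + h) - g x| ≤
      ENNReal.ofReal (h * ((2 * (2 * A + D * (B / c) ^ 2) + A) * F.card)) := by
  have hA := hg.A_nonneg
  have hD := hg.D_nonneg
  have key : ∀ R : ℕ, ∫⁻ x in Set.Ioo (-R : ℝ) R, ENNReal.ofReal |g (x + h) - g x| ≤
      ENNReal.ofReal (h * ((2 * (2 * A + D * (B / c) ^ 2) + A) * F.card)) := by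
    intro R
    -- Without singular points g vanishes identically, since its interval would be the whole line.
    -- This is why the bound is proportional to the number of singular points, with no additive
    -- constant, and can be integrated over all parallel lines.
    rcases F.eq_empty_or_nonempty with rfl | hne
    · have h0 : ∀ x, g x = 0 := by
        intro x
        rcases hg.zero_or_length_le (p := x - (B / c + 1)) (q := x + (B / c + 1))
          (fun y _ => by simp) with h | h
        · have : 0 ≤ B / c := div_nonneg hg.B_nonneg hg.c_pos.le
          exact h x ⟨by linarith, by linarith⟩
        · have : 0 ≤ B / c := div_nonneg hg.B_nonneg hg.c_pos.le
          linarith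
      simp [h0]
    · have := hg.setLIntegral_le hh F.card (-R) (R + h) (Finset.card_filter_le _ _)
      rw [add_sub_cancel_right] at this
      refine this.trans (ENNReal.ofReal_le_ofReal ?_)
      have h1 : (1 : ℝ) ≤ F.card := by exact_mod_cast hne.card_pos
      gcongr
      have : 0 ≤ 2 * A + D * (B / c) ^ 2 := by positivity
      nlinarith
  have hU : (⋃ R : ℕ, Set.Ioo (-R : ℝ) R) = Set.univ := by
    ext x
    simp only [Set.mem_iUnion, Set.mem_Ioo, Set.mem_univ, iff_true]
    obtain ⟨n, hn⟩ := exists_nat_gt |x|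
    exact ⟨n, by linarith [neg_abs_le x], by linarith [le_abs_self x]⟩
  rw [← setLIntegral_univ, ← hU, setLIntegral_iUnion_of_directed]
  · exact iSup_le key
  · apply Monotone.directed_le
    intro a b hab
    have : (a : ℝ) ≤ b := by exact_mod_cast hab
    exact Set.Ioo_subset_Ioo (by linarith) this

end PiecewiseSmooth

/-! ### Slices of sets of finite one-dimensional Hausdorff measure -/

/-- Eilenberg's inequality for a `1`-Lipschitz map to the line: the number of points in the fibres
is dominated by a measurable function whose integral is at most the Hausdorff measure. -/
theorem exists_fibre_count_le {X : Type*} [EMetricSpace X] [MeasurableSpace X] [BorelSpace X]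
    {π : X → ℝ} (hπ : LipschitzWith 1 π) (S : Set X) (hS : Measure.hausdorffMeasure 1 S ≠ ∞) :
    ∃ g : ℝ → ℝ≥0∞, Measurable g ∧ ∫⁻ y, g y ≤ Measure.hausdorffMeasure 1 S ∧
      ∀ (y : ℝ) (T : Finset X), (∀ x ∈ T, x ∈ S ∧ π x = y) → (T.card : ℝ≥0∞) ≤ g y := by
  classical
  have hcov : ∀ m : ℕ, ∃ t : ℕ → Set X, S ⊆ ⋃ n, t n ∧
      (∀ n, Metric.ediam (t n) ≤ ((m : ℝ≥0∞) + 1)⁻¹) ∧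
      ∑' n, Metric.ediam (t n) ≤ Measure.hausdorffMeasure 1 S + ((m : ℝ≥0∞) + 1)⁻¹ := by
    intro m
    have hm : (0 : ℝ≥0∞) < ((m : ℝ≥0∞) + 1)⁻¹ := by
      rw [ENNReal.inv_pos]
      exact ENNReal.add_ne_top.2 ⟨ENNReal.natCast_ne_top m, ENNReal.one_ne_top⟩
    have h1 : ⨅ (t : ℕ → Set X) (_ : S ⊆ ⋃ n, t n)
        (_ : ∀ n, Metric.ediam (t n) ≤ ((m : ℝ≥0∞) + 1)⁻¹),
        ∑' n, ⨆ _ : (t n).Nonempty, Metric.ediam (t n) ^ (1 : ℝ) <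
          Measure.hausdorffMeasure 1 S + ((m : ℝ≥0∞) + 1)⁻¹ := by
      refine lt_of_le_of_lt ?_ (ENNReal.lt_add_right hS hm.ne')
      rw [Measure.hausdorffMeasure_apply]
      exact le_iSup₂_of_le _ hm le_rfl
    simp only [iInf_lt_iff] at h1
    obtain ⟨t, ht1, ht2, ht3⟩ := h1
    refine ⟨t, ht1, ht2, le_trans (le_of_eq ?_) ht3.le⟩
    congr 1
    ext n
    rcases (t n).eq_empty_or_nonempty with h | h
    · simp [h]
    · simp [h]
  choose t htS htd htsum using hcov
  -- The projections of the covering sets need not be measurable, so they are replaced by measurable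
  -- hulls of the same length, at most the diameter of the covering set. The fibre count at scale m
  -- is the number of hulls over y; Fatou then controls the lower limit.
  set J : ℕ → ℕ → Set ℝ := fun m n => toMeasurable volume (π '' t m n) with hJ
  have hJm : ∀ m n, MeasurableSet (J m n) := fun m n => measurableSet_toMeasurable _ _
  have hJv : ∀ m n, volume (J m n) ≤ Metric.ediam (t m n) := by
    intro m n
    rw [hJ]
    simp only
    rw [measure_toMeasurable]
    refine (Real.volume_le_diam _).trans ?_
    simpa using hπ.ediam_image_le (t m n)
  set g : ℕ → ℝ → ℝ≥0∞ := fun m y => ∑' n, (J m n).indicator (fun _ => 1) y with hg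
  have hgm : ∀ m, Measurable (g m) := fun m =>
    Measurable.tsum fun n => measurable_const.indicator (hJm m n)
  have hgi : ∀ m, ∫⁻ y, g m y ≤ Measure.hausdorffMeasure 1 S + ((m : ℝ≥0∞) + 1)⁻¹ := by
    intro m
    rw [hg]
    simp only
    rw [lintegral_tsum fun n => (measurable_const.indicator (hJm m n)).aemeasurable]
    refine le_trans (ENNReal.tsum_le_tsum fun n => ?_) (htsum m)
    rw [lintegral_indicator_const (hJm m n), one_mul]
    exact hJv m n
  refine ⟨fun y => Filter.liminf (fun m => g m y) Filter.atTop, Measurable.liminf hgm, ?_, ?_⟩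
  · refine (lintegral_liminf_le hgm).trans ?_
    have hlim : Filter.Tendsto (fun m : ℕ => Measure.hausdorffMeasure 1 S + ((m : ℝ≥0∞) + 1)⁻¹)
        Filter.atTop (nhds (Measure.hausdorffMeasure 1 S + 0)) := by
      refine tendsto_const_nhds.add ?_
      have := ENNReal.tendsto_inv_nat_nhds_zero.comp (Filter.tendsto_add_atTop_nat 1)
      simpa [Function.comp_def] using this
    rw [add_zero] at hlim
    rw [← hlim.liminf_eq]
    exact Filter.liminf_le_liminf (Filter.Eventually.of_forall hgi)
  · intro y T hT
    refine Filter.le_liminf_of_le (by isBoundedDefault) ?_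
    -- Once the scale is finer than the separation of T, distinct points of T lie in distinct
    -- covering sets.
    have hsep : ∀ᶠ m : ℕ in Filter.atTop, ∀ x ∈ T, ∀ x' ∈ T, x ≠ x' →
        ((m : ℝ≥0∞) + 1)⁻¹ < edist x x' := by
      simp only [Filter.eventually_all_finset, Filter.eventually_imp_distrib_left]
      intro x _ x' _ hne
      have := ENNReal.tendsto_inv_nat_nhds_zero.comp (Filter.tendsto_add_atTop_nat 1)
      have := this.eventually (gt_mem_nhds (edist_pos.2 hne))
      simpa [Function.comp_def] using this
    filter_upwards [hsep] with m hm
    have hex : ∀ x ∈ T, ∃ n, x ∈ t m n := fun x hx => Set.mem_iUnion.1 (htS m (hT x hx).1)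
    choose! φ hφ using hex
    have hinj : Set.InjOn φ T := by
      intro x hx x' hx' heq
      by_contra hne
      refine absurd (hm x hx x' hx' hne) (not_lt.2 ?_)
      refine (Metric.edist_le_ediam_of_mem (hφ x hx) ?_).trans (htd m (φ x))
      rw [heq]; exact hφ x' hx'
    calc (T.card : ℝ≥0∞) = ((T.image φ).card : ℝ≥0∞) := by rw [Finset.card_image_of_injOn hinj]
      _ = ∑ n ∈ T.image φ, 1 := by simp
      _ ≤ ∑ n ∈ T.image φ, (J m n).indicator (fun _ => 1) y := by
          refine Finset.sum_le_sum fun n hn => ?_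
          obtain ⟨x, hx, rfl⟩ := Finset.mem_image.1 hn
          rw [Set.indicator_of_mem]
          exact subset_toMeasurable _ _ ⟨x, hφ x hx, (hT x hx).2⟩
      _ ≤ g m y := ENNReal.sum_le_tsum _

/-! ### Regularity along lines -/

section RegularAt

variable {E : Type*} [NormedAddCommGroup E] [NormedSpace ℝ E] {C C' : ℝ} {g : E → ℝ} {z : E}

theorem RegularAt.mono (h : RegularAt C g z) (hC : C ≤ C') : RegularAt C' g z :=
  ⟨h.1, h.2.trans_le hC⟩

theorem RegularAt.along_line {p e : E} (he : ‖e‖ ≤ 1) {t : ℝ} (h : RegularAt C g (p + t • e)) :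
    DifferentiableAt ℝ (fun s : ℝ => g (p + s • e)) t ∧
    DifferentiableAt ℝ (deriv fun s : ℝ => g (p + s • e)) t ∧
    |deriv (deriv fun s : ℝ => g (p + s • e)) t| ≤ C := by
  obtain ⟨hc, hC⟩ := h
  have hl : ∀ s : ℝ, HasDerivAt (fun s : ℝ => p + s • e) e s := fun s => by
    simpa using ((hasDerivAt_id s).smul_const e).const_add p
  have hev : ∀ᶠ s in nhds t, HasDerivAt (fun s : ℝ => g (p + s • e)) (fderiv ℝ g (p + s • e) e) s := by
    have h1 : ∀ᶠ w in nhds (p + t • e), ContDiffAt ℝ 2 g w := hc.eventually (by simp)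
    filter_upwards [(hl t).continuousAt.eventually h1] with s hs
    exact (hs.differentiableAt (by simp)).hasFDerivAt.comp_hasDerivAt s (hl s)
  have hder : deriv (fun s : ℝ => g (p + s • e)) =ᶠ[nhds t] fun s => fderiv ℝ g (p + s • e) e :=
    hev.mono fun s hs => hs.deriv
  have h2 : DifferentiableAt ℝ (fderiv ℝ g) (p + t • e) :=
    (hc.fderiv_right (m := 1) (by norm_num)).differentiableAt (by simp)
  have h3 : HasDerivAt (fun s : ℝ => fderiv ℝ g (p + s • e) e)
      (fderiv ℝ (fderiv ℝ g) (p + t • e) e e) t := by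
    have := h2.hasFDerivAt.comp_hasDerivAt t (hl t)
    exact this.clm_apply (hasDerivAt_const t e) |>.congr_deriv (by simp)
  have h4 := h3.congr_of_eventuallyEq hder
  refine ⟨hev.self_of_nhds.differentiableAt, h4.differentiableAt, ?_⟩
  rw [h4.deriv]
  have h5 := (fderiv ℝ (fderiv ℝ g) (p + t • e)).le_opNorm₂ e e
  have h6 : 0 ≤ ‖fderiv ℝ (fderiv ℝ g) (p + t • e)‖ :=
    norm_nonneg (fderiv ℝ (fderiv ℝ g) (p + t • e))
  rw [Real.norm_eq_abs] at h5
  have h7 : ‖fderiv ℝ (fderiv ℝ g) (p + t • e)‖ * ‖e‖ * ‖e‖ ≤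
      ‖fderiv ℝ (fderiv ℝ g) (p + t • e)‖ * 1 * 1 := by gcongr
  linarith

theorem RegularAt.real {g : ℝ → ℝ} {t : ℝ} (h : RegularAt C g t) :
    DifferentiableAt ℝ g t ∧ DifferentiableAt ℝ (deriv g) t ∧ |deriv (deriv g) t| ≤ C := by
  have := RegularAt.along_line (p := 0) (e := (1 : ℝ)) (t := t) (C := C) (g := g) (by simp)
    (by simpa using h)
  simpa using this

/-- Quadrature of a function with bounded second derivative. -/
theorem abs_integral_sub_le_of_regularAt {g : ℝ → ℝ} (hC : 0 ≤ C) {x r : ℝ} (hr : 0 ≤ r)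
    (h : ∀ t ∈ Set.Icc (x - r) (x + r), RegularAt C g t) :
    |(∫ t in (x - r)..(x + r), g t) - 2 * r * g x| ≤ 2 * C * r ^ 3 := by
  have hx : x ∈ Set.Icc (x - r) (x + r) := ⟨by linarith, by linarith⟩
  have hd1 : ∀ t ∈ Set.Icc (x - r) (x + r), |deriv g t - deriv g x| ≤ C * r := by
    intro t ht
    have := (convex_Icc (x - r) (x + r)).norm_image_sub_le_of_norm_deriv_le (f := deriv g) (C := C)
      (fun t ht => (h t ht).real.2.1) (fun t ht => (h t ht).real.2.2) hx ht
    have h2 : |t - x| ≤ r := by rw [abs_le]; constructor <;> linarith [ht.1, ht.2]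
    simp only [Real.norm_eq_abs] at this
    exact this.trans (mul_le_mul_of_nonneg_left h2 hC)
  have hd2 : ∀ t ∈ Set.Icc (x - r) (x + r), |g t - g x - deriv g x * (t - x)| ≤ C * r ^ 2 := by
    intro t ht
    have hder : ∀ s ∈ Set.Icc (x - r) (x + r),
        HasDerivAt (fun s => g s - deriv g x * s) (deriv g s - deriv g x) s := fun s hs => by
      exact ((h s hs).real.1.hasDerivAt.sub ((hasDerivAt_id s).const_mul (deriv g x))).congr_deriv
        (by ring)
    have := (convex_Icc (x - r) (x + r)).norm_image_sub_le_of_norm_deriv_le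
      (f := fun s => g s - deriv g x * s) (C := C * r)
      (fun t ht => (hder t ht).differentiableAt)
      (fun t ht => by rw [(hder t ht).deriv]; exact hd1 t ht) hx ht
    have h2 : |t - x| ≤ r := by rw [abs_le]; constructor <;> linarith [ht.1, ht.2]
    simp only [Real.norm_eq_abs] at this
    have e : g t - deriv g x * t - (g x - deriv g x * x) = g t - g x - deriv g x * (t - x) := by
      ring
    rw [e] at this
    calc _ ≤ C * r * |t - x| := this
      _ ≤ C * r * r := by gcongr
      _ = _ := by ring
  have hle : x - r ≤ x + r := by linarith
  have hgc : ContinuousOn g (Set.Icc (x - r) (x + r)) := fun t ht =>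
    (h t ht).real.1.continuousAt.continuousWithinAt
  have hgi : IntervalIntegrable g volume (x - r) (x + r) :=
    hgc.intervalIntegrable_of_Icc hle
  have hli : IntervalIntegrable (fun t => g x + deriv g x * (t - x)) volume (x - r) (x + r) :=
    Continuous.intervalIntegrable (by fun_prop) _ _
  -- The linear Taylor term integrates to zero over the symmetric interval, which is why the error
  -- is cubic in r.
  have e1 : ∫ t in (x - r)..(x + r), (g x + deriv g x * (t - x)) = 2 * r * g x := by
    rw [intervalIntegral.integral_add (by simp) (Continuous.intervalIntegrable (by fun_prop) _ _),
      intervalIntegral.integral_const_mul, intervalIntegral.integral_sub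
        (Continuous.intervalIntegrable (by fun_prop) _ _) (by simp), integral_id]
    simp only [intervalIntegral.integral_const, smul_eq_mul]
    ring
  rw [← e1, ← intervalIntegral.integral_sub hgi hli]
  have := intervalIntegral.norm_integral_le_of_norm_le_const (a := x - r) (b := x + r)
    (f := fun t => g t - (g x + deriv g x * (t - x))) (C := C * r ^ 2) (fun t ht => by
      rw [Set.uIoc_of_le hle] at ht
      rw [Real.norm_eq_abs, ← sub_sub]
      exact hd2 t (Set.Ioc_subset_Icc_self ht))
  rw [Real.norm_eq_abs] at this
  refine this.trans (le_of_eq ?_)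
  rw [abs_of_nonneg (by linarith)]
  ring

end RegularAt

/-- Leaving a closed set is an open condition, and nonempty open sets have positive measure. This
turns almost-everywhere bounds on f into bounds at every regular point, as needed for restricting f
to lines. -/
theorem of_ae_of_continuousAt {X : Type*} [TopologicalSpace X] [MeasurableSpace X]
    {μ : Measure X} [μ.IsOpenPosMeasure] {f : X → ℝ} {s : Set ℝ} (hs : IsClosed s)
    (hae : ∀ᵐ z ∂μ, f z ∈ s) {z : X} (hz : ContinuousAt f z) : f z ∈ s := by
  by_contra hcon
  have h1 : ∀ᶠ w in nhds z, f w ∉ s := hz.eventually (hs.isOpen_compl.mem_nhds hcon)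
  have h2 := Measure.measure_pos_of_mem_nhds μ h1
  rw [ae_iff] at hae
  exact h2.ne' hae

/-- On finite sets the zero-dimensional measure is the number of points, and a set whose finite
subsets have bounded size is finite. -/
theorem finite_of_hausdorffMeasure_zero_le {S : Set ℝ} {C : ℝ}
    (h : Measure.hausdorffMeasure 0 S ≤ ENNReal.ofReal C) :
    ∃ F : Finset ℝ, (F : Set ℝ) = S ∧ (F.card : ℝ) ≤ |C| := by
  have key : ∀ T : Finset ℝ, (T : Set ℝ) ⊆ S → (T.card : ℝ) ≤ |C| := by
    intro T hT
    have h1 : (T.card : ℝ≥0∞) ≤ ENNReal.ofReal |C| := by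
      have e : Measure.hausdorffMeasure 0 (T : Set ℝ) = (T.card : ℝ≥0∞) := by
        have e1 := measure_biUnion_finset (μ := Measure.hausdorffMeasure 0) (s := T)
          (f := fun x : ℝ => {x}) (fun x _ y _ h => by simpa using h)
          (fun x _ => measurableSet_singleton x)
        rw [← Set.biUnion_of_singleton (T : Set ℝ)]
        simpa using e1
      rw [← e]
      exact (measure_mono hT).trans (h.trans (ENNReal.ofReal_le_ofReal (le_abs_self C)))
    rw [← ENNReal.ofReal_natCast, ENNReal.ofReal_le_ofReal_iff (abs_nonneg C)] at h1
    exact h1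
  have hfin : S.Finite := by
    by_contra hinf
    obtain ⟨T, hT, hc⟩ := Set.Infinite.exists_subset_card_eq hinf (⌊|C|⌋₊ + 1)
    have := key T hT
    rw [hc] at this
    have h2 := Nat.lt_floor_add_one |C|
    push_cast at this
    linarith
  exact ⟨hfin.toFinset, by simp, key _ (by simp)⟩

/-! ### Translation modulus in the plane -/

/-- On almost every horizontal line the slice is piecewise smooth with at most n y singular points.
The one-dimensional estimate is linear in that number, and n has integral at most L. -/
theorem lintegral_translate_fst_le {φ : ℝ × ℝ → ℝ} {S : Set (ℝ × ℝ)} {A D c B L : ℝ}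
    (hc : 0 < c) (hA : 0 ≤ A) (hD : 0 ≤ D) (hB : 0 ≤ B) (hφ : Measurable φ)
    (hint : ∀ᵐ y, ∫⁻ x, ENNReal.ofReal (φ (x, y)) ≤ ENNReal.ofReal B)
    (hval : ∀ z ∉ S, 0 ≤ φ z ∧ φ z ≤ A ∧ (φ z = 0 ∨ c ≤ φ z))
    (hder : ∀ x y, (x, y) ∉ S → DifferentiableAt ℝ (fun t => φ (t, y)) x ∧
      DifferentiableAt ℝ (deriv fun t => φ (t, y)) x ∧ |deriv (deriv fun t => φ (t, y)) x| ≤ D)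
    {n : ℝ → ℝ≥0∞} (hn : Measurable n) (hnL : ∫⁻ y, n y ≤ ENNReal.ofReal L)
    (hS : ∀ (y : ℝ) (T : Finset ℝ), (∀ x ∈ T, (x, y) ∈ S) → (T.card : ℝ≥0∞) ≤ n y) (h : ℝ) :
    ∫⁻ z : ℝ × ℝ, ENNReal.ofReal |φ (z.1 + h, z.2) - φ z| ≤
      ENNReal.ofReal (|h| * ((2 * (2 * A + D * (B / c) ^ 2) + A) * L)) := by
  set K := 2 * (2 * A + D * (B / c) ^ 2) + A with hK
  have hK0 : 0 ≤ K := by positivity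
  have pos : ∀ h : ℝ, 0 < h → ∫⁻ z : ℝ × ℝ, ENNReal.ofReal |φ (z.1 + h, z.2) - φ z| ≤
      ENNReal.ofReal (h * (K * L)) := by
    intro h hh
    rw [Measure.volume_eq_prod, lintegral_prod_symm _ (by fun_prop)]
    have hfin : ∀ᵐ y, n y < ∞ :=
      ae_lt_top hn (hnL.trans_lt ENNReal.ofReal_lt_top).ne
    have hline : ∀ᵐ y, ∫⁻ x, ENNReal.ofReal |φ (x + h, y) - φ (x, y)| ≤
        ENNReal.ofReal (h * K) * n y := by
      filter_upwards [hfin, hint] with y hy hyB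
      have hfinite : {x : ℝ | (x, y) ∈ S}.Finite := by
        by_contra hinf
        obtain ⟨N, hN⟩ := ENNReal.exists_nat_gt hy.ne
        obtain ⟨T, hT, hcT⟩ := Set.Infinite.exists_subset_card_eq hinf N
        have := hS y T fun x hx => hT hx
        rw [hcT] at this
        exact absurd this (not_le.2 hN)
      set F := hfinite.toFinset with hF
      have hmem : ∀ x, x ∉ F → (x, y) ∉ S := fun x hx => by simpa [hF] using hx
      have hps : PiecewiseSmooth A D c B F fun x => φ (x, y) :=
        { measurable := by fun_prop
          c_pos := hc
          A_nonneg := hA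
          D_nonneg := hD
          B_nonneg := hB
          diff := fun x hx => (hder x y (hmem x hx)).1
          diff2 := fun x hx => (hder x y (hmem x hx)).2.1
          deriv2_le := fun x hx => (hder x y (hmem x hx)).2.2
          nonneg := fun x hx => (hval _ (hmem x hx)).1
          le := fun x hx => (hval _ (hmem x hx)).2.1
          dichotomy := fun x hx => (hval _ (hmem x hx)).2.2
          lintegral_le := hyB }
      refine (hps.lintegral_translate_le hh).trans ?_
      rw [← mul_assoc, ENNReal.ofReal_mul (by positivity), ENNReal.ofReal_natCast]
      gcongr
      exact hS y F fun x hx => by simpa [hF] using hx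
    refine (lintegral_mono_ae hline).trans ?_
    rw [lintegral_const_mul _ hn, ← mul_assoc, ENNReal.ofReal_mul (p := h * K) (by positivity)]
    exact mul_le_mul_right hnL _
  rcases lt_trichotomy h 0 with h0 | rfl | h0
  -- A leftward shift becomes a rightward one after translating the variable of integration.
  · have e := lintegral_add_right_eq_self (μ := (volume : Measure (ℝ × ℝ)))
      (fun z => ENNReal.ofReal |φ (z.1 + h, z.2) - φ z|) ((-h, 0) : ℝ × ℝ)
    rw [← e, abs_of_neg h0]
    refine le_trans (le_of_eq ?_) (pos (-h) (by linarith))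
    refine lintegral_congr fun z => ?_
    rw [abs_sub_comm]
    have e2 : z + (-h, 0) = (z.1 + -h, z.2) := by ext <;> simp
    simp [e2]
  · simp
  · rw [abs_of_pos h0]
    exact pos h h0

/-! ### Consequences of the regularity assumptions -/

namespace IsPdf

variable {f : ℝ × ℝ → ℝ}

theorem integrable (hf : IsPdf f) : Integrable f := by
  refine ⟨hf.measurable.aestronglyMeasurable, ?_⟩
  rw [hasFiniteIntegral_iff_ofReal (Filter.Eventually.of_forall hf.nonneg), hf.lintegral_eq_one]
  exact ENNReal.one_lt_top

theorem swap (hf : IsPdf f) : IsPdf (f ∘ Prod.swap) where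
  measurable := hf.measurable.comp measurable_swap
  nonneg z := hf.nonneg _
  lintegral_eq_one := by
    rw [← hf.lintegral_eq_one, Measure.volume_eq_prod]
    exact lintegral_prod_swap (μ := (volume : Measure ℝ)) (ν := (volume : Measure ℝ))
      (fun z => ENNReal.ofReal (f z))

theorem isProbabilityMeasure_law (hf : IsPdf f) : IsProbabilityMeasure (law f) :=
  ⟨by rw [law, withDensity_apply _ MeasurableSet.univ, setLIntegral_univ, hf.lintegral_eq_one]⟩

theorem margX_nonneg (hf : IsPdf f) (x : ℝ) : 0 ≤ margX f x :=
  integral_nonneg fun _ => hf.nonneg _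

theorem measurable_margX (hf : IsPdf f) : Measurable (margX f) :=
  (hf.measurable.stronglyMeasurable.integral_prod_right').measurable

theorem ae_lintegral_slice (hf : IsPdf f) :
    ∀ᵐ x, ∫⁻ y, ENNReal.ofReal (f (x, y)) = ENNReal.ofReal (margX f x) := by
  have h := hf.integrable
  rw [Measure.volume_eq_prod] at h
  filter_upwards [h.prod_right_ae] with x hx
  rw [margX, ofReal_integral_eq_lintegral_ofReal hx
    (Filter.Eventually.of_forall fun y => hf.nonneg _)]

/-- An exponential tail bound forces the density to be bounded below on its support. -/
theorem ae_lower_of_tail (hf : IsPdf f) {Cc C0 : ℝ}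
    (h : ∀ b : ℝ, 1 < b → ∫ z, f z * Real.exp (-b * f z) ≤ Cc * Real.exp (-C0 * b)) :
    ∀ᵐ z, f z ≠ 0 → C0 ≤ f z := by
  have key : ∀ n : ℕ, ∀ᵐ z, f z ≠ 0 → C0 - 1 / ((n : ℝ) + 1) < f z := by
    intro n
    set ε : ℝ := 1 / ((n : ℝ) + 1) with hε
    have hεpos : 0 < ε := by positivity
    set A : Set (ℝ × ℝ) := {z | f z ≤ C0 - ε} with hA
    have hAm : MeasurableSet A := measurableSet_le hf.measurable measurable_const
    -- On A the weight exp(-b f) is at least exp(-b (C0 - ε)), so the assumed decay exp(-C0 b)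
    -- leaves a factor exp(-ε b). Letting b tend to infinity shows that A carries no mass.
    have hb : ∀ b : ℝ, 1 < b → ∫ z in A, f z ≤ Cc * Real.exp (-(ε * b)) := by
      intro b hb
      have hint : Integrable fun z => f z * Real.exp (-b * f z) := by
        refine hf.integrable.mono' ?_ (Filter.Eventually.of_forall fun z => ?_)
        · have := hf.measurable
          exact (by fun_prop : Measurable fun z => f z * Real.exp (-b * f z)).aestronglyMeasurable
        · rw [Real.norm_eq_abs, abs_of_nonneg (mul_nonneg (hf.nonneg z) (Real.exp_pos _).le)]
          refine mul_le_of_le_one_right (hf.nonneg z) (Real.exp_le_one_iff.2 ?_)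
          nlinarith [hf.nonneg z]
      have h1 : ∫ z in A, f z * Real.exp (-b * (C0 - ε)) ≤ ∫ z, f z * Real.exp (-b * f z) := by
        calc _ ≤ ∫ z in A, f z * Real.exp (-b * f z) := by
              refine setIntegral_mono_on (hf.integrable.integrableOn.mul_const _)
                hint.integrableOn hAm fun z hz => ?_
              refine mul_le_mul_of_nonneg_left (Real.exp_le_exp.2 ?_) (hf.nonneg z)
              have : f z ≤ C0 - ε := hz
              nlinarith
          _ ≤ _ := setIntegral_le_integral hint (Filter.Eventually.of_forall fun z =>
              mul_nonneg (hf.nonneg z) (Real.exp_pos _).le)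
      rw [integral_mul_const] at h1
      have h2 := h1.trans (h b hb)
      have h3 := mul_le_mul_of_nonneg_right h2 (Real.exp_pos (b * (C0 - ε))).le
      rw [mul_assoc, mul_assoc, ← Real.exp_add, ← Real.exp_add] at h3
      have e1 : -b * (C0 - ε) + b * (C0 - ε) = 0 := by ring
      have e2 : -C0 * b + b * (C0 - ε) = -(ε * b) := by ring
      rwa [e1, e2, Real.exp_zero, mul_one] at h3
    have hlim : Filter.Tendsto (fun b : ℝ => Cc * Real.exp (-(ε * b))) Filter.atTop
        (nhds (Cc * 0)) := by
      refine Filter.Tendsto.const_mul _ (Real.tendsto_exp_neg_atTop_nhds_zero.comp ?_)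
      exact Filter.tendsto_id.const_mul_atTop hεpos
    rw [mul_zero] at hlim
    have h0 : ∫ z in A, f z ≤ 0 := by
      refine ge_of_tendsto hlim ?_
      filter_upwards [Filter.eventually_gt_atTop 1] with b hb' using hb b hb'
    have h1 : ∫ z in A, f z = 0 :=
      le_antisymm h0 (integral_nonneg fun z => hf.nonneg z)
    rw [integral_eq_zero_iff_of_nonneg (fun z => hf.nonneg z) hf.integrable.integrableOn] at h1
    have h2 := (ae_restrict_iff' hAm).1 h1
    filter_upwards [h2] with z hz hne
    by_contra! hcon
    exact hne (hz hcon)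
  filter_upwards [ae_all_iff.2 key] with z hz hne
  have := (tendsto_one_div_add_atTop_nhds_zero_nat (𝕜 := ℝ)).const_sub C0
  rw [sub_zero] at this
  exact le_of_tendsto' this fun n => (hz n hne).le

/-- The marginal is the joint density divided by the conditional one: at a point where f is nonzero
the former is at least C0 and the latter less than Ce. The product form avoids dividing by Ce, whose
sign is not assumed. -/
theorem ae_lower_margX (hf : IsPdf f) {C0 Ce : ℝ} (hC0 : 0 < C0)
    (hl : ∀ᵐ z, f z ≠ 0 → C0 ≤ f z)
    (hc : ∀ᵐ z : ℝ × ℝ, margX f z.1 ≠ 0 → f z / margX f z.1 < Ce) :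
    ∀ᵐ x, margX f x ≠ 0 → 1 ≤ (|Ce| / C0) * margX f x := by
  rw [Measure.volume_eq_prod] at hl hc
  filter_upwards [Measure.ae_ae_of_ae_prod hl, Measure.ae_ae_of_ae_prod hc] with x h1 h2 hne
  have hpos : 0 < margX f x := lt_of_le_of_ne (hf.margX_nonneg x) (Ne.symm hne)
  obtain ⟨y, hy1, hy2, hy3⟩ : ∃ y, f (x, y) ≠ 0 ∧ C0 ≤ f (x, y) ∧ f (x, y) / margX f x < Ce := by
    by_contra! hcon
    apply hne
    rw [margX]
    apply integral_eq_zero_of_ae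
    filter_upwards [h1, h2] with y hy1 hy2
    by_contra hfy
    exact absurd (hy2 hne) (not_lt.2 (hcon y hfy (hy1 hfy)))
  rw [div_lt_iff₀ hpos] at hy3
  rw [div_mul_eq_mul_div, le_div_iff₀ hC0]
  have := mul_le_mul_of_nonneg_right (le_abs_self Ce) hpos.le
  linarith

end IsPdf

/-- The consequences of the regularity assumptions used for the bias bound. -/
structure Regular (M : ℝ) (f : ℝ × ℝ → ℝ) : Prop where
  one_le : 1 ≤ M
  pdf : IsPdf f
  le : ∀ᵐ z, f z ≤ M
  lower : ∀ᵐ z, f z ≠ 0 → 1 / M ≤ f z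
  margX_le : ∀ᵐ x, margX f x ≤ M
  lower_margX : ∀ᵐ x, margX f x ≠ 0 → 1 / M ≤ margX f x
  margY_le : ∀ᵐ y, margY f y ≤ M
  lower_margY : ∀ᵐ y, margY f y ≠ 0 → 1 / M ≤ margY f y
  quadX : ∃ S : Finset ℝ, (S.card : ℝ) ≤ M ∧ ∀ x r, 0 ≤ r →
    (∀ t ∈ Set.Icc (x - r) (x + r), t ∉ S) →
    |(∫ t in (x - r)..(x + r), margX f t) - 2 * r * margX f x| ≤ 2 * M * r ^ 3
  quadY : ∃ S : Finset ℝ, (S.card : ℝ) ≤ M ∧ ∀ x r, 0 ≤ r →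
    (∀ t ∈ Set.Icc (x - r) (x + r), t ∉ S) →
    |(∫ t in (x - r)..(x + r), margY f t) - 2 * r * margY f x| ≤ 2 * M * r ^ 3
  translate : ∀ h : ℝ × ℝ, ∫⁻ z, ENNReal.ofReal |f (z + h) - f z| ≤
    ENNReal.ofReal (M * (|h.1| + |h.2|))

theorem quad_of_hausdorff {g : ℝ → ℝ} {Cd Ch M : ℝ} (hM : 1 ≤ M) (hCd : Cd ≤ M) (hCh : |Ch| ≤ M)
    (h : Measure.hausdorffMeasure 0 {x : ℝ | ¬ RegularAt Cd g x} ≤ ENNReal.ofReal Ch) :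
    ∃ S : Finset ℝ, (S.card : ℝ) ≤ M ∧ ∀ x r, 0 ≤ r →
    (∀ t ∈ Set.Icc (x - r) (x + r), t ∉ S) →
    |(∫ t in (x - r)..(x + r), g t) - 2 * r * g x| ≤ 2 * M * r ^ 3 := by
  obtain ⟨S, hS, hc⟩ := finite_of_hausdorffMeasure_zero_le h
  refine ⟨S, hc.trans hCh, fun x r hr hx => ?_⟩
  refine abs_integral_sub_le_of_regularAt (by linarith) hr fun t ht => ?_
  have h1 : t ∉ (S : Set ℝ) := hx t ht
  rw [hS] at h1
  have h2 : RegularAt Cd g t := by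
    by_contra hcon
    exact h1 hcon
  exact h2.mono hCd

/-- All constants are merged into one before f is chosen, which makes the final bounds uniform over
the class. -/
theorem RateAssumption.regular_M {Ca Cb Cc Cd Ce Cf Cg Ch C0 : ℝ} (hC0 : 0 < C0) :
    ∃ M, ∀ f, IsPdf f → RateAssumption Ca Cb Cc Cd Ce Cf Cg Ch C0 f → Regular M f := by
  set m := 1 + |Ca| + |Cd| + |Ce| / C0 + |Cf| + |Cg| + |Ch| + 1 / C0 with hm
  have pCe : 0 ≤ |Ce| / C0 := by positivity
  have pC0 : 0 ≤ 1 / C0 := by positivity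
  have hm1 : 1 ≤ m := by
    rw [hm]
    linarith [abs_nonneg Ca, abs_nonneg Cd, abs_nonneg Cf, abs_nonneg Cg, abs_nonneg Ch]
  have hmCa : Ca ≤ m := by
    rw [hm]
    linarith [le_abs_self Ca, abs_nonneg Cd, abs_nonneg Cf, abs_nonneg Cg, abs_nonneg Ch]
  have hmCd : Cd ≤ m := by
    rw [hm]
    linarith [le_abs_self Cd, abs_nonneg Ca, abs_nonneg Cf, abs_nonneg Cg, abs_nonneg Ch]
  have hmCf : Cf ≤ m := by
    rw [hm]
    linarith [le_abs_self Cf, abs_nonneg Ca, abs_nonneg Cd, abs_nonneg Cg, abs_nonneg Ch]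
  have hmCg : Cg ≤ m := by
    rw [hm]
    linarith [le_abs_self Cg, abs_nonneg Ca, abs_nonneg Cd, abs_nonneg Cf, abs_nonneg Ch]
  have hmCh : |Ch| ≤ m := by
    rw [hm]
    linarith [abs_nonneg Cg, abs_nonneg Ca, abs_nonneg Cd, abs_nonneg Cf]
  have hmCe : |Ce| / C0 ≤ m := by
    rw [hm]
    linarith [abs_nonneg Cg, abs_nonneg Ca, abs_nonneg Cd, abs_nonneg Cf, abs_nonneg Ch]
  have hmC0 : 1 / m ≤ C0 := by
    rw [div_le_iff₀ (by linarith), ← div_le_iff₀' hC0]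
    rw [hm]
    linarith [abs_nonneg Cg, abs_nonneg Ca, abs_nonneg Cd, abs_nonneg Cf, abs_nonneg Ch]
  clear_value m
  -- The constant of `lintegral_translate_fst_le` with A = D = B = m and lower bound 1/m; the
  -- remaining factor m in K * m bounds the length of the singular set.
  set K := 2 * (2 * m + m * (m / (1 / m)) ^ 2) + m with hK
  have hKm : m ≤ K := by
    rw [hK]
    have : 0 ≤ m * (m / (1 / m)) ^ 2 := by positivity
    linarith
  have hmM : m ≤ K * m := by nlinarith
  refine ⟨K * m, fun f hf h => ?_⟩
  have hlow := hf.ae_lower_of_tail h.tail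
  have hinv : 1 / (K * m) ≤ 1 / m := one_div_le_one_div_of_le (by linarith) hmM
  have hlow' : ∀ᵐ z, f z ≠ 0 → 1 / m ≤ f z := hlow.mono fun z hz hne => hmC0.trans (hz hne)
  have hle : ∀ᵐ z, f z ≤ m := h.bounded.mono fun z hz => hz.trans hmCa
  have hmX : ∀ᵐ x, margX f x ≤ m := h.marg_X.mono fun x hx => hx.le.trans hmCf
  have hmY : ∀ᵐ x, margY f x ≤ m := h.marg_Y.mono fun x hx => hx.le.trans hmCf
  have conv : ∀ t : ℝ, 0 ≤ t → 1 ≤ |Ce| / C0 * t → 1 / (K * m) ≤ t := fun t ht h1 => by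
    refine hinv.trans ?_
    rw [div_le_iff₀ (by linarith)]
    nlinarith
  set S : Set (WithLp 2 (ℝ × ℝ)) := {z | ¬ RegularAt Cd (onPlane f) z} with hS
  have hSfin : Measure.hausdorffMeasure 1 S ≠ ∞ :=
    (h.hausdorff_joint.trans_lt ENNReal.ofReal_lt_top).ne
  have hSm : Measure.hausdorffMeasure 1 S ≤ ENNReal.ofReal m :=
    h.hausdorff_joint.trans (ENNReal.ofReal_le_ofReal hmCg)
  have hval : ∀ z, WithLp.toLp 2 z ∉ S → 0 ≤ f z ∧ f z ≤ m ∧ (f z = 0 ∨ 1 / m ≤ f z) := by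
    intro z hz
    have hreg : RegularAt Cd (onPlane f) (WithLp.toLp 2 z) := by
      by_contra hcon
      exact hz hcon
    have hcont : ContinuousAt f z :=
      hreg.1.continuousAt.comp (WithLp.prod_continuous_toLp 2 ℝ ℝ).continuousAt
    refine ⟨hf.nonneg z, ?_, ?_⟩
    · exact of_ae_of_continuousAt (s := Set.Iic m) isClosed_Iic hle hcont
    · exact of_ae_of_continuousAt (s := {0} ∪ Set.Ici (1 / m))
        (isClosed_singleton.union isClosed_Ici) (by
          filter_upwards [hlow'] with w hw
          by_cases h0 : f w = 0
          · exact Or.inl h0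
          · exact Or.inr (hw h0)) hcont
  have hreg : ∀ z, z ∉ S → RegularAt m (onPlane f) z := fun z hz => by
    by_contra hcon
    exact hz fun hr => hcon (hr.mono hmCd)
  have lip1 : LipschitzWith 1 fun z : WithLp 2 (ℝ × ℝ) => (WithLp.ofLp z).1 := by
    refine LipschitzWith.of_dist_le_mul fun z w => ?_
    rw [NNReal.coe_one, one_mul, WithLp.prod_dist_eq_of_L2, Real.dist_eq]
    refine Real.abs_le_sqrt ?_
    rw [Real.dist_eq, Real.dist_eq, sq_abs, sq_abs]
    exact le_add_of_nonneg_right (sq_nonneg _)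
  have lip2 : LipschitzWith 1 fun z : WithLp 2 (ℝ × ℝ) => (WithLp.ofLp z).2 := by
    refine LipschitzWith.of_dist_le_mul fun z w => ?_
    rw [NNReal.coe_one, one_mul, WithLp.prod_dist_eq_of_L2, Real.dist_eq]
    refine Real.abs_le_sqrt ?_
    rw [Real.dist_eq, Real.dist_eq, sq_abs, sq_abs]
    exact le_add_of_nonneg_left (sq_nonneg _)
  have normX : ‖(WithLp.toLp 2 ((1 : ℝ), (0 : ℝ)) : WithLp 2 (ℝ × ℝ))‖ ≤ 1 := by
    rw [WithLp.prod_norm_eq_of_L2]; simp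
  have normY : ‖(WithLp.toLp 2 ((0 : ℝ), (1 : ℝ)) : WithLp 2 (ℝ × ℝ))‖ ≤ 1 := by
    rw [WithLp.prod_norm_eq_of_L2]; simp
  have hX : ∀ t : ℝ, ∫⁻ z : ℝ × ℝ, ENNReal.ofReal |f (z.1 + t, z.2) - f z| ≤
      ENNReal.ofReal (|t| * (K * m)) := by
    obtain ⟨n, hn, hnL, hnS⟩ := exists_fibre_count_le lip2 S hSfin
    refine lintegral_translate_fst_le (φ := f) (S := {z | WithLp.toLp 2 z ∈ S}) (by positivity)
      (by linarith) (by linarith) (B := m) (by linarith) hf.measurable ?_ (fun z hz => hval z hz)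
      (fun x y hxy => ?_) hn (hnL.trans hSm) (fun y T hT => ?_)
    · filter_upwards [hf.swap.ae_lintegral_slice, hmY] with y hy hy2
      exact (le_of_eq hy).trans (ENNReal.ofReal_le_ofReal hy2)
    · have e : ∀ t : ℝ, WithLp.toLp 2 ((0 : ℝ), y) + t • WithLp.toLp 2 ((1 : ℝ), (0 : ℝ)) =
          WithLp.toLp 2 (t, y) := fun t => by
        rw [← WithLp.toLp_smul, ← WithLp.toLp_add]; simp
      have h1 := hreg _ hxy
      rw [← e] at h1
      have h2 := h1.along_line normX
      simp only [e, onPlane] at h2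
      exact h2
    · have := hnS y (T.map ⟨fun x => WithLp.toLp 2 (x, y), fun a b hab => by
        simpa using hab⟩) (by
          intro z hz
          obtain ⟨x, hx, rfl⟩ := Finset.mem_map.1 hz
          exact ⟨hT x hx, rfl⟩)
      rwa [Finset.card_map] at this
  have hY : ∀ t : ℝ, ∫⁻ z : ℝ × ℝ, ENNReal.ofReal |f (z.1, z.2 + t) - f z| ≤
      ENNReal.ofReal (|t| * (K * m)) := by
    obtain ⟨n, hn, hnL, hnS⟩ := exists_fibre_count_le lip1 S hSfin
    intro t
    have := lintegral_translate_fst_le (φ := f ∘ Prod.swap)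
      (S := {z | WithLp.toLp 2 z.swap ∈ S}) (by positivity : (0 : ℝ) < 1 / m)
      (by linarith : 0 ≤ m) (by linarith : 0 ≤ m) (B := m) (by linarith) hf.swap.measurable ?_
      (fun z hz => hval z.swap hz)
      (fun y x hxy => ?_) hn (hnL.trans hSm) (fun x T hT => ?_) t
    · rw [Measure.volume_eq_prod, ← lintegral_prod_swap] at this
      exact this
    · filter_upwards [hf.ae_lintegral_slice, hmX] with y hy hy2
      exact (le_of_eq hy).trans (ENNReal.ofReal_le_ofReal hy2)
    · have e : ∀ t : ℝ, WithLp.toLp 2 (x, (0 : ℝ)) + t • WithLp.toLp 2 ((0 : ℝ), (1 : ℝ)) =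
          WithLp.toLp 2 (x, t) := fun t => by
        rw [← WithLp.toLp_smul, ← WithLp.toLp_add]; simp
      have h1 := hreg _ hxy
      rw [Prod.swap_prod_mk, ← e] at h1
      have h2 := h1.along_line normY
      simp only [e, onPlane] at h2
      exact h2
    · have := hnS x (T.map ⟨fun y => WithLp.toLp 2 (x, y), fun a b hab => by
        simpa using hab⟩) (by
          intro z hz
          obtain ⟨y, hy, rfl⟩ := Finset.mem_map.1 hz
          exact ⟨hT y hy, rfl⟩)
      rwa [Finset.card_map] at this
  refine ⟨hm1.trans hmM, hf, hle.mono fun z hz => hz.trans hmM,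
    hlow'.mono fun z hz hne => hinv.trans (hz hne), hmX.mono fun x hx => hx.trans hmM, ?_,
    hmY.mono fun x hx => hx.trans hmM, ?_,
    quad_of_hausdorff (hm1.trans hmM) (hmCd.trans hmM) (hmCh.trans hmM) h.hausdorff_X,
    quad_of_hausdorff (hm1.trans hmM) (hmCd.trans hmM) (hmCh.trans hmM) h.hausdorff_Y, ?_⟩
  · exact (hf.ae_lower_margX hC0 hlow h.cond_YX).mono fun x hx hne =>
      conv _ (hf.margX_nonneg x) (hx hne)
  · have hsw : MeasurePreserving Prod.swap (volume : Measure (ℝ × ℝ)) volume := by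
      rw [Measure.volume_eq_prod]; exact Measure.measurePreserving_swap
    exact (hf.swap.ae_lower_margX hC0 (hsw.quasiMeasurePreserving.ae hlow)
      (hsw.quasiMeasurePreserving.ae h.cond_XY)).mono fun x hx hne =>
        conv _ (hf.swap.margX_nonneg x) (hx hne)
  · intro t
    have hfm := hf.measurable
    -- One coordinate is moved at a time; the vertical offset left in the horizontal increment is
    -- removed by translation invariance.
    calc ∫⁻ z, ENNReal.ofReal |f (z + t) - f z|
        ≤ ∫⁻ z : ℝ × ℝ, (ENNReal.ofReal |f (z.1 + t.1, z.2 + t.2) - f (z.1, z.2 + t.2)| +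
            ENNReal.ofReal |f (z.1, z.2 + t.2) - f z|) := by
          refine lintegral_mono fun z => ?_
          rw [← ENNReal.ofReal_add (abs_nonneg _) (abs_nonneg _)]
          exact ENNReal.ofReal_le_ofReal (abs_sub_le _ _ _)
      _ = (∫⁻ z : ℝ × ℝ, ENNReal.ofReal |f (z.1 + t.1, z.2 + t.2) - f (z.1, z.2 + t.2)|) +
            ∫⁻ z : ℝ × ℝ, ENNReal.ofReal |f (z.1, z.2 + t.2) - f z| :=
          lintegral_add_left (by fun_prop) _
      _ ≤ ENNReal.ofReal (|t.1| * (K * m)) + ENNReal.ofReal (|t.2| * (K * m)) := by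
          refine add_le_add ?_ (hY t.2)
          have e := lintegral_add_right_eq_self (μ := (volume : Measure (ℝ × ℝ)))
            (fun z => ENNReal.ofReal |f (z.1 + t.1, z.2) - f z|) ((0, t.2) : ℝ × ℝ)
          refine le_trans (le_of_eq ?_) ((le_of_eq e).trans (hX t.1))
          refine lintegral_congr fun z => ?_
          have e2 : z + (0, t.2) = (z.1, z.2 + t.2) := by ext <;> simp
          rw [e2]
      _ = _ := by
          have hKm0 : 0 ≤ K * m := by linarith
          rw [← ENNReal.ofReal_add (by positivity) (by positivity)]
          congr 1; ring

/-! ### Expected logarithm of a marginal count given the nearest neighbour distance -/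

theorem le_one_add_two_mul {X d c : ℝ} (hX : 0 ≤ X) (hc : 0 ≤ c) (hc2 : c ≤ 1 / 2)
    (h : (1 - c) * X ≤ d) : X ≤ (1 + 2 * c) * d := by
  have h1 : (1 + 2 * c) * ((1 - c) * X) ≤ (1 + 2 * c) * d :=
    mul_le_mul_of_nonneg_left h (by positivity)
  have h2 : 0 ≤ c * (1 - 2 * c) * X := by
    have : 0 ≤ 1 - 2 * c := by linarith
    positivity
  linarith

theorem lower_count_bound {c C q M r n i : ℝ} (hC : c = C * r) (hc : 0 ≤ c) (hc2 : c ≤ 1 / 2)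
    (hCn : 0 ≤ C) (hq : 0 ≤ q) (hM : 1 ≤ M) (hr : 0 ≤ r) (hn : 0 ≤ n) (hni : n ≤ i) :
    (1 + 2 * c) * (1 + 2 * (q + 1) * n) ≤ 1 + (4 * C + 4 * (q + 1) * M) * (r + i) := by
  have t1 : (2 * c) * (2 * (q + 1) * n) ≤ 1 * (2 * (q + 1) * n) :=
    mul_le_mul_of_nonneg_right (by linarith) (by positivity)
  have t2 : 4 * (q + 1) * n ≤ 4 * (q + 1) * M * i := by
    calc 4 * (q + 1) * n ≤ 4 * (q + 1) * i := by gcongr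
      _ = 4 * (q + 1) * 1 * i := by ring
      _ ≤ 4 * (q + 1) * M * i := by
        have : 0 ≤ i := hn.trans hni
        gcongr
  have t3 : 0 ≤ 4 * C * i := by have : 0 ≤ i := hn.trans hni; positivity
  have t4 : 0 ≤ 4 * (q + 1) * M * r := by positivity
  subst hC
  linarith

theorem upper_count_bound {c x y z : ℝ} (hc : 0 ≤ c) (hc2 : c ≤ 1 / 2) (hx : x ≤ 1 + c)
    (hy : y ≤ 1 + 2 * c) (hx0 : 0 ≤ x) (hy0 : 0 ≤ y) (hz1 : z ≤ 1) :
    x * y * z ≤ 1 + 4 * c := by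
  have t1 : x * y ≤ (1 + c) * (1 + 2 * c) := mul_le_mul hx hy hy0 (by positivity)
  have t2 : x * y * z ≤ x * y := mul_le_of_le_one_right (by positivity) hz1
  have t3 : 0 ≤ c * (1 / 2 - c) := mul_nonneg hc (by linarith)
  linarith

/-- Both one-sided bounds are rewritten as multiples of `bin (m + 1) q` by means of `bin_succ`. The
relative error is O(r) from the mass of D and from the factor 1 - P, and O(1/(Nr)) from the offset q
+ 1 and the inverse moment, with N = m + 3. -/
theorem abs_integral_hits_log_le {E : Type*} [MeasurableSpace E] (μ : Measure E)
    [IsProbabilityMeasure μ] {A D : Set E} (hA : MeasurableSet A) (hD : MeasurableSet D)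
    (hAD : Disjoint A D) {G : ℕ → ℝ} (hG : LogLike G) {M C r φ : ℝ} {m q : ℕ} (hM : 1 ≤ M)
    (hr : 0 < r) (hr1 : r ≤ 1) (hφ : 1 / M ≤ φ) (hd : |μ.real D - 2 * r * φ| ≤ C * r * (2 * r * φ))
    (hCr : C * r ≤ 1 / 2) (hP : μ.real A ≤ C * r) (hq : q ≤ m) (hN : 2 * (q + 1) ≤ m + 3) :
    |∫ u : Fin (m + 1) → E, (if hits A u = q then
        G (hits D u + q + 1) - Real.log ((m + 3) * (2 * r * φ)) else 0) ∂(Measure.pi fun _ => μ)| ≤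
      bin (m + 1) q (μ.real A) * ((4 * C + 4 * (q + 1) * M) * (r + 1 / ((m + 3) * r))) := by
  set P := μ.real A with hPdef
  set d := μ.real D with hddef
  set N : ℝ := (m : ℝ) + 3 with hNdef
  have hN0 : 0 < N := by positivity
  have hP0 : 0 ≤ P := measureReal_nonneg
  have hP1 : P ≤ 1 / 2 := hP.trans hCr
  have hφ0 : 0 < φ := lt_of_lt_of_le (by positivity) hφ
  have hX : 0 < 2 * r * φ := by positivity
  have hC0 : 0 ≤ C * r := hP0.trans hP
  have hCn : 0 ≤ C := nonneg_of_mul_nonneg_left hC0 hr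
  rw [abs_le] at hd
  have hdlow : r * φ ≤ d := by
    have := mul_le_mul_of_nonneg_right hCr hX.le
    linarith [hd.1]
  have hdpos : 0 < d := lt_of_lt_of_le (by positivity) hdlow
  set b := bin (m + 1) q P with hb
  have hb0 : 0 ≤ b := bin_nonneg hP0 (by linarith)
  have h1 : ((m : ℝ) + 1 - q) * b = (m + 1) * (1 - P) * bin m q P := bin_succ hq P
  have h2 : (((m + 1 : ℕ) : ℝ) + 1 - q) * bin (m + 2) q P = ((m + 1 : ℕ) + 1) * (1 - P) * b :=
    bin_succ (by omega) P
  push_cast at h2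
  have hqm : (q : ℝ) ≤ m := by exact_mod_cast hq
  have hqN : 2 * ((q : ℝ) + 1) ≤ N := by rw [hNdef]; exact_mod_cast hN
  have hden : N / 2 ≤ (m : ℝ) + 1 + 1 - q := by linarith
  have hden0 : (0 : ℝ) < (m : ℝ) + 1 + 1 - q := by linarith
  have hMφ : 1 ≤ M * φ := by
    rw [div_le_iff₀ (by linarith)] at hφ; linarith
  have hq0 : (0 : ℝ) ≤ q := Nat.cast_nonneg q
  have hNr : 0 < N * r := by positivity
  -- the ratio of the two outer binomial probabilities
  have h3 : bin (m + 2) q P / (m + 2) = (1 - P) * b / ((m : ℝ) + 1 + 1 - q) := by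
    rw [div_eq_div_iff (by positivity) hden0.ne']
    linarith
  have hup := integral_hits_log_le μ hA hD hAD hG (M := N * (2 * r * φ)) (by positivity) hdpos m q
  have hlo := le_integral_hits_log μ hA hD hAD hG (M := N * (2 * r * φ)) (by positivity) hdpos
    (m + 1) q
  rw [← hPdef, ← hddef, ← hb] at hup hlo
  rw [abs_le]
  have hone : 1 / N ≤ 1 / (N * r) := one_div_le_one_div_of_le hNr (by nlinarith)
  have hinvpos : 0 < 1 / (N * r) := by positivity
  constructor
  · refine le_trans ?_ hlo
    push_cast
    have e1 : N * (2 * r * φ) * (bin (m + 1 + 1) q P / (((m : ℝ) + 1 + 1) * d)) =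
        (2 * r * φ / d) * ((1 - P) * (N / ((m : ℝ) + 1 + 1 - q))) * b := by
      have : bin (m + 1 + 1) q P / (((m : ℝ) + 1 + 1) * d) = bin (m + 2) q P / (m + 2) / d := by
        rw [div_div]; congr 2; ring
      rw [this, h3]
      field_simp
    rw [e1]
    have e2 : 2 * r * φ / d ≤ 1 + 2 * (C * r) := by
      rw [div_le_iff₀ hdpos]
      exact le_one_add_two_mul hX.le hC0 hCr (by linarith [hd.1])
    have e3 : N / ((m : ℝ) + 1 + 1 - q) ≤ 1 + 2 * (q + 1) * (1 / N) := by
      rw [div_le_iff₀ hden0]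
      have : (m : ℝ) + 1 + 1 - q = N - (q + 1) := by rw [hNdef]; ring
      rw [this]
      have e4 : (1 + 2 * ((q : ℝ) + 1) * (1 / N)) * (N - (q + 1)) =
          N + (q + 1) * (1 - 2 * (q + 1) / N) := by
        field_simp; ring
      rw [e4]
      have t : 2 * ((q : ℝ) + 1) / N ≤ 1 := by rw [div_le_one hN0]; exact hqN
      have : 0 ≤ ((q : ℝ) + 1) * (1 - 2 * (q + 1) / N) := mul_nonneg (by linarith) (by linarith)
      linarith
    have e5 : (1 - P) * (N / ((m : ℝ) + 1 + 1 - q)) ≤ 1 + 2 * (q + 1) * (1 / N) := by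
      have : 0 ≤ N / ((m : ℝ) + 1 + 1 - q) := by positivity
      have := mul_nonneg hP0 this
      linarith
    have e6 : (2 * r * φ / d) * ((1 - P) * (N / ((m : ℝ) + 1 + 1 - q))) ≤
        (1 + 2 * (C * r)) * (1 + 2 * (q + 1) * (1 / N)) := by
      apply mul_le_mul e2 e5 _ (by positivity)
      have : 0 ≤ 1 - P := by linarith
      positivity
    have e7 : (1 + 2 * (C * r)) * (1 + 2 * ((q : ℝ) + 1) * (1 / N)) ≤
        1 + (4 * C + 4 * (q + 1) * M) * (r + 1 / (N * r)) := by
      exact lower_count_bound rfl hC0 hCr hCn hq0 hM hr.le (by positivity) hone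
    have := mul_le_mul_of_nonneg_right (e6.trans e7) hb0
    linarith
  · refine hup.trans ?_
    have hP2 : 0 < 1 - P := by linarith
    have e1 : ((m : ℝ) + 1) * d / (N * (2 * r * φ)) * bin m q P =
        (d / (2 * r * φ)) * (1 / (1 - P)) * (((m : ℝ) + 1 - q) / N) * b := by
      have : bin m q P = ((m : ℝ) + 1 - q) * b / ((m + 1) * (1 - P)) := by
        rw [eq_div_iff (by positivity)]; linarith
      rw [this]
      field_simp
    have e2 : d / (2 * r * φ) ≤ 1 + C * r := by
      rw [div_le_iff₀ hX]; linarith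
    have e3 : 1 / (1 - P) ≤ 1 + 2 * (C * r) := by
      rw [div_le_iff₀ hP2]
      exact le_one_add_two_mul zero_le_one hC0 hCr (by linarith)
    have e4 : ((m : ℝ) + 1 - q) / N ≤ 1 := by
      rw [div_le_one hN0]; linarith
    have e5 : (d / (2 * r * φ)) * (1 / (1 - P)) * (((m : ℝ) + 1 - q) / N) ≤ 1 + 4 * C * r := by
      have hmq : (0 : ℝ) ≤ m + 1 - q := by linarith
      have := upper_count_bound (z := ((m : ℝ) + 1 - q) / N) hC0 hCr e2 e3 (by positivity)
        (by positivity) e4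
      linarith
    have e6 : bin (m + 2) q P / ((m + 2) * d) ≤ 2 * M * (1 / (N * r)) * b := by
      rw [← div_div, h3, div_div, div_le_iff₀ (by positivity)]
      have t1 : N / 2 * (r * φ) ≤ ((m : ℝ) + 1 + 1 - q) * d := by gcongr
      have t2 : 2 * M * (1 / (N * r)) * b * (N / 2 * (r * φ)) = M * φ * b := by
        field_simp
      calc (1 - P) * b ≤ 1 * b := by gcongr; linarith
        _ ≤ M * φ * b := by gcongr
        _ = 2 * M * (1 / (N * r)) * b * (N / 2 * (r * φ)) := t2.symm
        _ ≤ _ := by gcongr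
    have e7 : ((q : ℝ) + 1) / (N * (2 * r * φ)) ≤ (q + 1) * M * (1 / (N * r)) := by
      rw [div_le_iff₀ (by positivity)]
      have : (q + 1) * M * (1 / (N * r)) * (N * (2 * r * φ)) = (q + 1) * (2 * (M * φ)) := by
        field_simp
      rw [this]
      exact le_mul_of_one_le_right (by positivity) (by linarith)
    have e8 := mul_le_mul_of_nonneg_right e7 hb0
    have e9 := mul_le_mul_of_nonneg_right e5 hb0
    rw [e1]
    have t3 : 0 ≤ 4 * C * (1 / (N * r)) := by positivity
    have t4 : 0 ≤ 4 * ((q : ℝ) + 1) * M * r := by positivity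
    have t5 : 2 * M * (1 / (N * r)) ≤ 2 * (q + 1) * M * (1 / (N * r)) := by
      have : 2 * M ≤ 2 * (q + 1) * M := by
        have : 0 ≤ q * M := mul_nonneg hq0 (by linarith)
        linarith
      gcongr
    have t6 : 0 ≤ (q + 1) * M * (1 / (N * r)) := by positivity
    have fin : (q + 1) * M * (1 / (N * r)) + 4 * C * r + 2 * M * (1 / (N * r)) ≤
        (4 * C + 4 * (q + 1) * M) * (r + 1 / (N * r)) := by linarith
    have := mul_le_mul_of_nonneg_left fin hb0
    linarith

/-! ### The law of the sample: balls, strips and typical points -/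

section Law

variable {ν : ℝ × ℝ → ℝ} {c M : ℝ} {f : ℝ × ℝ → ℝ}

theorem law_apply (f : ℝ × ℝ → ℝ) {S : Set (ℝ × ℝ)} (hS : MeasurableSet S) :
    law f S = ∫⁻ z in S, ENNReal.ofReal (f z) := withDensity_apply _ hS

theorem law_ac (f : ℝ × ℝ → ℝ) : law f ≪ volume := withDensity_absolutelyContinuous _ _

theorem Regular.law_le (hf : Regular M f) : law f ≤ ENNReal.ofReal M • volume := by
  refine Measure.le_intro fun S hS _ => ?_
  rw [law_apply f hS, Measure.smul_apply, smul_eq_mul, ← setLIntegral_const]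
  exact lintegral_mono_ae (ae_restrict_of_ae (hf.le.mono fun z hz => ENNReal.ofReal_le_ofReal hz))

theorem Regular.lintegral_law_le (hf : Regular M f) (g : ℝ × ℝ → ℝ≥0∞) :
    ∫⁻ z, g z ∂(law f) ≤ ENNReal.ofReal M * ∫⁻ z, g z :=
  (lintegral_mono' hf.law_le le_rfl).trans (by rw [lintegral_smul_measure, smul_eq_mul])

theorem PlaneNorm.law_sphere (hν : PlaneNorm ν c) (f : ℝ × ℝ → ℝ) (z : ℝ × ℝ) (r : ℝ) :
    law f {w | ν (w - z) = r} = 0 := by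
  refine law_ac f ?_
  have h := (measurePreserving_sub_right (volume : Measure (ℝ × ℝ)) z).measure_preimage
    (s := {h | ν h = r})
    (measurableSet_eq_fun hν.measurable measurable_const).nullMeasurableSet
  rw [hν.volume_sphere r] at h
  exact h

theorem PlaneNorm.volume_nball (hν : PlaneNorm ν c) (z : ℝ × ℝ) {r : ℝ} (hr : 0 ≤ r) :
    volume (nball ν z r) = ENNReal.ofReal (c * r ^ 2) := by
  have h := (measurePreserving_sub_right (volume : Measure (ℝ × ℝ)) z).measure_preimage
    (s := {h | ν h ≤ r})
    (measurableSet_le hν.measurable measurable_const).nullMeasurableSet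
  rw [hν.volume_le r hr] at h
  exact h

theorem Regular.law_nball_le (hf : Regular M f) (hν : PlaneNorm ν c) (z : ℝ × ℝ) {r : ℝ}
    (hr : 0 ≤ r) : (law f).real (nball ν z r) ≤ M * (c * r ^ 2) := by
  have hM : 0 ≤ M := zero_le_one.trans hf.one_le
  have hc := hν.pos
  have h := hf.law_le (nball ν z r)
  rw [Measure.smul_apply, hν.volume_nball z hr, smul_eq_mul, ← ENNReal.ofReal_mul hM] at h
  rw [Measure.real]
  exact ENNReal.toReal_le_of_le_ofReal (by positivity) h

theorem measurable_law_nball {α : Type*} [MeasurableSpace α] (hν : PlaneNorm ν c) (hf : IsPdf f)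
    {z : α → ℝ × ℝ} {r : α → ℝ} (hz : Measurable z) (hr : Measurable r) :
    Measurable fun x => (law f).real (nball ν (z x) (r x)) := by
  have := hf.isProbabilityMeasure_law
  have h1 : Measurable fun q : α × (ℝ × ℝ) => q.2 - z q.1 :=
    measurable_snd.sub (hz.comp measurable_fst)
  have h : MeasurableSet {q : α × (ℝ × ℝ) | ν (q.2 - z q.1) ≤ r q.1} :=
    measurableSet_le (hν.measurable.comp h1) (hr.comp measurable_fst)
  exact (measurable_measure_prodMk_left (ν := law f) h).ennreal_toReal

theorem measurable_nball_dev (hν : PlaneNorm ν c) (hf : IsPdf f) (r t : ℝ) :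
    Measurable fun z : ℝ × ℝ => |(law f).real (nball ν z r) - f z * t| := by
  have h1 := measurable_law_nball hν hf measurable_id (measurable_const (a := r))
  have h2 := hf.measurable
  have h3 : Measurable fun z : ℝ × ℝ => f z * t := by fun_prop
  exact measurable_norm.comp (h1.sub h3)

/-- Mean deviation of the average density over a ball of radius `r`. -/
theorem Regular.lintegral_dev_le (hf : Regular M f) (hν : PlaneNorm ν c) {r : ℝ} (hr : 0 ≤ r) :
    ∫⁻ z, ENNReal.ofReal |(law f).real (nball ν z r) - f z * (c * r ^ 2)| ≤
      ENNReal.ofReal (2 * M * c * r ^ 3) := by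
  have hM : 0 ≤ M := zero_le_one.trans hf.one_le
  have hc := hν.pos
  have hfm := hf.pdf.measurable
  set B : Set (ℝ × ℝ) := {h | ν h ≤ r} with hB
  have hBm : MeasurableSet B := measurableSet_le hν.measurable measurable_const
  have hBv : volume B = ENNReal.ofReal (c * r ^ 2) := hν.volume_le r hr
  have hBr : volume.real B = c * r ^ 2 := by
    rw [Measure.real, hBv, ENNReal.toReal_ofReal (by positivity)]
  have point : ∀ z, ENNReal.ofReal |(law f).real (nball ν z r) - f z * (c * r ^ 2)| ≤
      ∫⁻ h in B, ENNReal.ofReal |f (z + h) - f z| := by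
    intro z
    have e1 : (law f).real (nball ν z r) = ∫ h in B, f (z + h) := by
      rw [Measure.real, law_apply f (hν.measurableSet_nball z r),
        ← integral_eq_lintegral_of_nonneg_ae (Filter.Eventually.of_forall hf.pdf.nonneg)
          hfm.aestronglyMeasurable]
      have h := (measurePreserving_add_left (volume : Measure (ℝ × ℝ)) z).setIntegral_preimage_emb
        (measurableEmbedding_addLeft z) f (nball ν z r)
      rw [← h]
      congr 2
      ext h
      simp [nball, hB]
    have i1 : Integrable (fun h => f (z + h)) := hf.pdf.integrable.comp_add_left z
    have i2 : IntegrableOn (fun _ => f z) B := by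
      refine integrableOn_const ?_ (by simp)
      rw [hBv]; exact ENNReal.ofReal_ne_top
    -- The deviation is an average of increments over the ball; after Fubini each increment is
    -- controlled by the L¹ modulus.
    have e2 : ∫ h in B, (f (z + h) - f z) = (law f).real (nball ν z r) - f z * (c * r ^ 2) := by
      rw [integral_sub i1.integrableOn i2, ← e1, setIntegral_const, hBr, smul_eq_mul, mul_comm]
    rw [← e2, ← Real.norm_eq_abs]
    refine (ENNReal.ofReal_le_ofReal (norm_integral_le_integral_norm _)).trans ?_
    have i3 : Integrable (fun h => ‖f (z + h) - f z‖) (volume.restrict B) :=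
      (i1.integrableOn.sub i2).norm
    rw [ofReal_integral_eq_lintegral_ofReal i3 (Filter.Eventually.of_forall fun _ => norm_nonneg _)]
    rfl
  calc _ ≤ ∫⁻ z, ∫⁻ h in B, ENNReal.ofReal |f (z + h) - f z| := lintegral_mono point
    _ = ∫⁻ h in B, ∫⁻ z, ENNReal.ofReal |f (z + h) - f z| :=
        lintegral_lintegral_swap (by fun_prop)
    _ ≤ ∫⁻ _ in B, ENNReal.ofReal (M * (2 * r)) := by
        refine setLIntegral_mono measurable_const fun h hh => (hf.translate h).trans ?_
        have h1 := hν.fst_le h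
        have h2 := hν.snd_le h
        have h3 : ν h ≤ r := hh
        apply ENNReal.ofReal_le_ofReal
        gcongr
        linarith
    _ = _ := by
        rw [setLIntegral_const, hBv, ← ENNReal.ofReal_mul (by positivity)]
        congr 1; ring

theorem IsPdf.law_fst (hf : IsPdf f) {A : Set ℝ} (hA : MeasurableSet A) :
    law f (Prod.fst ⁻¹' A) = ∫⁻ x in A, ENNReal.ofReal (margX f x) := by
  have hfm := hf.measurable
  rw [law_apply f (measurable_fst hA), ← Set.prod_univ, Measure.volume_eq_prod,
    ← Measure.prod_restrict, lintegral_prod _ (by fun_prop), Measure.restrict_univ]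
  exact lintegral_congr_ae (ae_restrict_of_ae hf.ae_lintegral_slice)

theorem IsPdf.law_snd (hf : IsPdf f) {A : Set ℝ} (hA : MeasurableSet A) :
    law f (Prod.snd ⁻¹' A) = ∫⁻ y in A, ENNReal.ofReal (margY f y) := by
  have hfm := hf.measurable
  rw [law_apply f (measurable_snd hA), ← Set.univ_prod, Measure.volume_eq_prod,
    ← Measure.prod_restrict, lintegral_prod_symm _ (by fun_prop), Measure.restrict_univ]
  exact lintegral_congr_ae (ae_restrict_of_ae hf.swap.ae_lintegral_slice)

theorem IsPdf.measurable_margY (hf : IsPdf f) : Measurable (margY f) := hf.swap.measurable_margX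

theorem IsPdf.margY_nonneg (hf : IsPdf f) (y : ℝ) : 0 ≤ margY f y := hf.swap.margX_nonneg y

theorem setOf_abs_sub_le (x r : ℝ) : {t : ℝ | |t - x| ≤ r} = Set.Icc (x - r) (x + r) := by
  ext t
  rw [Set.mem_ofPred_eq, abs_le, Set.mem_Icc]
  constructor <;> intro h <;> constructor <;> linarith [h.1, h.2]

theorem IsPdf.law_stripX (hf : IsPdf f) (z : ℝ × ℝ) {r : ℝ} (hr : 0 ≤ r) :
    (law f).real (stripX z r) = ∫ t in (z.1 - r)..(z.1 + r), margX f t := by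
  have e : stripX z r = Prod.fst ⁻¹' Set.Icc (z.1 - r) (z.1 + r) := by
    rw [← setOf_abs_sub_le]; rfl
  rw [Measure.real, e, hf.law_fst measurableSet_Icc, intervalIntegral.integral_of_le (by linarith),
    ← integral_Icc_eq_integral_Ioc, ← integral_eq_lintegral_of_nonneg_ae
      (Filter.Eventually.of_forall hf.margX_nonneg) hf.measurable_margX.aestronglyMeasurable]

theorem IsPdf.law_stripY (hf : IsPdf f) (z : ℝ × ℝ) {r : ℝ} (hr : 0 ≤ r) :
    (law f).real (stripY z r) = ∫ t in (z.2 - r)..(z.2 + r), margY f t := by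
  have e : stripY z r = Prod.snd ⁻¹' Set.Icc (z.2 - r) (z.2 + r) := by
    rw [← setOf_abs_sub_le]; rfl
  rw [Measure.real, e, hf.law_snd measurableSet_Icc, intervalIntegral.integral_of_le (by linarith),
    ← integral_Icc_eq_integral_Ioc, ← integral_eq_lintegral_of_nonneg_ae
      (Filter.Eventually.of_forall hf.margY_nonneg) hf.measurable_margY.aestronglyMeasurable]

theorem IsPdf.ae_law_ne_zero (hf : IsPdf f) : ∀ᵐ z ∂(law f), f z ≠ 0 := by
  rw [ae_iff]
  have hm : MeasurableSet {z | ¬ f z ≠ 0} :=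
    (measurableSet_eq_fun hf.measurable measurable_const).compl.compl
  rw [law_apply f hm]
  refine setLIntegral_eq_zero hm fun z hz => ?_
  simp only [not_not, Set.mem_ofPred_eq] at hz
  simp [hz]

theorem IsPdf.ae_law_margX_ne_zero (hf : IsPdf f) : ∀ᵐ z ∂(law f), margX f z.1 ≠ 0 := by
  rw [ae_iff]
  have hm : MeasurableSet {x | ¬ margX f x ≠ 0} :=
    (measurableSet_eq_fun hf.measurable_margX measurable_const).compl.compl
  refine (hf.law_fst hm).trans (setLIntegral_eq_zero hm fun z hz => ?_)
  simp only [not_not, Set.mem_ofPred_eq] at hz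
  simp [hz]

theorem IsPdf.ae_law_margY_ne_zero (hf : IsPdf f) : ∀ᵐ z ∂(law f), margY f z.2 ≠ 0 := by
  rw [ae_iff]
  have hm : MeasurableSet {x | ¬ margY f x ≠ 0} :=
    (measurableSet_eq_fun hf.measurable_margY measurable_const).compl.compl
  refine (hf.law_snd hm).trans (setLIntegral_eq_zero hm fun z hz => ?_)
  simp only [not_not, Set.mem_ofPred_eq] at hz
  simp [hz]

/-- Two-sided bounds for the joint density and both marginals at `z`. -/
structure DensityBounds (M : ℝ) (f : ℝ × ℝ → ℝ) (z : ℝ × ℝ) : Prop where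
  lower : 1 / M ≤ f z
  upper : f z ≤ M
  lowerX : 1 / M ≤ margX f z.1
  upperX : margX f z.1 ≤ M
  lowerY : 1 / M ≤ margY f z.2
  upperY : margY f z.2 ≤ M

theorem Regular.ae_densityBounds (hf : Regular M f) : ∀ᵐ z ∂(law f), DensityBounds M f z := by
  have q1 : Measure.QuasiMeasurePreserving (Prod.fst : ℝ × ℝ → ℝ) volume volume := by
    rw [Measure.volume_eq_prod]; exact Measure.quasiMeasurePreserving_fst
  have q2 : Measure.QuasiMeasurePreserving (Prod.snd : ℝ × ℝ → ℝ) volume volume := by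
    rw [Measure.volume_eq_prod]; exact Measure.quasiMeasurePreserving_snd
  have ac := law_ac f
  filter_upwards [hf.pdf.ae_law_ne_zero, hf.pdf.ae_law_margX_ne_zero, hf.pdf.ae_law_margY_ne_zero,
    ac.ae_le hf.le, ac.ae_le hf.lower, ac.ae_le (q1.ae hf.margX_le),
    ac.ae_le (q1.ae hf.lower_margX), ac.ae_le (q2.ae hf.margY_le), ac.ae_le (q2.ae hf.lower_margY)]
    with z h1 h2 h3 h4 h5 h6 h7 h8 h9
  exact ⟨h5 h1, h4, h7 h2, h6, h9 h3, h8⟩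

/-- `z` is typical at scales up to `a`. -/
structure Good (ν : ℝ × ℝ → ℝ) (c M a : ℝ) (f : ℝ × ℝ → ℝ) (z : ℝ × ℝ) : Prop where
  bounds : DensityBounds M f z
  ball : ∀ r, 0 < r → r ≤ a → c * r ^ 2 / (8 * M) ≤ (law f).real (nball ν z r)
  stripX : ∀ r, 0 ≤ r → r ≤ a →
    |(law f).real (stripX z r) - 2 * r * margX f z.1| ≤ 2 * M * r ^ 3
  stripY : ∀ r, 0 ≤ r → r ≤ a →
    |(law f).real (stripY z r) - 2 * r * margY f z.2| ≤ 2 * M * r ^ 3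

theorem lintegral_near_finset_le {g : ℝ → ℝ} {M a : ℝ} (hM : 0 ≤ M) (ha : 0 ≤ a)
    (hg : ∀ᵐ x, g x ≤ M) (S : Finset ℝ) (hS : (S.card : ℝ) ≤ M) :
    ∫⁻ x in ⋃ s ∈ S, Set.Icc (s - a) (s + a), ENNReal.ofReal (g x) ≤
      ENNReal.ofReal (2 * M ^ 2 * a) := by
  calc ∫⁻ x in ⋃ s ∈ S, Set.Icc (s - a) (s + a), ENNReal.ofReal (g x)
      ≤ ∑ s ∈ S, ∫⁻ x in Set.Icc (s - a) (s + a), ENNReal.ofReal (g x) :=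
        by
          classical
          induction S using Finset.induction_on with
          | empty => simp
          | insert s S hs ih =>
            rw [Finset.set_biUnion_insert, Finset.sum_insert hs]
            refine (lintegral_union_le _ _ _).trans (add_le_add le_rfl (ih ?_))
            refine le_trans ?_ hS
            exact_mod_cast Finset.card_le_card (Finset.subset_insert s S)
    _ ≤ ∑ _s ∈ S, ENNReal.ofReal (M * (2 * a)) := by
        refine Finset.sum_le_sum fun s _ => ?_
        calc _ ≤ ∫⁻ _ in Set.Icc (s - a) (s + a), ENNReal.ofReal M :=
              lintegral_mono_ae (ae_restrict_of_ae
                (hg.mono fun x hx => ENNReal.ofReal_le_ofReal hx))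
          _ = _ := by
              rw [setLIntegral_const, Real.volume_Icc, ← ENNReal.ofReal_mul hM]
              congr 2; ring
    _ = ENNReal.ofReal (S.card * (M * (2 * a))) := by
        rw [Finset.sum_const, nsmul_eq_mul, ENNReal.ofReal_mul (Nat.cast_nonneg _),
          ENNReal.ofReal_natCast]
    _ ≤ _ := by
        apply ENNReal.ofReal_le_ofReal
        calc (S.card : ℝ) * (M * (2 * a)) ≤ M * (M * (2 * a)) := by gcongr
          _ = _ := by ring

/-- Two kinds of points are discarded: those within a of a singular point of a marginal, and those
where the ball mass is far from f(z) c ρ² at some dyadic radius ρ ≤ a. Markov's inequality bounds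
the mass of the second kind by 4M³ρ at each scale, and this sums geometrically to 8M³a. -/
theorem Regular.exists_bad (hf : Regular M f) (hν : PlaneNorm ν c) {a : ℝ} (ha : 0 < a) :
    ∃ Bad : Set (ℝ × ℝ), MeasurableSet Bad ∧ law f Bad ≤ ENNReal.ofReal (12 * M ^ 3 * a) ∧
      ∀ᵐ z ∂(law f), z ∉ Bad → Good ν c M a f z := by
  have hM1 := hf.one_le
  have hM : 0 < M := zero_lt_one.trans_le hM1
  have hc := hν.pos
  have hprob := hf.pdf.isProbabilityMeasure_law
  obtain ⟨SX, hSX, hqX⟩ := hf.quadX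
  obtain ⟨SY, hSY, hqY⟩ := hf.quadY
  set NX : Set ℝ := ⋃ s ∈ SX, Set.Icc (s - a) (s + a) with hNX
  set NY : Set ℝ := ⋃ s ∈ SY, Set.Icc (s - a) (s + a) with hNY
  have hNXm : MeasurableSet NX := Finset.measurableSet_biUnion _ fun _ _ => measurableSet_Icc
  have hNYm : MeasurableSet NY := Finset.measurableSet_biUnion _ fun _ _ => measurableSet_Icc
  set ρ : ℕ → ℝ := fun j => a * (1 / 2) ^ j with hρ
  have hρ0 : ∀ j, 0 < ρ j := fun j => by positivity
  set g : ℕ → ℝ × ℝ → ℝ := fun j z =>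
    |(law f).real (nball ν z (ρ j)) - f z * (c * ρ j ^ 2)| with hg
  have hgm : ∀ j, Measurable (g j) := fun j => measurable_nball_dev hν hf.pdf _ _
  set D : ℕ → Set (ℝ × ℝ) := fun j => {z | c * ρ j ^ 2 / (2 * M) ≤ g j z} with hD
  have hDm : ∀ j, MeasurableSet (D j) := fun j => measurableSet_le measurable_const (hgm j)
  have hDv : ∀ j, law f (D j) ≤ ENNReal.ofReal (4 * M ^ 3 * a * (1 / 2) ^ j) := by
    intro j
    have h0 : 0 < c * ρ j ^ 2 / (2 * M) := by have := hρ0 j; positivity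
    have h1 := mul_meas_ge_le_lintegral (μ := (volume : Measure (ℝ × ℝ)))
      (f := fun z => ENNReal.ofReal (g j z)) (hgm j).ennreal_ofReal
      (ENNReal.ofReal (c * ρ j ^ 2 / (2 * M)))
    have h2 : {z | ENNReal.ofReal (c * ρ j ^ 2 / (2 * M)) ≤ ENNReal.ofReal (g j z)} = D j := by
      ext z
      simp only [hD, Set.mem_ofPred_eq]
      exact ENNReal.ofReal_le_ofReal_iff (abs_nonneg _)
    rw [h2] at h1
    have h3 := h1.trans (hf.lintegral_dev_le hν (hρ0 j).le)
    rw [mul_comm, ← ENNReal.le_div_iff_mul_le (by left; simpa using h0) (by left; simp),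
      ← ENNReal.ofReal_div_of_pos h0] at h3
    refine (hf.law_le (D j)).trans ?_
    rw [Measure.smul_apply, smul_eq_mul]
    refine (mul_le_mul_right h3 _).trans ?_
    rw [← ENNReal.ofReal_mul hM.le]
    apply ENNReal.ofReal_le_ofReal
    have h4 := (hρ0 j).ne'
    have : M * (2 * M * c * ρ j ^ 3 / (c * ρ j ^ 2 / (2 * M))) = 4 * M ^ 3 * ρ j := by
      field_simp; ring
    rw [this, hρ]
    simp only
    rw [← mul_assoc]
  have hDU : law f (⋃ j, D j) ≤ ENNReal.ofReal (8 * M ^ 3 * a) := by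
    refine (measure_iUnion_le _).trans ((ENNReal.tsum_le_tsum hDv).trans ?_)
    rw [← ENNReal.ofReal_tsum_of_nonneg (fun j => by positivity)
      (summable_geometric_two.mul_left _), tsum_mul_left, tsum_geometric_two]
    apply ENNReal.ofReal_le_ofReal
    linarith
  have hX : law f (Prod.fst ⁻¹' NX) ≤ ENNReal.ofReal (2 * M ^ 2 * a) := by
    rw [hf.pdf.law_fst hNXm]
    exact lintegral_near_finset_le hM.le ha.le hf.margX_le SX hSX
  have hY : law f (Prod.snd ⁻¹' NY) ≤ ENNReal.ofReal (2 * M ^ 2 * a) := by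
    rw [hf.pdf.law_snd hNYm]
    exact lintegral_near_finset_le hM.le ha.le hf.margY_le SY hSY
  refine ⟨Prod.fst ⁻¹' NX ∪ (Prod.snd ⁻¹' NY ∪ ⋃ j, D j), (measurable_fst hNXm).union
    ((measurable_snd hNYm).union (MeasurableSet.iUnion hDm)), ?_, ?_⟩
  · refine (measure_union_le _ _).trans ((add_le_add hX ((measure_union_le _ _).trans
      (add_le_add hY hDU))).trans ?_)
    rw [← ENNReal.ofReal_add (by positivity) (by positivity),
      ← ENNReal.ofReal_add (by positivity) (by positivity)]
    apply ENNReal.ofReal_le_ofReal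
    have : M ^ 2 * a ≤ M ^ 3 * a := by gcongr; first | exact hM1 | norm_num
    linarith
  · filter_upwards [hf.ae_densityBounds] with z hz hbad
    simp only [Set.mem_union, not_or, Set.mem_preimage, Set.mem_iUnion, not_exists] at hbad
    obtain ⟨b1, b2, b3⟩ := hbad
    refine ⟨hz, ?_, ?_, ?_⟩
    · intro r hr hra
      -- A general radius contains the next smaller dyadic ball, at least half as large. The mass
      -- there is at least c ρ²/(2M), and the halving costs a factor 4, whence 8M.
      obtain ⟨j, hj1, hj2⟩ := exists_nat_pow_near_of_lt_one (x := r / a) (y := 1 / 2)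
        (by positivity) ((div_le_one ha).2 hra) (by norm_num) (by norm_num)
      rw [lt_div_iff₀ ha, mul_comm] at hj1
      rw [div_le_iff₀ ha, mul_comm] at hj2
      have h1 : g (j + 1) z < c * ρ (j + 1) ^ 2 / (2 * M) := not_le.1 (b3 (j + 1))
      have h2 : (law f).real (nball ν z (ρ (j + 1))) ≤ (law f).real (nball ν z r) :=
        measureReal_mono fun w hw => le_trans (show ν (w - z) ≤ ρ (j + 1) from hw) hj1.le
      have h3 := (abs_lt.1 h1).1
      have h4 : r ≤ 2 * ρ (j + 1) := by
        refine hj2.trans (le_of_eq ?_)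
        rw [hρ]; simp only; rw [pow_succ]; ring
      have h5 : c * r ^ 2 / (8 * M) ≤ c * ρ (j + 1) ^ 2 / (2 * M) := by
        calc c * r ^ 2 / (8 * M) ≤ c * (2 * ρ (j + 1)) ^ 2 / (8 * M) := by gcongr
          _ = _ := by field_simp; ring
      have h6 : 1 / M * (c * ρ (j + 1) ^ 2) ≤ f z * (c * ρ (j + 1) ^ 2) := by
        have := hz.lower
        gcongr
      have h7 : 1 / M * (c * ρ (j + 1) ^ 2) =
          c * ρ (j + 1) ^ 2 / (2 * M) + c * ρ (j + 1) ^ 2 / (2 * M) := by field_simp; ring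
      linarith
    · intro r hr hra
      rw [hf.pdf.law_stripX z hr]
      refine hqX z.1 r hr fun t ht hts => b1 ?_
      refine Set.mem_biUnion hts ⟨?_, ?_⟩ <;> linarith [ht.1, ht.2]
    · intro r hr hra
      rw [hf.pdf.law_stripY z hr]
      refine hqY z.2 r hr fun t ht hts => b2 ?_
      refine Set.mem_biUnion hts ⟨?_, ?_⟩ <;> linarith [ht.1, ht.2]

end Law

/-! ### Bias of the local estimate at a typical point -/

theorem hits_add_hits_diff {E : Type*} {m : ℕ} {A S : Set E} (hAS : A ⊆ S) (u : Fin m → E) :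
    hits S u = hits A u + hits (S \ A) u := by
  classical
  rw [hits_eq_sum, hits_eq_sum, hits_eq_sum, ← Finset.sum_add_distrib]
  refine Finset.sum_congr rfl fun l _ => ?_
  by_cases h1 : u l ∈ A
  · simp [h1, hAS h1]
  · by_cases h2 : u l ∈ S <;> simp [h1, h2]

theorem abs_log_sub_log_le {x y t : ℝ} (ht : 0 < t) (hx : t ≤ x) (hy : t ≤ y) :
    |Real.log x - Real.log y| ≤ |x - y| / t := by
  have key : ∀ {x y : ℝ}, t ≤ x → t ≤ y → Real.log x - Real.log y ≤ |x - y| / t := by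
    intro x y hx hy
    have hx0 := ht.trans_le hx
    have hy0 := ht.trans_le hy
    rw [← Real.log_div hx0.ne' hy0.ne']
    calc Real.log (x / y) ≤ x / y - 1 := Real.log_le_sub_one_of_pos (by positivity)
      _ = (x - y) / y := by field_simp
      _ ≤ |x - y| / y := by gcongr; exact le_abs_self _
      _ ≤ |x - y| / t := by gcongr
  refine abs_le.2 ⟨?_, key hx hy⟩
  have := key hy hx
  rw [abs_sub_comm] at this
  linarith

/-- When the ball holds q points, the strip count is q plus the count in the strip outside the ball,
a set disjoint from the ball. Removing the ball changes the strip mass by O(r²), a relative error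
O(r). -/
theorem abs_integral_strip_le {E : Type*} [MeasurableSpace E] (μ : Measure E)
    [IsProbabilityMeasure μ] {A S : Set E} (hA : MeasurableSet A) (hS : MeasurableSet S)
    (hAS : A ⊆ S) {G : ℕ → ℝ} (hG : LogLike G) {M c r φ : ℝ} {m q : ℕ} (hM : 1 ≤ M) (hc : 0 < c)
    (hr : 0 < r) (hr1 : r ≤ 1) (hφ : 1 / M ≤ φ) (hd : |μ.real S - 2 * r * φ| ≤ 2 * M * r ^ 3)
    (hCr : M ^ 2 * (1 + c) * r ≤ 1 / 2) (hP : μ.real A ≤ M * (c * r ^ 2)) (hq : q ≤ m)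
    (hN : 2 * (q + 1) ≤ m + 3) :
    |∫ u : Fin (m + 1) → E, (if hits A u = q then
        G (hits S u + 1) - Real.log ((m + 3) * (2 * r * φ)) else 0) ∂(Measure.pi fun _ => μ)| ≤
      bin (m + 1) q (μ.real A) *
        ((4 * (M ^ 2 * (1 + c)) + 4 * (q + 1) * M) * (r + 1 / ((m + 3) * r))) := by
  have hM0 : 0 < M := zero_lt_one.trans_le hM
  have e : ∀ u : Fin (m + 1) → E, (if hits A u = q then
        G (hits S u + 1) - Real.log ((m + 3) * (2 * r * φ)) else 0) =
      if hits A u = q then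
        G (hits (S \ A) u + q + 1) - Real.log ((m + 3) * (2 * r * φ)) else 0 := by
    intro u
    split_ifs with h
    · rw [hits_add_hits_diff hAS, h, add_comm q]
    · rfl
  simp_rw [e]
  have hA0 : 0 ≤ μ.real A := measureReal_nonneg
  have hMM : M ≤ M ^ 2 := by nlinarith
  have hD : μ.real (S \ A) = μ.real S - μ.real A := measureReal_sdiff hAS hA
  have hr3 : r ^ 3 ≤ r ^ 2 := by
    calc r ^ 3 = r ^ 2 * r := by ring
      _ ≤ r ^ 2 * 1 := by gcongr
      _ = r ^ 2 := mul_one _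
  refine abs_integral_hits_log_le μ hA (hS.diff hA) Set.disjoint_sdiff_right hG hM hr hr1 hφ ?_ hCr
    ?_ hq hN
  · rw [hD]
    calc |μ.real S - μ.real A - 2 * r * φ| = |(μ.real S - 2 * r * φ) - μ.real A| := by ring_nf
      _ ≤ |μ.real S - 2 * r * φ| + |μ.real A| := abs_sub _ _
      _ ≤ 2 * M * r ^ 3 + M * (c * r ^ 2) := by rw [abs_of_nonneg hA0]; exact add_le_add hd hP
      _ ≤ 2 * M * r ^ 2 + 2 * M * (c * r ^ 2) := by
        have : 0 ≤ M * (c * r ^ 2) := by positivity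
        gcongr
        linarith
      _ = M ^ 2 * (1 + c) * r * (2 * r * (1 / M)) := by field_simp
      _ ≤ _ := by gcongr
  · refine hP.trans ?_
    calc M * (c * r ^ 2) = M * c * (r * r) := by ring
      _ ≤ M ^ 2 * (1 + c) * (1 * r) := by
        have : 0 ≤ c := hc.le
        gcongr
        linarith
      _ = _ := by ring

/-- Pointwise mutual information. -/
def pmi (f : ℝ × ℝ → ℝ) (z : ℝ × ℝ) : ℝ := Real.log (f z / (margX f z.1 * margY f z.2))

section Pointwise

variable {ν : ℝ × ℝ → ℝ} {c M a : ℝ} {f : ℝ × ℝ → ℝ} {z : ℝ × ℝ} {G : ℕ → ℝ} {m q : ℕ}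

theorem PlaneNorm.nball_subset_stripX (hν : PlaneNorm ν c) (z : ℝ × ℝ) (r : ℝ) :
    nball ν z r ⊆ KSG.stripX z r := fun w hw => (hν.fst_le (w - z)).trans hw

theorem PlaneNorm.nball_subset_stripY (hν : PlaneNorm ν c) (z : ℝ × ℝ) (r : ℝ) :
    nball ν z r ⊆ KSG.stripY z r := fun w hw => (hν.snd_le (w - z)).trans hw

/-- Given q points in the ball, the strip counts may be replaced by N · 2r · f_X and N · 2r · f_Y.
The logarithms then combine to the pointwise mutual information, up to replacing f(z) by p/(c r²).
-/
theorem abs_integral_local_le_of_good (hf : Regular M f) (hν : PlaneNorm ν c)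
    (hg : Good ν c M a f z) (hG : LogLike G) (hq : q ≤ m) (hN : 2 * (q + 1) ≤ m + 3) {r κ : ℝ}
    (hr : 0 < r) (hra : r ≤ a) (ha1 : a ≤ 1) (hCa : M ^ 2 * (1 + c) * a ≤ 1 / 2) :
    |(∫ u : Fin (m + 1) → ℝ × ℝ, (if hits (nball ν z r) u = q then
        κ + Real.log (m + 3) + Real.log (4 / c) - G (hits (stripX z r) u + 1)
          - G (hits (stripY z r) u + 1) else 0) ∂(Measure.pi fun _ => law f))
      - bin (m + 1) q ((law f).real (nball ν z r)) *
        (κ - Real.log (m + 3) - Real.log ((law f).real (nball ν z r)) + pmi f z)| ≤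
      bin (m + 1) q ((law f).real (nball ν z r)) *
        (8 * M / (c * r ^ 2) * |(law f).real (nball ν z r) - f z * (c * r ^ 2)| +
          2 * (4 * (M ^ 2 * (1 + c)) + 4 * (q + 1) * M) * (r + 1 / ((m + 3) * r))) := by
  have hprob := hf.pdf.isProbabilityMeasure_law
  have hM := hf.one_le
  have hM0 : 0 < M := zero_lt_one.trans_le hM
  have hc := hν.pos
  have hA := hν.measurableSet_nball z r
  have hSX := measurableSet_stripX z r
  have hSY := measurableSet_stripY z r
  have hC : M ^ 2 * (1 + c) * r ≤ 1 / 2 := le_trans (by gcongr) hCa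
  have hP := hf.law_nball_le hν z hr.le
  have tX := abs_integral_strip_le (law f) hA hSX (hν.nball_subset_stripX z r) hG hM hc hr
    (hra.trans ha1) hg.bounds.lowerX (hg.stripX r hr.le hra) hC hP hq hN
  have tY := abs_integral_strip_le (law f) hA hSY (hν.nball_subset_stripY z r) hG hM hc hr
    (hra.trans ha1) hg.bounds.lowerY (hg.stripY r hr.le hra) hC hP hq hN
  set p := (law f).real (nball ν z r) with hp
  have hplow : c * r ^ 2 / (8 * M) ≤ p := hg.ball r hr hra
  have hp0 : 0 < p := lt_of_lt_of_le (by positivity) hplow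
  have hb : 0 ≤ bin (m + 1) q p := bin_nonneg hp0.le (measureReal_le_one)
  have hfz : 0 < f z := lt_of_lt_of_le (by positivity) hg.bounds.lower
  have hfX : 0 < margX f z.1 := lt_of_lt_of_le (by positivity) hg.bounds.lowerX
  have hfY : 0 < margY f z.2 := lt_of_lt_of_le (by positivity) hg.bounds.lowerY
  set JX := ∫ u : Fin (m + 1) → ℝ × ℝ, (if hits (nball ν z r) u = q then
    G (hits (stripX z r) u + 1) - Real.log ((m + 3) * (2 * r * margX f z.1)) else 0)
    ∂(Measure.pi fun _ => law f) with hJX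
  set JY := ∫ u : Fin (m + 1) → ℝ × ℝ, (if hits (nball ν z r) u = q then
    G (hits (stripY z r) u + 1) - Real.log ((m + 3) * (2 * r * margY f z.2)) else 0)
    ∂(Measure.pi fun _ => law f) with hJY
  set K := κ + Real.log (m + 3) + Real.log (4 / c) - Real.log ((m + 3) * (2 * r * margX f z.1)) -
    Real.log ((m + 3) * (2 * r * margY f z.2)) with hK
  have split : (∫ u : Fin (m + 1) → ℝ × ℝ, (if hits (nball ν z r) u = q then
        κ + Real.log (m + 3) + Real.log (4 / c) - G (hits (stripX z r) u + 1)
          - G (hits (stripY z r) u + 1) else 0) ∂(Measure.pi fun _ => law f)) =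
      bin (m + 1) q p * K - JX - JY := by
    have i1 : Integrable (fun u : Fin (m + 1) → ℝ × ℝ =>
        (if hits (nball ν z r) u = q then (1 : ℝ) else 0) * K) (Measure.pi fun _ => law f) :=
      (integrable_hits (law f) hA hA fun x _ => if x = q then (1 : ℝ) else 0).mul_const K
    have i2 := integrable_hits (m := m + 1) (law f) hA hSX fun x y =>
      if x = q then G (y + 1) - Real.log ((m + 3) * (2 * r * margX f z.1)) else 0
    have i3 := integrable_hits (m := m + 1) (law f) hA hSY fun x y =>
      if x = q then G (y + 1) - Real.log ((m + 3) * (2 * r * margY f z.2)) else 0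
    have i12 : Integrable (fun u : Fin (m + 1) → ℝ × ℝ =>
        (if hits (nball ν z r) u = q then (1 : ℝ) else 0) * K -
        if hits (nball ν z r) u = q then
          G (hits (stripX z r) u + 1) - Real.log ((m + 3) * (2 * r * margX f z.1)) else 0)
        (Measure.pi fun _ => law f) := i1.sub i2
    rw [← integral_hits_eq (law f) hA (m + 1) q, ← integral_mul_const, hJX, hJY,
      ← integral_sub i1 i2, ← integral_sub i12 i3]
    refine integral_congr_ae (Filter.Eventually.of_forall fun u => ?_)
    simp only [hK]
    split_ifs <;> ring
  -- The correction log(4/c) is the ratio of the square (2r)² to the ball area c r²; with it all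
  -- powers of r cancel except through p.
  have hKeq : K - (κ - Real.log (m + 3) - Real.log p + pmi f z) =
      Real.log (p / (c * r ^ 2)) - Real.log (f z) := by
    have hN0 : ((m : ℝ) + 3) ≠ 0 := by positivity
    rw [hK, pmi, Real.log_div (by norm_num) hc.ne', Real.log_mul hN0 (by positivity),
      Real.log_mul hN0 (by positivity), Real.log_mul (by positivity) hfX.ne',
      Real.log_mul (by positivity) hfY.ne', Real.log_mul two_ne_zero hr.ne',
      Real.log_div hfz.ne' (by positivity), Real.log_mul hfX.ne' hfY.ne',
      Real.log_div hp0.ne' (by positivity), Real.log_mul hc.ne' (by positivity), Real.log_pow,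
      show (4 : ℝ) = 2 * 2 by norm_num, Real.log_mul two_ne_zero two_ne_zero]
    push_cast
    ring
  have hlog : |Real.log (p / (c * r ^ 2)) - Real.log (f z)| ≤
      8 * M / (c * r ^ 2) * |p - f z * (c * r ^ 2)| := by
    have hcr : 0 < c * r ^ 2 := by positivity
    refine (abs_log_sub_log_le (t := 1 / (8 * M)) (by positivity) ?_ ?_).trans (le_of_eq ?_)
    · rw [le_div_iff₀ hcr]
      calc 1 / (8 * M) * (c * r ^ 2) = c * r ^ 2 / (8 * M) := by ring
        _ ≤ p := hplow
    · refine le_trans ?_ hg.bounds.lower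
      gcongr
      linarith
    · have : p / (c * r ^ 2) - f z = (p - f z * (c * r ^ 2)) / (c * r ^ 2) := by field_simp
      rw [this, abs_div, abs_of_pos hcr]
      field_simp
  rw [split]
  calc |bin (m + 1) q p * K - JX - JY - bin (m + 1) q p *
          (κ - Real.log (m + 3) - Real.log p + pmi f z)|
      = |bin (m + 1) q p * (K - (κ - Real.log (m + 3) - Real.log p + pmi f z)) - JX - JY| := by
        ring_nf
    _ ≤ |bin (m + 1) q p * (K - (κ - Real.log (m + 3) - Real.log p + pmi f z))| + |JX| + |JY| :=
        (abs_sub _ _).trans (add_le_add (abs_sub _ _) le_rfl)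
    _ ≤ bin (m + 1) q p * (8 * M / (c * r ^ 2) * |p - f z * (c * r ^ 2)|) + _ + _ := by
        rw [abs_mul, abs_of_nonneg hb, hKeq]
        exact add_le_add (add_le_add (mul_le_mul_of_nonneg_left hlog hb) tX) tY
    _ = _ := by ring

end Pointwise

section Bias

variable {ν : ℝ × ℝ → ℝ} {c M a : ℝ} {f : ℝ × ℝ → ℝ} {z : ℝ × ℝ} {G : ℕ → ℝ} {m q : ℕ}

theorem abs_digamma_sub_log_le (m : ℕ) :
    |-Real.eulerMascheroniConstant + (harmonic (m + 2) : ℝ) - Real.log (m + 3)| ≤ 1 / (m + 2) := by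
  have h1 := logLike_digamma.log_le (m + 2) (by omega)
  have h2 := logLike_digamma.le_log (m + 2) (by omega)
  rw [digamma_nat] at h1 h2
  push_cast at h1 h2
  have h0 : (0 : ℝ) < m + 2 := by positivity
  have h3 : Real.log (m + 2) ≤ Real.log (m + 3) := Real.log_le_log h0 (by linarith)
  have h4 : Real.log (m + 3) ≤ Real.log (m + 2) + 1 / (m + 2) := by
    have h := Real.log_le_sub_one_of_pos (x := ((m : ℝ) + 3) / (m + 2)) (by positivity)
    rw [Real.log_div (by positivity) h0.ne'] at h
    have e : ((m : ℝ) + 3) / (m + 2) - 1 = 1 / (m + 2) := by field_simp; ring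
    linarith
  rw [abs_le]
  constructor <;> linarith

theorem DensityBounds.abs_pmi_le (hM : 1 ≤ M) (h : DensityBounds M f z) :
    |pmi f z| ≤ 3 * Real.log M := by
  have hM0 : 0 < M := zero_lt_one.trans_le hM
  have h0 : (0 : ℝ) < 1 / M := by positivity
  have key : ∀ x : ℝ, 1 / M ≤ x → x ≤ M → |Real.log x| ≤ Real.log M := fun x h1 h2 => by
    rw [abs_le, ← Real.log_inv, ← one_div]
    exact ⟨Real.log_le_log h0 h1, Real.log_le_log (h0.trans_le h1) h2⟩
  have k1 := key _ h.lower h.upper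
  have k2 := key _ h.lowerX h.upperX
  have k3 := key _ h.lowerY h.upperY
  have hX := (h0.trans_le h.lowerX).ne'
  have hY := (h0.trans_le h.lowerY).ne'
  rw [pmi, Real.log_div (h0.trans_le h.lower).ne' (mul_ne_zero hX hY), Real.log_mul hX hY]
  rw [abs_le] at *
  constructor <;> linarith [k1.1, k1.2, k2.1, k2.2, k3.1, k3.2]

theorem bin_le_exp {p τ : ℝ} (hτ0 : 0 ≤ τ) (hτ : τ ≤ p) (hp : p ≤ 1) (hq : q ≤ m) :
    ((m : ℝ) + 2) * bin (m + 1) q p ≤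
      ((m : ℝ) + 3) ^ (q + 1) * Real.exp (-(τ * (m + 1 - q))) := by
  have h1 := bin_le (m := m + 1) (q := q) (hτ0.trans hτ) hp
  have h2 : (1 - p) ^ (m + 1 - q) ≤ Real.exp (-(τ * (m + 1 - q))) := by
    calc (1 - p) ^ (m + 1 - q) ≤ (Real.exp (-τ)) ^ (m + 1 - q) := by
          refine pow_le_pow_left₀ (by linarith) ?_ _
          have := Real.add_one_le_exp (-τ)
          linarith
      _ = _ := by
          rw [← Real.exp_nat_mul, Nat.cast_sub (by omega)]
          congr 1
          push_cast; ring
  have h3 : p ^ q ≤ 1 := pow_le_one₀ (hτ0.trans hτ) hp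
  have h4 : 0 ≤ p ^ q := pow_nonneg (hτ0.trans hτ) _
  have h5 : 0 ≤ (1 - p) ^ (m + 1 - q) := pow_nonneg (by linarith) _
  push_cast at h1
  calc ((m : ℝ) + 2) * bin (m + 1) q p
      ≤ ((m : ℝ) + 2) * (((m : ℝ) + 1) ^ q * p ^ q * (1 - p) ^ (m + 1 - q)) := by gcongr
    _ ≤ ((m : ℝ) + 3) * (((m : ℝ) + 3) ^ q * 1 * Real.exp (-(τ * (m + 1 - q)))) := by
        gcongr <;> linarith
    _ = _ := by ring

/-- Keeping p^q and dropping the power of 1 - p yields (N a²)^q after multiplication by N^q; this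
crude step puts the dependence on k into the logarithmic exponent. -/
theorem bin_le_pow {p t : ℝ} (hp0 : 0 ≤ p) (hp1 : p ≤ 1) (hp : p ≤ t) :
    ((m : ℝ) + 2) * bin (m + 1) q p ≤ ((m : ℝ) + 3) ^ (q + 1) * t ^ q := by
  have h1 := bin_le (m := m + 1) (q := q) hp0 hp1
  have h2 : (1 - p) ^ (m + 1 - q) ≤ 1 := pow_le_one₀ (by linarith) (by linarith)
  have h5 : 0 ≤ (1 - p) ^ (m + 1 - q) := pow_nonneg (by linarith) _
  push_cast at h1
  calc ((m : ℝ) + 2) * bin (m + 1) q p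
      ≤ ((m : ℝ) + 2) * (((m : ℝ) + 1) ^ q * p ^ q * (1 - p) ^ (m + 1 - q)) := by gcongr
    _ ≤ ((m : ℝ) + 3) * (((m : ℝ) + 3) ^ q * t ^ q * 1) := by
        have : 0 ≤ t := hp0.trans hp
        gcongr <;> linarith
    _ = _ := by ring

/-- Contribution to the bias of the event that the nearest neighbour distance exceeds `a`. -/
def tailErr (c M κ a : ℝ) (m q : ℕ) : ℝ :=
  ((m : ℝ) + 3) ^ (q + 1) * Real.exp (-(c * a ^ 2 / (8 * M) * (m + 1 - q))) *
    (|κ| + Real.log (m + 3) + |Real.log (c * a ^ 2 / (8 * M))| + 3 * Real.log M)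

/-- The conditional mean J(w) is compared with g(p(w)), whose integral is known exactly. For w
within a of z the difference is the local error. Beyond a the truncation makes J zero, and g(p) is
small because a good point has ball mass at least of order a². -/
theorem bias_le_of_good (hf : Regular M f) (hν : PlaneNorm ν c)
    (hg : Good ν c M a f z) (hG : LogLike G) (hq : q ≤ m) (hN : 2 * (q + 1) ≤ m + 3)
    (ha : 0 < a) (ha1 : a ≤ 1) (hCa : M ^ 2 * (1 + c) * a ≤ 1 / 2) :
    ENNReal.ofReal |(∫ v : Fin (m + 2) → ℝ × ℝ, loc ν (q + 1) G
        (digamma (q + 1) + Real.log (m + 3) + Real.log (4 / c)) a Finset.univ v z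
          ∂(Measure.pi fun _ => law f)) - pmi f z| ≤
      ENNReal.ofReal (1 / (m + 2) + tailErr c M (digamma (q + 1)) a m q) +
      ENNReal.ofReal M * ∫⁻ h in {h | ν h ≤ a}, ENNReal.ofReal
        (((m : ℝ) + 3) ^ (q + 1) * (M * (c * a ^ 2)) ^ q *
        (8 * M / (c * ν h ^ 2) * |(law f).real (nball ν z (ν h)) - f z * (c * ν h ^ 2)| +
          2 * (4 * (M ^ 2 * (1 + c)) + 4 * (q + 1) * M) * (ν h + 1 / ((m + 3) * ν h)))) := by
  have hprob := hf.pdf.isProbabilityMeasure_law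
  have hM := hf.one_le
  have hM0 : 0 < M := zero_lt_one.trans_le hM
  have hc := hν.pos
  have h0 : ∀ r, law f {w | ν (w - z) = r} = 0 := hν.law_sphere f z
  have hR : Measurable fun w : ℝ × ℝ => ν (w - z) := hν.measurable.comp (measurable_id.sub_const z)
  obtain ⟨hI, hE⟩ := integral_loc (m := m + 1) (a := a) (z := z)
    (κ := digamma (q + 1) + Real.log (m + 3) + Real.log (4 / c)) hν (law f) hG
    (Nat.succ_le_succ (Nat.zero_le q)) (by omega) h0
  set κ := digamma (q + 1) + Real.log (m + 3) + Real.log (4 / c) with hκ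
  set J : ℝ × ℝ → ℝ := fun w => ∫ u : Fin (m + 1) → ℝ × ℝ,
    (if ν (w - z) ≤ a ∧ hits (nball ν z (ν (w - z))) u + 1 = q + 1 then
      κ - G (hits (stripX z (ν (w - z))) u + 1) - G (hits (stripY z (ν (w - z))) u + 1)
    else 0) ∂(Measure.pi fun _ => law f) with hJ
  set p : ℝ × ℝ → ℝ := fun w => (law f).real (nball ν z (ν (w - z))) with hp
  have hpm : Measurable p := measurable_law_nball hν hf.pdf measurable_const hR
  have hp0 : ∀ w, 0 ≤ p w := fun w => measureReal_nonneg
  have hp1 : ∀ w, p w ≤ 1 := fun w => measureReal_le_one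
  set L : ℝ → ℝ := fun u => digamma (q + 1) - Real.log (m + 3) - Real.log u + pmi f z with hL
  set g : ℝ → ℝ := fun u => bin (m + 1) q u * L u with hgdef
  have hgm : Measurable g := by
    have := (continuous_bin (m + 1) q).measurable
    simp only [hgdef, hL]
    fun_prop
  have hgi : IntervalIntegrable g volume 0 1 := by
    have i1 := intervalIntegrable_mul_log (continuous_bin (m + 1) q)
    have i2 : IntervalIntegrable (fun u => bin (m + 1) q u *
        (digamma (q + 1) - Real.log (m + 3) + pmi f z)) volume 0 1 :=
      ((continuous_bin (m + 1) q).mul continuous_const).intervalIntegrable _ _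
    refine (i2.sub i1).congr fun u _ => ?_
    simp only [hgdef, hL]; ring
  have hgint := integrable_cdf_comp (law f) hR h0 hpm hgm hgi
  -- The ball mass is uniform, so the beta integrals apply: ψ(q + 1) cancels and ψ(m + 3) - log(m +
  -- 3) remains.
  have hgval : ((m : ℝ) + 2) * ∫ w, g (p w) ∂(law f) =
      pmi f z + (-Real.eulerMascheroniConstant + (harmonic (m + 2) : ℝ) - Real.log (m + 3)) := by
    have e1 : ∫ w, g (p w) ∂(law f) = ∫ u in (0 : ℝ)..1, g u :=
      integral_cdf_comp (law f) hR h0 hpm hgm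
    have b1 := integral_bin (m := m + 1) (q := q) (by omega)
    have b2 := integral_bin_log (m := m + 1) (q := q) (by omega)
    have i1 := intervalIntegrable_mul_log (continuous_bin (m + 1) q)
    have i2 : IntervalIntegrable (fun u => bin (m + 1) q u *
        (digamma (q + 1) - Real.log (m + 3) + pmi f z)) volume 0 1 :=
      ((continuous_bin (m + 1) q).mul continuous_const).intervalIntegrable _ _
    have e2 : ∫ u in (0 : ℝ)..1, g u = (∫ u in (0 : ℝ)..1, bin (m + 1) q u) *
        (digamma (q + 1) - Real.log (m + 3) + pmi f z) -
        ∫ u in (0 : ℝ)..1, bin (m + 1) q u * Real.log u := by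
      rw [← intervalIntegral.integral_mul_const, ← intervalIntegral.integral_sub i2 i1]
      refine intervalIntegral.integral_congr fun u _ => ?_
      simp only [hgdef, hL]; ring
    rw [e1, e2, digamma_nat]
    rw [digamma_nat] at *
    push_cast at b1 b2
    have e3 : (m : ℝ) + 1 + 1 = m + 2 := by ring
    rw [e3] at b1 b2
    have e4 : harmonic (m + 1 + 1) = harmonic (m + 2) := rfl
    rw [e4] at b2
    rw [mul_sub, ← mul_assoc, b1, b2]
    ring
  set S : Set (ℝ × ℝ) := {w | ν (w - z) ≤ a} with hS
  have hSm : MeasurableSet S := measurableSet_le hR measurable_const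
  set Φ : ℝ → ℝ := fun r => ((m : ℝ) + 3) ^ (q + 1) * (M * (c * a ^ 2)) ^ q *
        (8 * M / (c * r ^ 2) * |(law f).real (nball ν z r) - f z * (c * r ^ 2)| +
          2 * (4 * (M ^ 2 * (1 + c)) + 4 * (q + 1) * M) * (r + 1 / ((m + 3) * r))) with hΦ
  have near : ∀ w ∈ S, ν (w - z) ≠ 0 → ((m : ℝ) + 2) * |J w - g (p w)| ≤ Φ (ν (w - z)) := by
    intro w hw hne
    have hr : 0 < ν (w - z) := lt_of_le_of_ne (hν.nonneg _) hne.symm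
    have hw' : ν (w - z) ≤ a := hw
    have h1 := abs_integral_local_le_of_good hf hν hg hG hq hN (κ := digamma (q + 1)) hr hw' ha1 hCa
    have h2 : J w = ∫ u : Fin (m + 1) → ℝ × ℝ, (if hits (nball ν z (ν (w - z))) u = q then
        digamma (q + 1) + Real.log (m + 3) + Real.log (4 / c)
          - G (hits (stripX z (ν (w - z))) u + 1)
          - G (hits (stripY z (ν (w - z))) u + 1) else 0) ∂(Measure.pi fun _ => law f) := by
      simp only [hJ, hw', true_and, add_left_inj, hκ]
    have h3 := bin_le_pow (m := m) (q := q) (hp0 w) (hp1 w)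
      (t := M * (c * a ^ 2)) ((hf.law_nball_le hν z hr.le).trans (by gcongr))
    calc ((m : ℝ) + 2) * |J w - g (p w)|
        ≤ ((m : ℝ) + 2) * (bin (m + 1) q (p w) * _) := by
          rw [h2]
          exact mul_le_mul_of_nonneg_left h1 (by positivity)
      _ = ((m : ℝ) + 2) * bin (m + 1) q (p w) * _ := (mul_assoc _ _ _).symm
      _ ≤ _ := mul_le_mul_of_nonneg_right h3 (by positivity)
  have far : ∀ w ∈ Sᶜ, ((m : ℝ) + 2) * |J w - g (p w)| ≤
      tailErr c M (digamma (q + 1)) a m q := by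
    intro w hw
    have hw' : a < ν (w - z) := not_le.1 hw
    have h2 : J w = 0 := by
      simp only [hJ, hw'.not_ge, false_and, if_false, integral_zero]
    have hτ0 : 0 < c * a ^ 2 / (8 * M) := by positivity
    have hτ : c * a ^ 2 / (8 * M) ≤ p w := (hg.ball a ha le_rfl).trans
      (measureReal_mono fun w' hw'' => le_trans (show ν (w' - z) ≤ a from hw'') hw'.le)
    have hb := bin_le_exp (m := m) (q := q) hτ0.le hτ (hp1 w) hq
    have hb0 : 0 ≤ bin (m + 1) q (p w) := bin_nonneg (hp0 w) (hp1 w)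
    have hL1 : |L (p w)| ≤ |digamma (q + 1)| + Real.log (m + 3) +
        |Real.log (c * a ^ 2 / (8 * M))| + 3 * Real.log M := by
      have l1 : |Real.log (p w)| ≤ |Real.log (c * a ^ 2 / (8 * M))| := by
        rw [abs_of_nonpos (Real.log_nonpos (hp0 w) (hp1 w)),
          abs_of_nonpos (Real.log_nonpos hτ0.le (hτ.trans (hp1 w)))]
        exact neg_le_neg (Real.log_le_log hτ0 hτ)
      have l2 := hg.bounds.abs_pmi_le hM
      have l3 : |Real.log ((m : ℝ) + 3)| = Real.log (m + 3) :=
        abs_of_nonneg (Real.log_nonneg (by have : (0 : ℝ) ≤ m := by positivity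
                                           linarith))
      calc |L (p w)| ≤ |digamma (q + 1) - Real.log (m + 3) - Real.log (p w)| + |pmi f z| :=
            abs_add_le _ _
        _ ≤ |digamma (q + 1)| + |Real.log ((m : ℝ) + 3)| + |Real.log (p w)| + |pmi f z| :=
            add_le_add ((abs_sub _ _).trans (add_le_add (abs_sub _ _) le_rfl)) le_rfl
        _ ≤ _ := by rw [l3]; gcongr
    rw [h2, zero_sub, abs_neg, abs_mul, abs_of_nonneg hb0, ← mul_assoc]
    exact mul_le_mul hb hL1 (abs_nonneg _) (by positivity)
  have htail : 0 ≤ tailErr c M (digamma (q + 1)) a m q := by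
    have l3 : 0 ≤ Real.log ((m : ℝ) + 3) := Real.log_nonneg (by
      have : (0 : ℝ) ≤ m := by positivity
      linarith)
    have l4 := Real.log_nonneg hM
    unfold tailErr
    positivity
  have hX : ENNReal.ofReal |((m : ℝ) + 2) * ∫ w, (J w - g (p w)) ∂(law f)| ≤
      ∫⁻ w, ENNReal.ofReal (((m : ℝ) + 2) * |J w - g (p w)|) ∂(law f) := by
    rw [← integral_const_mul, ← Real.enorm_eq_ofReal_abs]
    refine (enorm_integral_le_lintegral_enorm _).trans (le_of_eq ?_)
    refine lintegral_congr fun w => ?_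
    rw [Real.enorm_eq_ofReal_abs, abs_mul, abs_of_nonneg (by positivity : (0 : ℝ) ≤ m + 2)]
  have hsplit : (∫ v : Fin (m + 2) → ℝ × ℝ, loc ν (q + 1) G κ a Finset.univ v z
          ∂(Measure.pi fun _ => law f)) - pmi f z =
      ((m : ℝ) + 2) * ∫ w, (J w - g (p w)) ∂(law f) +
      (-Real.eulerMascheroniConstant + (harmonic (m + 2) : ℝ) - Real.log (m + 3)) := by
    have e : ∫ w, (J w - g (p w)) ∂(law f) = ∫ w, J w ∂(law f) - ∫ w, g (p w) ∂(law f) :=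
      integral_sub hI hgint
    have hE' : (∫ v : Fin (m + 2) → ℝ × ℝ, loc ν (q + 1) G κ a Finset.univ v z
          ∂(Measure.pi fun _ => law f)) = (((m + 1 : ℕ) : ℝ) + 1) * ∫ w, J w ∂(law f) := hE
    rw [hE', e, mul_sub, hgval]
    push_cast
    ring
  have hnear : ∫⁻ w in S, ENNReal.ofReal (((m : ℝ) + 2) * |J w - g (p w)|) ∂(law f) ≤
      ENNReal.ofReal M * ∫⁻ h in {h | ν h ≤ a}, ENNReal.ofReal (Φ (ν h)) := by
    calc ∫⁻ w in S, ENNReal.ofReal (((m : ℝ) + 2) * |J w - g (p w)|) ∂(law f)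
        ≤ ∫⁻ w in S, ENNReal.ofReal (Φ (ν (w - z))) ∂(law f) := by
          refine lintegral_mono_ae ((ae_restrict_iff' hSm).2 ?_)
          have : ∀ᵐ w ∂(law f), ν (w - z) ≠ 0 := by
            rw [ae_iff]; simpa using h0 0
          filter_upwards [this] with w hw hwS
          exact ENNReal.ofReal_le_ofReal (near w hwS hw)
      -- Passing from the law to area and recentring at z makes the domain of integration
      -- independent of z, which permits Fubini when the bias is integrated over z.
      _ ≤ ENNReal.ofReal M * ∫⁻ w in S, ENNReal.ofReal (Φ (ν (w - z))) := by
          rw [← lintegral_indicator hSm, ← lintegral_indicator hSm]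
          exact hf.lintegral_law_le _
      _ = _ := by
          congr 1
          rw [← lintegral_indicator hSm, ← lintegral_indicator
            (measurableSet_le hν.measurable measurable_const),
            ← lintegral_sub_right_eq_self ({h | ν h ≤ a}.indicator _) z]
          rfl
  have hfar : ∫⁻ w in Sᶜ, ENNReal.ofReal (((m : ℝ) + 2) * |J w - g (p w)|) ∂(law f) ≤
      ENNReal.ofReal (tailErr c M (digamma (q + 1)) a m q) := by
    calc _ ≤ ∫⁻ _ in Sᶜ, ENNReal.ofReal (tailErr c M (digamma (q + 1)) a m q) ∂(law f) :=
          setLIntegral_mono' hSm.compl fun w hw => ENNReal.ofReal_le_ofReal (far w hw)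
      _ ≤ _ := by
          rw [setLIntegral_const]
          exact mul_le_of_le_one_right' prob_le_one
  rw [hsplit]
  calc ENNReal.ofReal |((m : ℝ) + 2) * ∫ w, (J w - g (p w)) ∂(law f) +
        (-Real.eulerMascheroniConstant + (harmonic (m + 2) : ℝ) - Real.log (m + 3))|
      ≤ ENNReal.ofReal |((m : ℝ) + 2) * ∫ w, (J w - g (p w)) ∂(law f)| +
        ENNReal.ofReal (1 / (m + 2)) :=
        (ENNReal.ofReal_le_ofReal ((abs_add_le _ _).trans
          (add_le_add le_rfl (abs_digamma_sub_log_le m)))).trans ENNReal.ofReal_add_le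
    _ ≤ (ENNReal.ofReal M * (∫⁻ h in {h | ν h ≤ a}, ENNReal.ofReal (Φ (ν h))) +
        ENNReal.ofReal (tailErr c M (digamma (q + 1)) a m q)) + ENNReal.ofReal (1 / (m + 2)) := by
        refine add_le_add (hX.trans ?_) le_rfl
        rw [← lintegral_add_compl _ hSm]
        exact add_le_add hnear hfar
    _ = _ := by
        rw [ENNReal.ofReal_add (by positivity) htail, add_assoc, add_comm]
        congr 1
        exact add_comm _ _

end Bias

/-! ### Integration of the local bias over the sample point -/

section IntegratedBias

variable {ν : ℝ × ℝ → ℝ} {c M a : ℝ} {f : ℝ × ℝ → ℝ} {G : ℕ → ℝ} {m q : ℕ}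

/-- Dyadic shells: 1/ν is at most 2/ρ on the shell of outer radius ρ, whose area is at most c ρ²,
and the resulting series is geometric. -/
theorem PlaneNorm.lintegral_one_div_le (hν : PlaneNorm ν c) (ha : 0 < a) :
    ∫⁻ h in {h | ν h ≤ a}, ENNReal.ofReal (1 / ν h) ≤ ENNReal.ofReal (4 * c * a) := by
  have hc := hν.pos
  set ρ : ℕ → ℝ := fun j => a * (1 / 2) ^ j with hρ
  have hρ0 : ∀ j, 0 < ρ j := fun j => by positivity
  have hBm : ∀ r : ℝ, MeasurableSet {h | ν h ≤ r} := fun r =>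
    measurableSet_le hν.measurable measurable_const
  have point : ∀ h, {h | ν h ≤ a}.indicator (fun h => ENNReal.ofReal (1 / ν h)) h ≤
      ∑' j, {h | ν h ≤ ρ j}.indicator (fun _ => ENNReal.ofReal (2 / ρ j)) h := by
    intro h
    by_cases hh : ν h ≤ a
    · rw [Set.indicator_of_mem (show h ∈ {h | ν h ≤ a} from hh)]
      rcases (hν.nonneg h).eq_or_lt with h0 | h0
      · rw [← h0]; simp
      obtain ⟨j, hj1, hj2⟩ := exists_nat_pow_near_of_lt_one (x := ν h / a) (y := 1 / 2)
        (by positivity) ((div_le_one ha).2 hh) (by norm_num) (by norm_num)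
      rw [lt_div_iff₀ ha, mul_comm] at hj1
      rw [div_le_iff₀ ha, mul_comm] at hj2
      refine le_trans ?_ (ENNReal.le_tsum j)
      rw [Set.indicator_of_mem (show h ∈ {h | ν h ≤ ρ j} from hj2)]
      apply ENNReal.ofReal_le_ofReal
      rw [div_le_div_iff₀ h0 (hρ0 j)]
      have : ρ j = 2 * (a * (1 / 2) ^ (j + 1)) := by simp only [hρ]; ring
      linarith
    · rw [Set.indicator_of_notMem (show h ∉ {h | ν h ≤ a} from hh)]
      exact zero_le
  rw [← lintegral_indicator (hBm a)]
  refine (lintegral_mono point).trans ?_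
  rw [lintegral_tsum fun j => (measurable_const.indicator (hBm _)).aemeasurable]
  have e : ∀ j, ∫⁻ h, {h | ν h ≤ ρ j}.indicator (fun _ => ENNReal.ofReal (2 / ρ j)) h =
      ENNReal.ofReal (2 * c * a * (1 / 2) ^ j) := by
    intro j
    rw [lintegral_indicator (hBm _), setLIntegral_const, hν.volume_le _ (hρ0 j).le,
      ← ENNReal.ofReal_mul (by have := hρ0 j; positivity)]
    congr 1
    have h1 := (hρ0 j).ne'
    have : 2 / ρ j * (c * ρ j ^ 2) = 2 * c * ρ j := by field_simp
    rw [this, hρ]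
    ring
  simp_rw [e]
  rw [← ENNReal.ofReal_tsum_of_nonneg (fun j => by positivity)
    (summable_geometric_two.mul_left _), tsum_mul_left, tsum_geometric_two]
  apply ENNReal.ofReal_le_ofReal
  linarith

/-- For fixed h the mean deviation over z is of order ν(h)³, so the weight 1/ν(h)² leaves order
ν(h); it is integrated over h only after that. Pointwise in z no such rate is available. -/
theorem Regular.lintegral_near_le (hf : Regular M f) (hν : PlaneNorm ν c) (ha : 0 < a) {W C N : ℝ}
    (hW : 0 ≤ W) (hC : 0 ≤ C) (hN : 0 < N) :
    ∫⁻ z, (∫⁻ h in {h | ν h ≤ a}, ENNReal.ofReal (W *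
      (8 * M / (c * ν h ^ 2) * |(law f).real (nball ν z (ν h)) - f z * (c * ν h ^ 2)| +
        C * (ν h + 1 / (N * ν h))))) ∂(law f) ≤
      ENNReal.ofReal (W * c * ((16 * M ^ 3 + C) * a ^ 3 + 4 * C * (a / N))) := by
  have hprob := hf.pdf.isProbabilityMeasure_law
  have hM := hf.one_le
  have hM0 : 0 < M := zero_lt_one.trans_le hM
  have hc := hν.pos
  have hνm := hν.measurable
  have hfm := hf.pdf.measurable
  have hBm : MeasurableSet {h | ν h ≤ a} := measurableSet_le hν.measurable measurable_const
  have hd : Measurable fun p : (ℝ × ℝ) × (ℝ × ℝ) => (law f).real (nball ν p.1 (ν p.2)) :=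
    measurable_law_nball hν hf.pdf measurable_fst (hνm.comp measurable_snd)
  have hd' : Measurable fun p : (ℝ × ℝ) × (ℝ × ℝ) =>
      |(law f).real (nball ν p.1 (ν p.2)) - f p.1 * (c * ν p.2 ^ 2)| := by
    have h3 : Measurable fun p : (ℝ × ℝ) × (ℝ × ℝ) => f p.1 * (c * ν p.2 ^ 2) := by fun_prop
    exact measurable_norm.comp (hd.sub h3)
  have hmeas : Measurable fun p : (ℝ × ℝ) × (ℝ × ℝ) => ENNReal.ofReal (W *
      (8 * M / (c * ν p.2 ^ 2) * |(law f).real (nball ν p.1 (ν p.2)) - f p.1 * (c * ν p.2 ^ 2)| +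
        C * (ν p.2 + 1 / (N * ν p.2)))) := by
    have h1 : Measurable fun p : (ℝ × ℝ) × (ℝ × ℝ) => 8 * M / (c * ν p.2 ^ 2) := by fun_prop
    have h2 : Measurable fun p : (ℝ × ℝ) × (ℝ × ℝ) => C * (ν p.2 + 1 / (N * ν p.2)) := by fun_prop
    exact (((h1.mul hd').add h2).const_mul W).ennreal_ofReal
  rw [lintegral_lintegral_swap hmeas.aemeasurable]
  have point : ∀ h ∈ {h | ν h ≤ a}, ∫⁻ z, ENNReal.ofReal (W *
      (8 * M / (c * ν h ^ 2) * |(law f).real (nball ν z (ν h)) - f z * (c * ν h ^ 2)| +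
        C * (ν h + 1 / (N * ν h)))) ∂(law f) ≤
      ENNReal.ofReal (W * (16 * M ^ 3 + C) * a) +
        ENNReal.ofReal (W * C / N) * ENNReal.ofReal (1 / ν h) := by
    intro h hh
    have hh' : ν h ≤ a := hh
    have hn := hν.nonneg h
    calc _ = ∫⁻ z, (ENNReal.ofReal (W * (8 * M / (c * ν h ^ 2))) *
          ENNReal.ofReal |(law f).real (nball ν z (ν h)) - f z * (c * ν h ^ 2)| +
          ENNReal.ofReal (W * (C * (ν h + 1 / (N * ν h))))) ∂(law f) := by
          refine lintegral_congr fun z => ?_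
          rw [← ENNReal.ofReal_mul (by positivity), ← ENNReal.ofReal_add (by positivity)
            (by positivity)]
          congr 1; ring
      _ = ENNReal.ofReal (W * (8 * M / (c * ν h ^ 2))) * (∫⁻ z,
          ENNReal.ofReal |(law f).real (nball ν z (ν h)) - f z * (c * ν h ^ 2)| ∂(law f)) +
          ENNReal.ofReal (W * (C * (ν h + 1 / (N * ν h)))) := by
          rw [lintegral_add_right _ measurable_const, lintegral_const, measure_univ, mul_one,
            lintegral_const_mul _ (measurable_nball_dev hν hf.pdf _ _).ennreal_ofReal]
      _ ≤ ENNReal.ofReal (W * (8 * M / (c * ν h ^ 2))) *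
          (ENNReal.ofReal M * ENNReal.ofReal (2 * M * c * ν h ^ 3)) +
          ENNReal.ofReal (W * (C * (ν h + 1 / (N * ν h)))) := by
          gcongr
          exact (hf.lintegral_law_le _).trans (mul_le_mul_right (hf.lintegral_dev_le hν hn) _)
      _ = ENNReal.ofReal (W * (16 * M ^ 3 + C) * ν h) +
          ENNReal.ofReal (W * C / N) * ENNReal.ofReal (1 / ν h) := by
          rw [← ENNReal.ofReal_mul hM0.le, ← ENNReal.ofReal_mul (by positivity),
            ← ENNReal.ofReal_mul (by positivity), ← ENNReal.ofReal_add (by positivity)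
            (by positivity), ← ENNReal.ofReal_add (by positivity) (by positivity)]
          congr 1
          rcases hn.eq_or_lt with h0 | h0
          · rw [← h0]; simp
          · field_simp; ring
      _ ≤ _ := by gcongr
  refine (setLIntegral_mono' hBm point).trans ?_
  rw [lintegral_add_left measurable_const, setLIntegral_const, hν.volume_le a ha.le,
    lintegral_const_mul _ (by fun_prop)]
  refine (add_le_add le_rfl (mul_le_mul_right (hν.lintegral_one_div_le ha) _)).trans ?_
  rw [← ENNReal.ofReal_mul (by positivity), ← ENNReal.ofReal_mul (by positivity),
    ← ENNReal.ofReal_add (by positivity) (by positivity)]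
  apply ENNReal.ofReal_le_ofReal
  apply le_of_eq
  field_simp

/-- Bound for the bias of the estimator with `m + 3` samples, in terms of the threshold `a`. -/
def biasBound (c M : ℝ) (m q : ℕ) (a : ℝ) : ℝ :=
  12 * M ^ 3 * a * (|digamma (q + 1) + Real.log (m + 3) + Real.log (4 / c)| +
      2 * (Real.log (m + 3) + 1) + 3 * Real.log M) +
    (1 / (m + 2) + tailErr c M (digamma (q + 1)) a m q) +
    M * (((m : ℝ) + 3) ^ (q + 1) * (M * (c * a ^ 2)) ^ q * c *
      ((16 * M ^ 3 + 2 * (4 * (M ^ 2 * (1 + c)) + 4 * (q + 1) * M)) * a ^ 3 +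
        4 * (2 * (4 * (M ^ 2 * (1 + c)) + 4 * (q + 1) * M)) * (a / (m + 3))))

theorem tailErr_nonneg (hM : 1 ≤ M) (c κ a : ℝ) (m q : ℕ) : 0 ≤ tailErr c M κ a m q := by
  have l3 : 0 ≤ Real.log ((m : ℝ) + 3) := Real.log_nonneg (by
    have : (0 : ℝ) ≤ m := by positivity
    linarith)
  have l4 := Real.log_nonneg hM
  unfold tailErr
  positivity

/-- On the exceptional set only the trivial bound of order log N is used, which its mass O(a) can
afford; elsewhere `bias_le_of_good` applies. -/
theorem Regular.lintegral_bias_le (hf : Regular M f) (hν : PlaneNorm ν c)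
    (hG : LogLike G) (hq : q ≤ m) (hN : 2 * (q + 1) ≤ m + 3)
    (ha : 0 < a) (ha1 : a ≤ 1) (hCa : M ^ 2 * (1 + c) * a ≤ 1 / 2) :
    ∫⁻ z, ENNReal.ofReal |(∫ v : Fin (m + 2) → ℝ × ℝ, loc ν (q + 1) G
        (digamma (q + 1) + Real.log (m + 3) + Real.log (4 / c)) a Finset.univ v z
          ∂(Measure.pi fun _ => law f)) - pmi f z| ∂(law f) ≤
      ENNReal.ofReal (biasBound c M m q a) := by
  have hprob := hf.pdf.isProbabilityMeasure_law
  have hM := hf.one_le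
  have hM0 : 0 < M := zero_lt_one.trans_le hM
  have hc := hν.pos
  have l3 : 0 ≤ Real.log ((m : ℝ) + 3) := Real.log_nonneg (by
    have : (0 : ℝ) ≤ m := by positivity
    linarith)
  have l4 := Real.log_nonneg hM
  have htail := tailErr_nonneg hM c (digamma (q + 1)) a m q
  obtain ⟨Bad, hBad, hBadv, hgood⟩ := hf.exists_bad hν ha
  set κ := digamma (q + 1) + Real.log (m + 3) + Real.log (4 / c) with hκ
  set D : ℝ × ℝ → ℝ := fun z => |(∫ v : Fin (m + 2) → ℝ × ℝ, loc ν (q + 1) G κ a Finset.univ v z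
          ∂(Measure.pi fun _ => law f)) - pmi f z| with hD
  have b1 : ∫⁻ z in Bad, ENNReal.ofReal (D z) ∂(law f) ≤
      ENNReal.ofReal (12 * M ^ 3 * a * (|κ| + 2 * (Real.log (m + 3) + 1) + 3 * Real.log M)) := by
    have pt : ∀ᵐ z ∂(law f), ENNReal.ofReal (D z) ≤
        ENNReal.ofReal (|κ| + 2 * (Real.log (m + 3) + 1) + 3 * Real.log M) := by
      filter_upwards [hf.ae_densityBounds] with z hz
      apply ENNReal.ofReal_le_ofReal
      refine (abs_sub _ _).trans (add_le_add ?_ (hz.abs_pmi_le hM))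
      rw [← Real.norm_eq_abs]
      have h := norm_integral_le_of_norm_le_const (μ := Measure.pi fun _ : Fin (m + 2) => law f)
        (f := fun v => loc ν (q + 1) G κ a Finset.univ v z)
        (C := |κ| + 2 * (Real.log (m + 3) + 1))
        (Filter.Eventually.of_forall fun v => by
          have h := abs_loc_le (T := Finset.univ) (s := v) (z := z) (κ := κ) (a := a) (N := m + 3)
            (k := q + 1) hν hG (by omega) (by simp; omega) (by simp)
          rw [Real.norm_eq_abs]
          push_cast at h
          exact h)
      simpa using h
    calc _ ≤ ∫⁻ _ in Bad, ENNReal.ofReal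
            (|κ| + 2 * (Real.log (m + 3) + 1) + 3 * Real.log M) ∂(law f) :=
          lintegral_mono_ae (ae_restrict_of_ae pt)
      _ ≤ _ := by
          rw [setLIntegral_const, mul_comm (12 * M ^ 3 * a), ENNReal.ofReal_mul (by positivity)]
          gcongr
  have b2 : ∫⁻ z in Badᶜ, ENNReal.ofReal (D z) ∂(law f) ≤
      ENNReal.ofReal (1 / (m + 2) + tailErr c M (digamma (q + 1)) a m q) +
      ENNReal.ofReal M * ENNReal.ofReal (((m : ℝ) + 3) ^ (q + 1) * (M * (c * a ^ 2)) ^ q * c *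
      ((16 * M ^ 3 + 2 * (4 * (M ^ 2 * (1 + c)) + 4 * (q + 1) * M)) * a ^ 3 +
        4 * (2 * (4 * (M ^ 2 * (1 + c)) + 4 * (q + 1) * M)) * (a / (m + 3)))) := by
    refine (lintegral_mono_ae ((ae_restrict_iff' hBad.compl).2 (hgood.mono fun z hz hzb =>
      bias_le_of_good hf hν (hz hzb) hG hq hN ha ha1 hCa))).trans ?_
    refine (setLIntegral_le_lintegral _ _).trans ?_
    rw [lintegral_add_left measurable_const, lintegral_const, measure_univ, mul_one,
      lintegral_const_mul' _ _ ENNReal.ofReal_ne_top]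
    gcongr
    exact hf.lintegral_near_le hν ha (by positivity) (by positivity) (by positivity)
  rw [← lintegral_add_compl _ hBad]
  refine (add_le_add b1 b2).trans (le_of_eq ?_)
  rw [← ENNReal.ofReal_mul hM0.le, ← ENNReal.ofReal_add (by positivity) (by positivity),
    ← ENNReal.ofReal_add (by positivity) (by positivity), biasBound, ← hκ]
  exact congrArg _ (add_assoc _ _ _).symm

end IntegratedBias

/-! ### Mutual information as an expectation -/

section MutualInfo

variable {ν : ℝ × ℝ → ℝ} {c M a : ℝ} {f : ℝ × ℝ → ℝ} {G : ℕ → ℝ} {m q : ℕ}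

theorem integral_withDensity_ofReal {E : Type*} [MeasureSpace E] {g : E → ℝ} (hg : Measurable g)
    (h0 : ∀ z, 0 ≤ g z) (h : E → ℝ) :
    ∫ z, h z ∂((volume : Measure E).withDensity fun z => ENNReal.ofReal (g z)) =
      ∫ z, g z * h z := by
  rw [integral_withDensity_eq_integral_toReal_smul hg.ennreal_ofReal
    (Filter.Eventually.of_forall fun _ => ENNReal.ofReal_lt_top)]
  simp_rw [ENNReal.toReal_ofReal (h0 _), smul_eq_mul]

theorem IsPdf.integral_log (hf : IsPdf f) :
    ∫ z, Real.log (f z) ∂(law f) = -entropy f := by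
  rw [law, integral_withDensity_ofReal hf.measurable hf.nonneg, entropy, neg_neg]

theorem IsPdf.integral_log_margX (hf : IsPdf f) :
    ∫ z, Real.log (margX f z.1) ∂(law f) = -entropy (margX f) := by
  have hm := hf.measurable_margX
  have e : (law f).map Prod.fst = volume.withDensity fun x => ENNReal.ofReal (margX f x) := by
    ext A hA
    rw [Measure.map_apply measurable_fst hA, hf.law_fst hA, withDensity_apply _ hA]
  have h := integral_map (μ := law f) (φ := Prod.fst) measurable_fst.aemeasurable
    (f := fun x => Real.log (margX f x)) (Measurable.aestronglyMeasurable (by fun_prop))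
  rw [← h, e, integral_withDensity_ofReal hm hf.margX_nonneg, entropy, neg_neg]

theorem IsPdf.integral_log_margY (hf : IsPdf f) :
    ∫ z, Real.log (margY f z.2) ∂(law f) = -entropy (margY f) := by
  have hm := hf.measurable_margY
  have e : (law f).map Prod.snd = volume.withDensity fun x => ENNReal.ofReal (margY f x) := by
    ext A hA
    rw [Measure.map_apply measurable_snd hA, hf.law_snd hA, withDensity_apply _ hA]
  have h := integral_map (μ := law f) (φ := Prod.snd) measurable_snd.aemeasurable
    (f := fun x => Real.log (margY f x)) (Measurable.aestronglyMeasurable (by fun_prop))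
  rw [← h, e, integral_withDensity_ofReal hm hf.margY_nonneg, entropy, neg_neg]

theorem Regular.integrable_log (hf : Regular M f) {g : ℝ × ℝ → ℝ} (hg : Measurable g)
    (h : ∀ᵐ z ∂(law f), 1 / M ≤ g z ∧ g z ≤ M) :
    Integrable (fun z => Real.log (g z)) (law f) := by
  have hprob := hf.pdf.isProbabilityMeasure_law
  have h0 : 0 < 1 / M := by have := hf.one_le; positivity
  refine Integrable.of_bound (Measurable.aestronglyMeasurable (by fun_prop)) (Real.log M) ?_
  filter_upwards [h] with z hz
  rw [Real.norm_eq_abs, abs_le, ← Real.log_inv, ← one_div]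
  exact ⟨Real.log_le_log h0 hz.1, Real.log_le_log (h0.trans_le hz.1) hz.2⟩

/-- The joint and marginal densities are pinched between 1/M and M almost surely, so the three
logarithms are bounded and the expectation splits into entropies. -/
theorem Regular.integrable_pmi (hf : Regular M f) :
    Integrable (pmi f) (law f) ∧ ∫ z, pmi f z ∂(law f) = mutualInfo f := by
  have hpos : 0 < 1 / M := by have := hf.one_le; positivity
  have hX : Measurable fun z : ℝ × ℝ => margX f z.1 := hf.pdf.measurable_margX.comp measurable_fst
  have hY : Measurable fun z : ℝ × ℝ => margY f z.2 := hf.pdf.measurable_margY.comp measurable_snd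
  have hb := hf.ae_densityBounds
  have i1 := hf.integrable_log hf.pdf.measurable (hb.mono fun z hz => ⟨hz.lower, hz.upper⟩)
  have i2 := hf.integrable_log hX (hb.mono fun z hz => ⟨hz.lowerX, hz.upperX⟩)
  have i3 := hf.integrable_log hY (hb.mono fun z hz => ⟨hz.lowerY, hz.upperY⟩)
  have e : (fun z => Real.log (f z) - Real.log (margX f z.1) - Real.log (margY f z.2))
      =ᵐ[law f] pmi f := by
    filter_upwards [hb] with z hz
    have h1 := (hpos.trans_le hz.lowerX).ne'
    have h2 := (hpos.trans_le hz.lowerY).ne'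
    rw [pmi, Real.log_div (hpos.trans_le hz.lower).ne' (mul_ne_zero h1 h2), Real.log_mul h1 h2]
    ring
  have i12 : Integrable (fun z => Real.log (f z) - Real.log (margX f z.1)) (law f) := i1.sub i2
  refine ⟨(i12.sub i3).congr e, ?_⟩
  rw [← integral_congr_ae e, integral_sub i12 i3, integral_sub i1 i2, hf.pdf.integral_log,
    hf.pdf.integral_log_margX, hf.pdf.integral_log_margY, mutualInfo]
  ring

theorem Regular.integrable_integral_loc (hf : Regular M f) (hν : PlaneNorm ν c) (hG : LogLike G)
    {κ : ℝ} {k n : ℕ} (hk : 1 ≤ k) (hkn : k ≤ n) :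
    Integrable (fun z => ∫ v : Fin n → ℝ × ℝ, loc ν k G κ a Finset.univ v z
      ∂(Measure.pi fun _ => law f)) (law f) := by
  have hprob := hf.pdf.isProbabilityMeasure_law
  have hm : Measurable fun p : (ℝ × ℝ) × (Fin n → ℝ × ℝ) => loc ν k G κ a Finset.univ p.2 p.1 :=
    measurable_loc hν hk (by simpa using hkn)
      (fun l => (measurable_pi_apply l).comp measurable_snd) measurable_fst
  refine Integrable.integral_prod_left (f := fun p : (ℝ × ℝ) × (Fin n → ℝ × ℝ) =>
    loc ν k G κ a Finset.univ p.2 p.1) ?_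
  exact integrable_of_abs_le hm (B := |κ| + 2 * (Real.log n + 1)) fun p =>
    abs_loc_le hν hG hk (by simpa using hkn) (by simp)

theorem Regular.abs_bias_le (hf : Regular M f) (hν : PlaneNorm ν c)
    (hG : LogLike G) (hq : q ≤ m) (hN : 2 * (q + 1) ≤ m + 3)
    (ha : 0 < a) (ha1 : a ≤ 1) (hCa : M ^ 2 * (1 + c) * a ≤ 1 / 2) :
    |(∫ z, (∫ v : Fin (m + 2) → ℝ × ℝ, loc ν (q + 1) G
        (digamma (q + 1) + Real.log (m + 3) + Real.log (4 / c)) a Finset.univ v z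
          ∂(Measure.pi fun _ => law f)) ∂(law f)) - mutualInfo f| ≤ biasBound c M m q a := by
  obtain ⟨ip, ep⟩ := hf.integrable_pmi
  have il := hf.integrable_integral_loc (a := a) (k := q + 1) (n := m + 2)
    (κ := digamma (q + 1) + Real.log (m + 3) + Real.log (4 / c)) hν hG (by omega) (by omega)
  have hB : 0 ≤ biasBound c M m q a := by
    have hM := hf.one_le
    have hc := hν.pos
    have l3 : 0 ≤ Real.log ((m : ℝ) + 3) := Real.log_nonneg (by
      have : (0 : ℝ) ≤ m := by positivity
      linarith)
    have l4 := Real.log_nonneg hM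
    have htail := tailErr_nonneg hM c (digamma (q + 1)) a m q
    unfold biasBound
    positivity
  rw [← ep, ← integral_sub il ip, ← ENNReal.ofReal_le_ofReal_iff hB, ← Real.enorm_eq_ofReal_abs]
  refine (enorm_integral_le_lintegral_enorm _).trans (le_trans (le_of_eq ?_)
    (hf.lintegral_bias_le hν hG hq hN ha ha1 hCa))
  exact lintegral_congr fun z => Real.enorm_eq_ofReal_abs _

end MutualInfo

/-! ### Mean squared error over a product measure -/

/-- The average of the local estimates. -/
def average (ν : ℝ × ℝ → ℝ) (k : ℕ) (G : ℕ → ℝ) (κ a : ℝ) {N : ℕ} (s : Fin N → ℝ × ℝ) : ℝ :=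
  (1 / (N : ℝ)) * ∑ i, loc ν k G κ a (Finset.univ.erase i) s (s i)

section Average

variable {ν : ℝ × ℝ → ℝ} {c M a κ : ℝ} {f : ℝ × ℝ → ℝ} {G : ℕ → ℝ} {k m q N : ℕ}

theorem measurable_loc_erase (hν : PlaneNorm ν c) (hk : 1 ≤ k) (hkN : k + 1 ≤ N) (i : Fin N) :
    Measurable fun s : Fin N → ℝ × ℝ => loc ν k G κ a (Finset.univ.erase i) s (s i) :=
  measurable_loc hν hk (by rw [Finset.card_erase_of_mem (Finset.mem_univ _)]; simp; omega)
    (fun l => measurable_pi_apply l) (measurable_pi_apply i)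

theorem abs_loc_erase_le (hν : PlaneNorm ν c) (hG : LogLike G) (hk : 1 ≤ k) (hkN : k + 1 ≤ N)
    (s : Fin N → ℝ × ℝ) (i : Fin N) :
    |loc ν k G κ a (Finset.univ.erase i) s (s i)| ≤ |κ| + 2 * (Real.log N + 1) := by
  have hc : (Finset.univ.erase i).card = N - 1 := by
    rw [Finset.card_erase_of_mem (Finset.mem_univ _)]; simp
  exact abs_loc_le hν hG hk (by omega) (by omega)

theorem measurable_average (hν : PlaneNorm ν c) (hk : 1 ≤ k) (hkN : k + 1 ≤ N) :
    Measurable fun s : Fin N → ℝ × ℝ => average ν k G κ a s :=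
  (Finset.measurable_sum _ fun i _ => measurable_loc_erase hν hk hkN i).const_mul _

theorem abs_average_le (hν : PlaneNorm ν c) (hG : LogLike G) (hk : 1 ≤ k) (hkN : k + 1 ≤ N)
    (s : Fin N → ℝ × ℝ) : |average ν k G κ a s| ≤ |κ| + 2 * (Real.log N + 1) := by
  have hN : (0 : ℝ) < N := by exact_mod_cast (by omega : 0 < N)
  rw [average, abs_mul, abs_of_pos (by positivity)]
  calc 1 / (N : ℝ) * |∑ i, loc ν k G κ a (Finset.univ.erase i) s (s i)|
      ≤ 1 / (N : ℝ) * ∑ _i : Fin N, (|κ| + 2 * (Real.log N + 1)) := by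
        gcongr
        exact (Finset.abs_sum_le_sum_abs _ _).trans
          (Finset.sum_le_sum fun i _ => abs_loc_erase_le hν hG hk hkN s i)
    _ = _ := by
        rw [Finset.sum_const, Finset.card_univ, Fintype.card_fin, nsmul_eq_mul]
        field_simp

/-- Splitting off coordinate i turns each summand into the same iterated integral, with the other
coordinates re-indexed. -/
theorem integral_average (hν : PlaneNorm ν c) (hG : LogLike G) (μ : Measure (ℝ × ℝ))
    [IsProbabilityMeasure μ] {n : ℕ} (hk : 1 ≤ k) (hkn : k ≤ n) :
    ∫ s : Fin (n + 1) → ℝ × ℝ, average ν k G κ a s ∂(Measure.pi fun _ => μ) =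
      ∫ z, (∫ v : Fin n → ℝ × ℝ, loc ν k G κ a Finset.univ v z ∂(Measure.pi fun _ => μ)) ∂μ := by
  have hi : ∀ i : Fin (n + 1), Integrable (fun s : Fin (n + 1) → ℝ × ℝ =>
      loc ν k G κ a (Finset.univ.erase i) s (s i)) (Measure.pi fun _ => μ) := fun i =>
    integrable_of_abs_le (measurable_loc_erase hν hk (by omega) i)
      fun s => abs_loc_erase_le hν hG hk (by omega) s i
  have hE : ∀ i : Fin (n + 1), ∫ s : Fin (n + 1) → ℝ × ℝ,
      loc ν k G κ a (Finset.univ.erase i) s (s i) ∂(Measure.pi fun _ => μ) =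
      ∫ z, (∫ v : Fin n → ℝ × ℝ, loc ν k G κ a Finset.univ v z ∂(Measure.pi fun _ => μ)) ∂μ := by
    intro i
    rw [integral_pi_insertNth μ i (hi i)]
    refine integral_congr_ae (Filter.Eventually.of_forall fun z => ?_)
    refine integral_congr_ae (Filter.Eventually.of_forall fun v => ?_)
    have e : (Finset.univ.erase i : Finset (Fin (n + 1))) =
        Finset.univ.map (Fin.succAboveEmb i) := by
      ext j
      simp only [Finset.mem_erase, Finset.mem_univ, and_true, Finset.mem_map, true_and,
        Fin.succAboveEmb_apply]
      exact ⟨fun h => Fin.exists_succAbove_eq h, fun ⟨l, hl⟩ => hl ▸ Fin.succAbove_ne i l⟩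
    have e2 : (Fin.insertNth i z v : Fin (n + 1) → ℝ × ℝ) ∘ (Fin.succAboveEmb i) = v := by
      ext1 l
      simp
    simp only
    rw [e, loc_map, e2, Fin.insertNth_apply_same]
  unfold average
  rw [integral_const_mul, integral_finsetSum _ fun i _ => hi i]
  simp_rw [hE]
  rw [Finset.sum_const, Finset.card_univ, Fintype.card_fin, nsmul_eq_mul]
  have : ((n + 1 : ℕ) : ℝ) ≠ 0 := by positivity
  field_simp

theorem variance_average_le (hν : PlaneNorm ν c) (hG : LogLike G) (μ : Measure (ℝ × ℝ))
    [IsProbabilityMeasure μ] (hk : 1 ≤ k) (hkN : k + 2 ≤ N) :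
    ∫ s : Fin N → ℝ × ℝ, (average ν k G κ a s -
        ∫ t : Fin N → ℝ × ℝ, average ν k G κ a t ∂(Measure.pi fun _ => μ)) ^ 2
        ∂(Measure.pi fun _ => μ) ≤
      ((32 * k + 2) * (|κ| + 2 * (Real.log N + 1)) + 16 * (1 + Real.log N)) ^ 2 / N := by
  have hN : (0 : ℝ) < N := by exact_mod_cast (by omega : 0 < N)
  refine (variance_le_of_bounded_differences μ N (fun s => average ν k G κ a s)
    (measurable_average hν hk (by omega)) (fun s => abs_average_le hν hG hk (by omega) s)
    (d := 1 / N * ((32 * k + 2) * (|κ| + 2 * (Real.log N + 1)) + 16 * (1 + Real.log N)))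
    fun s s' j hs => ?_).trans (le_of_eq ?_)
  · rw [average, average, ← mul_sub, abs_mul, abs_of_pos (by positivity)]
    exact mul_le_mul_of_nonneg_left
      (abs_sum_loc_sub_le hν hG hk (Fintype.card_fin N) hkN s s' j hs) (by positivity)
  · field_simp

/-- Bound for the effect of one sample point on the sum of the local estimates. -/
def diffBound (c : ℝ) (q : ℕ) (l : ℝ) : ℝ :=
  (32 * (q + 1) + 2) * (|digamma (q + 1) + l + Real.log (4 / c)| + 2 * (l + 1)) + 16 * (1 + l)

theorem Regular.mse_le (hf : Regular M f) (hν : PlaneNorm ν c)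
    (hG : LogLike G) (hq : q ≤ m) (hN : 2 * (q + 1) ≤ m + 3)
    (ha : 0 < a) (ha1 : a ≤ 1) (hCa : M ^ 2 * (1 + c) * a ≤ 1 / 2) :
    ∫ s : Fin (m + 3) → ℝ × ℝ, (average ν (q + 1) G
        (digamma (q + 1) + Real.log (m + 3) + Real.log (4 / c)) a s - mutualInfo f) ^ 2
        ∂(Measure.pi fun _ => law f) ≤
      diffBound c q (Real.log (m + 3)) ^ 2 / (m + 3) + biasBound c M m q a ^ 2 := by
  have hprob := hf.pdf.isProbabilityMeasure_law
  rw [integral_sq_sub (measurable_average hν (by omega) (by omega))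
    (fun s => abs_average_le hν hG (by omega) (by omega) s)]
  refine add_le_add ?_ ?_
  · have h := variance_average_le (N := m + 3) (k := q + 1) (a := a)
      (κ := digamma (q + 1) + Real.log (m + 3) + Real.log (4 / c)) hν hG (law f) (by omega)
      (by omega)
    push_cast at h
    exact h
  · rw [integral_average (n := m + 2) hν hG (law f) (by omega) (by omega)]
    exact sq_le_sq' (by linarith [(abs_le.1 (hf.abs_bias_le hν hG hq hN ha ha1 hCa)).1])
      (abs_le.1 (hf.abs_bias_le hν hG hq hN ha ha1 hCa)).2

end Average

/-! ### Asymptotics of the error bounds -/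

section Rate

variable {c M δ : ℝ}

theorem pow_mul_exp_neg_le {N x : ℝ} {q : ℕ} (hN : 0 < N) (hx : (q + 2) * Real.log N ≤ x) :
    N ^ (q + 1) * Real.exp (-x) ≤ 1 / N := by
  have h1 : Real.exp (-x) ≤ (N ^ (q + 2))⁻¹ := by
    rw [← Real.exp_log (pow_pos hN (q + 2)), ← Real.exp_neg, Real.log_pow]
    apply Real.exp_le_exp.2
    push_cast
    linarith
  calc N ^ (q + 1) * Real.exp (-x) ≤ N ^ (q + 1) * (N ^ (q + 2))⁻¹ := by gcongr
    _ = 1 / N := by field_simp; ring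

/-- Since N a² = t and m + 1 - q ≥ (m + 3)/2, the exponent is at least (q + 2) log N, which beats
N^(q+1) and leaves 1/N for the logarithmic factor. -/
theorem tailErr_le (hc : 0 < c) (hM : 1 ≤ M) (κ : ℝ) {m q : ℕ} {t a : ℝ}
    (hl1 : 1 ≤ Real.log (m + 3)) (hlt : Real.log (m + 3) ≤ t)
    (ha2 : a ^ 2 = t / (m + 3)) (hm : 2 * q + 4 ≤ m + 3)
    (ht : (q + 2) * Real.log (m + 3) ≤ c * t / (16 * M)) :
    tailErr c M κ a m q ≤ (|κ| + |Real.log (c / (8 * M))| + 3 * Real.log M + 3) * (t / (m + 3)) := by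
  have hM0 : 0 < M := zero_lt_one.trans_le hM
  have hl4 := Real.log_nonneg hM
  have ht1 : 1 ≤ t := hl1.trans hlt
  have ht0 : 0 < t := zero_lt_one.trans_le ht1
  have hN0 : (0 : ℝ) < m + 3 := by positivity
  have hmR : (2 : ℝ) * q + 4 ≤ m + 3 := by exact_mod_cast hm
  have h1 : (q + 2) * Real.log (m + 3) ≤ c * a ^ 2 / (8 * M) * (m + 1 - q) := by
    refine ht.trans ?_
    have : c * t / (16 * M) = c * a ^ 2 / (8 * M) * ((m + 3) / 2) := by
      rw [ha2]; field_simp; ring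
    rw [this]
    gcongr
    linarith
  have h2 := pow_mul_exp_neg_le (q := q) hN0 h1
  have h3 : |Real.log (c * a ^ 2 / (8 * M))| ≤ |Real.log (c / (8 * M))| + 2 * t := by
    have e : c * a ^ 2 / (8 * M) = c / (8 * M) * (t / (m + 3)) := by rw [ha2]; ring
    rw [e, Real.log_mul (by positivity) (by positivity), Real.log_div ht0.ne' hN0.ne']
    have t1 := Real.log_nonneg ht1
    have t2 := Real.log_le_sub_one_of_pos ht0
    have t3 := abs_add_le (Real.log (c / (8 * M))) (Real.log t - Real.log (m + 3))
    have t4 : |Real.log t - Real.log (m + 3)| ≤ 2 * t := by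
      rw [abs_le]; constructor <;> linarith
    linarith
  unfold tailErr
  calc _ ≤ 1 / ((m : ℝ) + 3) * (|κ| * t + t + (|Real.log (c / (8 * M))| * t + 2 * t) +
        3 * Real.log M * t) := by
        refine mul_le_mul h2 ?_ (by positivity) (by positivity)
        have k1 : |κ| ≤ |κ| * t := le_mul_of_one_le_right (abs_nonneg _) ht1
        have k2 : |Real.log (c / (8 * M))| ≤ |Real.log (c / (8 * M))| * t :=
          le_mul_of_one_le_right (abs_nonneg _) ht1
        have k3 : 3 * Real.log M ≤ 3 * Real.log M * t := le_mul_of_one_le_right (by positivity) ht1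
        linarith
    _ = _ := by ring

/-- Every term is dominated by t^(q+2)/√N. The largest is the local error N^(q+1) a^(2q) a³ =
t^(q+1) a; the exceptional set contributes a log N. -/
theorem biasBound_le (hc : 0 < c) (hM : 1 ≤ M) (q : ℕ) : ∃ C : ℝ, 0 ≤ C ∧ ∀ (m : ℕ) (t a : ℝ),
    1 ≤ Real.log (m + 3) → Real.log (m + 3) ≤ t → 0 < a → a ^ 2 = t / (m + 3) →
    2 * q + 4 ≤ m + 3 → (q + 2) * Real.log (m + 3) ≤ c * t / (16 * M) →
    biasBound c M m q a ≤ C * (t ^ (q + 2) / √(m + 3)) := by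
  have hM0 : 0 < M := zero_lt_one.trans_le hM
  have hl4 := Real.log_nonneg hM
  set A0 := |digamma (q + 1)| with hA0
  set A1 := |Real.log (4 / c)| with hA1
  set A3 := |Real.log (c / (8 * M))| with hA3
  set C' := 2 * (4 * (M ^ 2 * (1 + c)) + 4 * (q + 1) * M) with hC'
  have hC'0 : 0 ≤ C' := by positivity
  refine ⟨12 * M ^ 3 * (A0 + A1 + 5 + 3 * Real.log M) + (2 + (A0 + A3 + 3 * Real.log M + 3)) +
    M * ((M * c) ^ q * c * (16 * M ^ 3 + C' + 4 * C')), by positivity, ?_⟩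
  intro m t a hl1 hlt ha ha2 hm ht
  have ht1 : 1 ≤ t := hl1.trans hlt
  have ht0 : 0 < t := zero_lt_one.trans_le ht1
  have hN0 : (0 : ℝ) < m + 3 := by positivity
  set s := √((m : ℝ) + 3) with hs
  have hs2 : s ^ 2 = m + 3 := Real.sq_sqrt hN0.le
  have hs1 : 1 ≤ s := Real.one_le_sqrt.2 (by have : (0 : ℝ) ≤ m := by positivity
                                             linarith)
  have hs0 : 0 < s := zero_lt_one.trans_le hs1
  set b := t ^ (q + 2) / s with hb
  -- The exact value is √(t/N); since t ≥ 1 it is rounded up to t/√N to keep integer powers.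
  have hat : a ≤ t / s := by
    refine le_of_sq_le_sq ?_ (by positivity)
    rw [ha2, div_pow, hs2]
    gcongr
    nlinarith
  have hqt : 1 ≤ t ^ q := one_le_pow₀ ht1
  have F1 : a * t ≤ b := by
    calc a * t ≤ t / s * t := by gcongr
      _ = 1 * t ^ 2 / s := by ring
      _ ≤ t ^ q * t ^ 2 / s := by gcongr
      _ = b := by rw [hb]; ring
  have F0 : t / (m + 3) ≤ b := by
    rw [← hs2]
    calc t / s ^ 2 ≤ t / s := by
          gcongr
          nlinarith
      _ = 1 * 1 * t / s := by ring
      _ ≤ t ^ q * t * t / s := by gcongr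
      _ = b := by rw [hb]; ring
  have F2 : 1 / ((m : ℝ) + 2) ≤ 2 * b := by
    have : 1 / ((m : ℝ) + 2) ≤ 2 * (1 / (m + 3)) := by
      rw [mul_one_div, div_le_div_iff₀ (by positivity) hN0]
      have : (0 : ℝ) ≤ m := by positivity
      linarith
    refine this.trans ?_
    gcongr
    exact le_trans (by gcongr) F0
  have F3 : tailErr c M (digamma (q + 1)) a m q ≤ (A0 + A3 + 3 * Real.log M + 3) * b :=
    (tailErr_le hc hM _ hl1 hlt ha2 hm ht).trans (by gcongr)
  have F4 : t ^ q * (a * t) ≤ b := by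
    calc t ^ q * (a * t) ≤ t ^ q * (t / s * t) := by gcongr
      _ = b := by rw [hb]; ring
  have G1 : 12 * M ^ 3 * a * (|digamma (q + 1) + Real.log (m + 3) + Real.log (4 / c)| +
      2 * (Real.log (m + 3) + 1) + 3 * Real.log M) ≤
      12 * M ^ 3 * (A0 + A1 + 5 + 3 * Real.log M) * b := by
    have k0 : |digamma (q + 1) + Real.log (m + 3) + Real.log (4 / c)| ≤ A0 + t + A1 := by
      refine (abs_add_le _ _).trans (add_le_add ((abs_add_le _ _).trans (add_le_add le_rfl ?_))
        le_rfl)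
      rw [abs_of_nonneg (by linarith)]
      exact hlt
    have k1 : A0 ≤ A0 * t := le_mul_of_one_le_right (abs_nonneg _) ht1
    have k2 : A1 ≤ A1 * t := le_mul_of_one_le_right (abs_nonneg _) ht1
    have k3 : 3 * Real.log M ≤ 3 * Real.log M * t := le_mul_of_one_le_right (by positivity) ht1
    calc _ ≤ 12 * M ^ 3 * a * (A0 * t + t + A1 * t + 4 * t + 3 * Real.log M * t) :=
          mul_le_mul_of_nonneg_left (by linarith) (by positivity)
      _ = 12 * M ^ 3 * (A0 + A1 + 5 + 3 * Real.log M) * (a * t) := by ring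
      _ ≤ _ := by gcongr
  have G3 : M * (((m : ℝ) + 3) ^ (q + 1) * (M * (c * a ^ 2)) ^ q * c *
      ((16 * M ^ 3 + C') * a ^ 3 + 4 * C' * (a / (m + 3)))) ≤
      M * ((M * c) ^ q * c * (16 * M ^ 3 + C' + 4 * C')) * b := by
    have e : M * (((m : ℝ) + 3) ^ (q + 1) * (M * (c * a ^ 2)) ^ q * c *
      ((16 * M ^ 3 + C') * a ^ 3 + 4 * C' * (a / (m + 3)))) =
      M * ((M * c) ^ q * c * (t ^ q * ((16 * M ^ 3 + C') * (a * t) + 4 * C' * a))) := by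
      have e1 : a ^ 3 = t / (m + 3) * a := by rw [← ha2]; ring
      rw [e1, ha2, pow_succ, mul_pow M, mul_pow c, div_pow, mul_pow M c]
      field_simp
    rw [e]
    calc _ ≤ M * ((M * c) ^ q * c * (t ^ q * ((16 * M ^ 3 + C') * (a * t) + 4 * C' * (a * t)))) := by
          gcongr
          exact le_mul_of_one_le_right ha.le ht1
      _ = M * ((M * c) ^ q * c * (16 * M ^ 3 + C' + 4 * C')) * (t ^ q * (a * t)) := by ring
      _ ≤ _ := by gcongr
  unfold biasBound
  calc _ ≤ 12 * M ^ 3 * (A0 + A1 + 5 + 3 * Real.log M) * b +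
        (2 * b + (A0 + A3 + 3 * Real.log M + 3) * b) +
        M * ((M * c) ^ q * c * (16 * M ^ 3 + C' + 4 * C')) * b :=
        add_le_add (add_le_add G1 (add_le_add F2 F3)) G3
    _ = _ := by ring

theorem biasBound_nonneg (hc : 0 < c) (hM : 1 ≤ M) (m q : ℕ) {a : ℝ} (ha : 0 < a) :
    0 ≤ biasBound c M m q a := by
  have l3 : 0 ≤ Real.log ((m : ℝ) + 3) := Real.log_nonneg (by
    have : (0 : ℝ) ≤ m := by positivity
    linarith)
  have l4 := Real.log_nonneg hM
  have htail := tailErr_nonneg hM c (digamma (q + 1)) a m q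
  unfold biasBound
  positivity

theorem diffBound_le (c : ℝ) (q : ℕ) {l t : ℝ} (hl : 1 ≤ l) (hlt : l ≤ t) :
    diffBound c q l ≤
      ((32 * (q + 1) + 2) * (|digamma (q + 1)| + |Real.log (4 / c)| + 5) + 32) * t := by
  have ht1 : 1 ≤ t := hl.trans hlt
  have k0 : |digamma (q + 1) + l + Real.log (4 / c)| ≤
      |digamma (q + 1)| + t + |Real.log (4 / c)| := by
    refine (abs_add_le _ _).trans (add_le_add ((abs_add_le _ _).trans (add_le_add le_rfl ?_))
      le_rfl)
    rw [abs_of_nonneg (by linarith)]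
    exact hlt
  have k1 : |digamma (q + 1)| ≤ |digamma (q + 1)| * t := le_mul_of_one_le_right (abs_nonneg _) ht1
  have k2 : |Real.log (4 / c)| ≤ |Real.log (4 / c)| * t :=
    le_mul_of_one_le_right (abs_nonneg _) ht1
  unfold diffBound
  calc _ ≤ (32 * (q + 1) + 2) * (|digamma (q + 1)| * t + |Real.log (4 / c)| * t + 5 * t) +
        32 * t :=
        add_le_add (mul_le_mul_of_nonneg_left (by linarith) (by positivity)) (by linarith)
    _ = _ := by ring

theorem diffBound_nonneg (c : ℝ) (q : ℕ) {l : ℝ} (hl : 1 ≤ l) : 0 ≤ diffBound c q l := by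
  unfold diffBound
  positivity

theorem threshold_sq (δ : ℝ) {N : ℕ} (hN : 1 ≤ N) :
    threshold δ N ^ 2 = Real.log N ^ (1 + δ) / N := by
  have h0 : 0 ≤ Real.log N ^ (1 + δ) / N := by
    have := Real.log_natCast_nonneg N
    positivity
  rw [threshold, show (1 : ℝ) / (1 + 1) = 1 / 2 by norm_num, ← Real.sqrt_eq_rpow, Real.sq_sqrt h0]

/-- Strict positivity of δ makes (log N)^(1+δ) exceed any fixed multiple of log N, which is what the
truncation tail requires. -/
theorem eventually_threshold (hδ : 0 < δ) (q : ℕ) (A ε : ℝ) (hε : 0 < ε) :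
    ∃ N₀ : ℕ, ∀ N : ℕ, N₀ ≤ N → 2 * q + 4 ≤ N ∧ 1 ≤ Real.log N ∧
      A * Real.log N ≤ Real.log N ^ (1 + δ) ∧ 0 < threshold δ N ∧ threshold δ N ≤ ε := by
  have hlog : Filter.Tendsto (fun N : ℕ => Real.log N) Filter.atTop Filter.atTop :=
    Real.tendsto_log_atTop.comp tendsto_natCast_atTop_atTop
  have h1 : ∀ᶠ N : ℕ in Filter.atTop, A ≤ Real.log N ^ δ :=
    ((tendsto_rpow_atTop hδ).comp hlog).eventually_ge_atTop A
  have h2 : ∀ᶠ N : ℕ in Filter.atTop, ‖Real.log N ^ (1 + δ)‖ ≤ ε ^ 2 * ‖(N : ℝ) ^ (1 : ℝ)‖ :=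
    tendsto_natCast_atTop_atTop.eventually
      ((isLittleO_log_rpow_rpow_atTop (1 + δ) zero_lt_one).bound (by positivity : 0 < ε ^ 2))
  obtain ⟨N₀, h⟩ := Filter.eventually_atTop.1 (h1.and (h2.and ((hlog.eventually_ge_atTop 1).and
    (Filter.eventually_ge_atTop (2 * q + 4)))))
  refine ⟨N₀, fun N hN => ?_⟩
  obtain ⟨g1, g2, g3, g4⟩ := h N hN
  have hl0 : 0 < Real.log N := zero_lt_one.trans_le g3
  have hN0 : (0 : ℝ) < N := by exact_mod_cast (by omega : 0 < N)
  refine ⟨g4, g3, ?_, ?_, ?_⟩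
  · rw [Real.rpow_add hl0, Real.rpow_one, mul_comm]
    gcongr
  · unfold threshold
    positivity
  · refine le_of_sq_le_sq ?_ hε.le
    rw [threshold_sq δ (by omega), div_le_iff₀ hN0]
    rwa [Real.rpow_one, Real.norm_of_nonneg (by positivity), Real.norm_of_nonneg hN0.le] at g2

theorem exists_rate (hc : 0 < c) (hM : 1 ≤ M) (hδ : 0 < δ) (q : ℕ) :
    ∃ (K : ℝ) (N₀ : ℕ), ∀ m : ℕ, N₀ ≤ m + 3 → q ≤ m ∧ 2 * (q + 1) ≤ m + 3 ∧
      0 < threshold δ (m + 3) ∧ threshold δ (m + 3) ≤ 1 ∧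
      M ^ 2 * (1 + c) * threshold δ (m + 3) ≤ 1 / 2 ∧
      diffBound c q (Real.log (m + 3)) ^ 2 / (m + 3) + biasBound c M m q (threshold δ (m + 3)) ^ 2 ≤
        K * (Real.log (m + 3) ^ ((2 * ((q : ℝ) + 1) + 2) * (1 + δ)) / (m + 3)) := by
  have hM0 : 0 < M := zero_lt_one.trans_le hM
  obtain ⟨C, hC0, hC⟩ := biasBound_le hc hM q
  -- The multiple of log N is the one demanded by `tailErr_le`; the bound on the threshold makes
  -- strip and ball masses small enough for the relative error estimates.
  obtain ⟨N₀, hN₀⟩ := eventually_threshold hδ q ((q + 2) * (16 * M / c))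
    (min 1 (1 / 2 / (M ^ 2 * (1 + c)))) (by positivity)
  set E := (32 * (q + 1) + 2) * (|digamma (q + 1)| + |Real.log (4 / c)| + 5) + 32 with hE
  refine ⟨E ^ 2 + C ^ 2, N₀, fun m hm => ?_⟩
  obtain ⟨g1, g2, g3, g4, g5⟩ := hN₀ (m + 3) hm
  have hsq := threshold_sq δ (N := m + 3) (by omega)
  push_cast at g2 g3 hsq
  set a := threshold δ (m + 3) with ha
  set l := Real.log ((m : ℝ) + 3) with hl
  have hl0 : 0 < l := zero_lt_one.trans_le g2
  set t := l ^ (1 + δ) with ht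
  have hlt : l ≤ t := by
    calc l = l ^ (1 : ℝ) := (Real.rpow_one l).symm
      _ ≤ t := Real.rpow_le_rpow_of_exponent_le g2 (by linarith)
  have ht1 : 1 ≤ t := g2.trans hlt
  have ht0 : 0 < t := zero_lt_one.trans_le ht1
  have hN0 : (0 : ℝ) < m + 3 := by positivity
  -- With k = q + 1 the squared bias t^(2(q+2))/N has exponent 2k + 2, and it dominates the variance
  -- term t²/N.
  have hpow : l ^ ((2 * ((q : ℝ) + 1) + 2) * (1 + δ)) = t ^ (2 * (q + 2)) := by
    rw [ht, ← Real.rpow_natCast, ← Real.rpow_mul hl0.le]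
    congr 1
    push_cast; ring
  refine ⟨by omega, by omega, g4, g5.trans (min_le_left _ _), ?_, ?_⟩
  · have := g5.trans (min_le_right _ _)
    rwa [le_div_iff₀ (by positivity), mul_comm] at this
  · have hb := hC m t a g2 hlt g4 hsq g1 (by
      rw [le_div_iff₀ (by positivity)]
      calc (q + 2) * l * (16 * M) = (q + 2) * (16 * M / c) * l * c := by field_simp
        _ ≤ t * c := by gcongr
        _ = c * t := mul_comm _ _)
    have hb0 := biasBound_nonneg hc hM m q g4
    have hd := diffBound_le c q g2 hlt
    have hd0 := diffBound_nonneg c q g2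
    rw [hpow]
    calc diffBound c q l ^ 2 / (m + 3) + biasBound c M m q a ^ 2
        ≤ (E * t) ^ 2 / (m + 3) + (C * (t ^ (q + 2) / √(m + 3))) ^ 2 := by gcongr
      _ = E ^ 2 * (t ^ 2 / (m + 3)) + C ^ 2 * (t ^ (2 * (q + 2)) / (m + 3)) := by
        rw [mul_pow, mul_pow, div_pow, Real.sq_sqrt hN0.le]; ring
      _ ≤ E ^ 2 * (t ^ (2 * (q + 2)) / (m + 3)) + C ^ 2 * (t ^ (2 * (q + 2)) / (m + 3)) := by
        have : t ^ 2 ≤ t ^ (2 * (q + 2)) := pow_le_pow_right₀ ht1 (by omega)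
        gcongr
      _ = _ := by ring

end Rate

/-! ### The estimators of the theorem -/

section Estimators

variable {ν : ℝ × ℝ → ℝ} {c M δ : ℝ} {f : ℝ × ℝ → ℝ} {k N : ℕ} {p : ℝ≥0∞}

theorem ncard_eq_card_filter_erase {N : ℕ} (i : Fin N) (φ : Fin N → Prop) [DecidablePred φ] :
    Set.ncard {j : Fin N | j ≠ i ∧ φ j} = ((Finset.univ.erase i).filter φ).card := by
  rw [← Set.ncard_coe_finset]
  congr 1
  ext j
  simp

theorem knnDist_eq_kRad (hp : ∀ z w, lpDist p z w = ν (z - w)) (s : Fin N → ℝ × ℝ) (i : Fin N) :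
    knnDist p k s i = kRad ν k (Finset.univ.erase i) s (s i) := by
  unfold knnDist kRad
  simp_rw [hp]
  congr 1
  ext r
  rw [Set.mem_ofPred_eq, Set.mem_ofPred_eq, ncard_eq_card_filter_erase]

theorem countX_eq_cntX (hp : ∀ z w, lpDist p z w = ν (z - w)) (s : Fin N → ℝ × ℝ) (i : Fin N) :
    countX p k s i = cntX (Finset.univ.erase i) s (s i)
      (kRad ν k (Finset.univ.erase i) s (s i)) := by
  rw [countX, knnDist_eq_kRad hp, ncard_eq_card_filter_erase, cntX]

theorem countY_eq_cntY (hp : ∀ z w, lpDist p z w = ν (z - w)) (s : Fin N → ℝ × ℝ) (i : Fin N) :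
    countY p k s i = cntY (Finset.univ.erase i) s (s i)
      (kRad ν k (Finset.univ.erase i) s (s i)) := by
  rw [countY, knnDist_eq_kRad hp, ncard_eq_card_filter_erase, cntY]

/-- The ℓ_∞ unit ball has area 4, so the correction log(4/c) vanishes. -/
theorem tKSG_eq_average (s : Fin N → ℝ × ℝ) :
    tKSG k δ s = average supNorm k (fun n => digamma (n + 1))
      (digamma k + Real.log N + Real.log (4 / 4)) (threshold δ N) s := by
  unfold tKSG average
  congr 1
  refine Finset.sum_congr rfl fun i _ => ?_
  rw [iotaKSG, loc, knnDist_eq_kRad lpDist_top, countX_eq_cntX lpDist_top,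
    countY_eq_cntY lpDist_top, div_self (by norm_num : (4 : ℝ) ≠ 0), Real.log_one, add_zero]

theorem ballVol_one : ballVol 1 = 2 := by
  have h : Real.Gamma (1 / 2 + 1) = 1 / 2 * √Real.pi := by
    rw [Real.Gamma_add_one (by norm_num), Real.Gamma_one_half_eq]
  have hpi : √Real.pi ≠ 0 := (Real.sqrt_pos.2 Real.pi_pos).ne'
  rw [ballVol, Nat.cast_one, h, ← Real.sqrt_eq_rpow]
  field_simp

theorem ballVol_two : ballVol (1 + 1) = Real.pi := by
  rw [ballVol]
  norm_num

/-- For the disc c = π, and log(4/π) is the logarithm of c₁c₁/c₂ in the estimator. -/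
theorem tBIKSG_eq_average (s : Fin N → ℝ × ℝ) :
    tBIKSG k δ s = average eucNorm k (fun n => Real.log n)
      (digamma k + Real.log N + Real.log (4 / Real.pi)) (threshold δ N) s := by
  unfold tBIKSG average
  congr 1
  refine Finset.sum_congr rfl fun i _ => ?_
  rw [iotaBIKSG, loc, knnDist_eq_kRad lpDist_two, countX_eq_cntX lpDist_two,
    countY_eq_cntY lpDist_two, ballVol_one, ballVol_two,
    show (2 : ℝ) * 2 = 4 by norm_num]

theorem integral_sample {Ω : Type*} [MeasurableSpace Ω] (P : Measure Ω)
    [IsProbabilityMeasure P] {Z : Fin N → Ω → ℝ × ℝ} (hZ : ∀ i, Measurable (Z i))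
    (hI : iIndepFun Z P) (hL : ∀ i, P.map (Z i) = law f) {F : (Fin N → ℝ × ℝ) → ℝ}
    (hF : Measurable F) :
    ∫ ω, F (fun i => Z i ω) ∂P = ∫ s, F s ∂(Measure.pi fun _ => law f) := by
  have h := (iIndepFun_iff_map_fun_eq_pi_map fun i => (hZ i).aemeasurable).1 hI
  simp_rw [hL] at h
  rw [← h, integral_map (measurable_pi_lambda _ hZ).aemeasurable hF.aestronglyMeasurable]

theorem Regular.mse_average_le (hM : 1 ≤ M) (hδ : 0 < δ) (hν : PlaneNorm ν c) {G : ℕ → ℝ}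
    (hG : LogLike G) (hk : 1 ≤ k) :
    ∃ (K : ℝ) (N₀ : ℕ), ∀ f, Regular M f → ∀ N : ℕ, N₀ ≤ N →
      ∀ {Ω : Type*} [MeasurableSpace Ω] (P : Measure Ω) [IsProbabilityMeasure P]
        (Z : Fin N → Ω → ℝ × ℝ),
        (∀ i, Measurable (Z i)) → iIndepFun Z P → (∀ i, P.map (Z i) = law f) →
        Integrable (fun ω => (average ν k G (digamma k + Real.log N + Real.log (4 / c))
          (threshold δ N) (fun i => Z i ω) - mutualInfo f) ^ 2) P ∧
        ∫ ω, (average ν k G (digamma k + Real.log N + Real.log (4 / c))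
          (threshold δ N) (fun i => Z i ω) - mutualInfo f) ^ 2 ∂P
            ≤ K * (Real.log N ^ ((2 * (k : ℝ) + 2) * (1 + δ)) / N) := by
  obtain ⟨q, rfl⟩ : ∃ q, k = q + 1 := ⟨k - 1, by omega⟩
  obtain ⟨K, N₀, h⟩ := exists_rate hν.pos hM hδ q
  refine ⟨K, N₀ + 3, fun f hf N hN Ω _ P _ Z hZ hI hL => ?_⟩
  -- Removing the centre and its k-th neighbour leaves m + 1 points, the successor form in which the
  -- binomial estimates are stated.
  obtain ⟨m, rfl⟩ : ∃ m, N = m + 3 := ⟨N - 3, by omega⟩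
  obtain ⟨g1, g2, g3, g4, g5, g6⟩ := h m (by omega)
  have hF : Measurable fun s : Fin (m + 3) → ℝ × ℝ =>
      average ν (q + 1) G (digamma ((q + 1 : ℕ) : ℝ) + Real.log ((m + 3 : ℕ) : ℝ) +
        Real.log (4 / c)) (threshold δ (m + 3)) s := measurable_average hν hk (by omega)
  have hF2 : Measurable fun s : Fin (m + 3) → ℝ × ℝ =>
      (average ν (q + 1) G (digamma ((q + 1 : ℕ) : ℝ) + Real.log ((m + 3 : ℕ) : ℝ) +
        Real.log (4 / c)) (threshold δ (m + 3)) s - mutualInfo f) ^ 2 :=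
    (hF.sub_const _).pow_const 2
  refine ⟨?_, ?_⟩
  · refine integrable_of_abs_le (hF2.comp (measurable_pi_lambda _ hZ))
      (B := (|digamma ((q + 1 : ℕ) : ℝ) +
      Real.log ((m + 3 : ℕ) : ℝ) + Real.log (4 / c)| + 2 * (Real.log ((m + 3 : ℕ) : ℝ) + 1) +
        |mutualInfo f|) ^ 2) fun ω => ?_
    rw [abs_pow]
    exact pow_le_pow_left₀ (abs_nonneg _) ((abs_sub _ _).trans
      (add_le_add (abs_average_le hν hG hk (by omega) _) le_rfl)) 2
  · rw [integral_sample P hZ hI hL hF2]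
    push_cast
    exact (hf.mse_le hν hG g1 g2 g3 g4 g5).trans g6

end Estimators

end KSG

end

/-! ### The theorem for both estimators -/

theorem mainTheorem10 (k : ℕ) (hk : 1 ≤ k) (δ : ℝ) (hδ : 0 < δ)
    (Ca Cb Cc Cd Ce Cf Cg Ch C0 : ℝ) (hC0 : 0 < C0) :
    ∃ (K : ℝ) (N₀ : ℕ), ∀ f : ℝ × ℝ → ℝ, KSG.IsPdf f →
      KSG.RateAssumption Ca Cb Cc Cd Ce Cf Cg Ch C0 f →
      ∀ N : ℕ, N₀ ≤ N →
      ∀ {Ω : Type*} [MeasurableSpace Ω] (P : Measure Ω) [IsProbabilityMeasure P]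
        (Z : Fin N → Ω → ℝ × ℝ),
        (∀ i, Measurable (Z i)) → iIndepFun Z P → (∀ i, P.map (Z i) = KSG.law f) →
        (Integrable (fun ω => (KSG.tKSG k δ (fun i => Z i ω) - KSG.mutualInfo f) ^ 2) P ∧
          ∫ ω, (KSG.tKSG k δ (fun i => Z i ω) - KSG.mutualInfo f) ^ 2 ∂P
            ≤ K * (Real.log N ^ ((2 * (k : ℝ) + 2) * (1 + δ)) / N)) ∧
        (Integrable (fun ω => (KSG.tBIKSG k δ (fun i => Z i ω) - KSG.mutualInfo f) ^ 2) P ∧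
          ∫ ω, (KSG.tBIKSG k δ (fun i => Z i ω) - KSG.mutualInfo f) ^ 2 ∂P
            ≤ K * (Real.log N ^ ((2 * (k : ℝ) + 2) * (1 + δ)) / N)) := by
  obtain ⟨M, hreg⟩ := KSG.RateAssumption.regular_M (Ca := Ca) (Cb := Cb) (Cc := Cc) (Cd := Cd)
    (Ce := Ce) (Cf := Cf) (Cg := Cg) (Ch := Ch) hC0
  -- The bound 1 ≤ M is only known once some f is given; if it fails, the class is empty and the
  -- claim is vacuous.
  by_cases hM : 1 ≤ M
  swap
  · exact ⟨0, 0, fun f hf hr => absurd (hreg f hf hr).one_le hM⟩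
  obtain ⟨K₁, N₁, h₁⟩ := KSG.Regular.mse_average_le hM hδ KSG.planeNorm_supNorm
    KSG.logLike_digamma hk
  obtain ⟨K₂, N₂, h₂⟩ := KSG.Regular.mse_average_le hM hδ KSG.planeNorm_eucNorm
    KSG.logLike_log hk
  refine ⟨max K₁ K₂, max N₁ N₂, fun f hf hr N hN Ω _ P _ Z hZ hI hL => ?_⟩
  have t₁ := h₁ f (hreg f hf hr) N ((le_max_left _ _).trans hN) P Z hZ hI hL
  have t₂ := h₂ f (hreg f hf hr) N ((le_max_right _ _).trans hN) P Z hZ hI hL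
  simp_rw [KSG.tKSG_eq_average, KSG.tBIKSG_eq_average]
  have hpos : 0 ≤ Real.log N ^ ((2 * (k : ℝ) + 2) * (1 + δ)) / N := by
    have := Real.log_natCast_nonneg N
    positivity
  exact ⟨⟨t₁.1, t₁.2.trans (mul_le_mul_of_nonneg_right (le_max_left _ _) hpos)⟩,
    ⟨t₂.1, t₂.2.trans (mul_le_mul_of_nonneg_right (le_max_right _ _) hpos)⟩⟩
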